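/- **Setting.** Let $\mathfrak g=\mathfrak{osp}(2|2)$, with even basis elements $f_3,h_1,h_2,e_3$ and odd basis elements $e_1,e_2,f_1,f_2$, where $$[e_1,e_2]=e_3,\ [f_1,f_2]=f_3,\ [h_2,e_1]=2e_1,\ [h_1,e_2]=2e_2,\ [h_1,f_2]=-2f_2,\ [h_2,f_1]=-2f_1,\ [e_1,f_1]=h_1,\ [e_2,f_2]=h_2,$$ realized in $\mathfrak{sl}(2|2)$ by $e_1=E_{24}+E_{31}$, $e_2=E_{14}+E_{32}$, $f_1=E_{13}-E_{42}$, $f_2=E_{23}-E_{41}$, and with the invariant form $(e_1|f_1)=(e_2|f_2)=-2$, $(e_3|f_3)=4$, $(h_1|h_2)=-4$ (other pairings of basis elements, up to supersymmetry, being $0$). Grade $\mathfrak g$ by $\mathfrak g_1=\langle e_2,e_3\rangle$, $\mathfrak g_0=\langle f_1,h_1,h_2,e_1\rangle$, $\mathfrak g_{-1}=\langle f_2,f_3\rangle$, and put $\mathfrak m=\mathfrak n=\mathfrak g_1$, $\mathfrak b_-=\mathfrak g_{-1}\oplus\mathfrak g_0$, $f=f_2$, $s=e_2$. Let $\mathcal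 P(\bar{\mathfrak g})=S(\mathbb C[D]\otimes\bar{\mathfrak g})$ be the superalgebra of super differential polynomials in the parity-reversed elements $\bar a$ ($a\in\mathfrak g$), with odd derivation $D$, written $u'=Du$. Give it the affine SUSY PVA $\chi$-bracket $\{\bar a_\chi\bar b\}_1=(-1)^{p(a)}(\overline{[a,b]}+\chi(a|b))$, extended by sesquilinearity $\{a_\chi Db\}=(-1)^{p(a)+1}(D+\chi)\{a_\chi b\}$ with $D\chi+\chi D=-2\chi^2$, skew-symmetry $\{a_\chi b\}=(-1)^{p(a)p(b)}\{b_{-\chi-D}a\}$, and the Leibniz rule $\{a_\chi bc\}=\{a_\chi b\}c+(-1)^{p(b)p(c)}\{a_\chi c\}b$. Let $\mathcal I$ be the differential ideal generated by $\bar m-(f|m)$, $m\in\mathfrak m$, let $\pi:\mathcal P(\bar{\mathfrak g})\to\mathcal P(\bar{\mathfrak g})/\mathcal I\cong\mathcal P:=S(\mathbb C[D]\otimes\bar{\mathfrak b}_-)$ be the projection, and let $\mathcal W=\{a\in\mathcal P:\{\bar n_\chi a\}_1\in\mathcal I[\chi]\ \forall n\in\mathfrak n\}$, with reduced bracket $\{a_\chi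 b\}_1^{\mathcal W}=\pi(\{a_\chi b\}_1)$. For $a\in\mathcal W$, $\smallint a$ is the class of $a$ in $\mathcal W/D\mathcal W$. Let $\hat{\mathfrak g}=\mathfrak g((z^{-1}))$. On $\hat{\mathfrak g}\otimes\mathcal P$ (completed in $z^{-1}$) put $[a\otimes u,b\otimes v]=(-1)^{p(b)p(u)}[a,b]\otimes uv$, $[D,a\otimes u]=(-1)^{p(a)}a\otimes u'$ and $(az^m\otimes u|bz^n\otimes v)=(-1)^{p(b)p(u)}\delta_{m+n,0}(a|b)uv$. Let $$\mathcal L_u=D+e_3\otimes\tfrac{\bar f_3}{4}-e_2\otimes\tfrac{\bar f_2}{2}-e_1\otimes\tfrac{\bar f_1}{2}-h_1\otimes\tfrac{\bar h_2}{4}-h_2\otimes\tfrac{\bar h_1}{4}+f_1\otimes\tfrac{\bar e_1}{2}+f_2\otimes1$$ and define $w_1,w_3$ (even) and $w_2,w_4$ (odd) in $\mathcal P$ by the canonical form $$e^{\mathrm{ad}\,N}\mathcal L_u=D+e_3\otimes w_4+e_2\otimes w_3+h_1\otimes w_2+f_1\otimes w_1+f_2\otimes1,\qquad N\in(\mathfrak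 n\otimes\mathcal P)_{\bar0}.$$ Let $\Lambda=f_2+ze_2$ and $\mathcal L^c=D+e_3\otimes w_4+e_2\otimes w_3+h_1\otimes w_2+f_1\otimes w_1+\Lambda\otimes1$. Give $z$ degree $-2$, and let $T^c$ be the even element, with components of positive degree only, of $\operatorname{im}(\mathrm{ad}\,\Lambda^2)\otimes\mathcal W$ such that $e^{\mathrm{ad}\,T^c}[\mathcal L^c,\mathcal L^c]/2=D^2+H^c+\Lambda^2\otimes1$ with $H^c\in\ker(\mathrm{ad}\,\Lambda^2)\otimes\mathcal W$. Define $K^c$ by $e^{\mathrm{ad}\,T^c}\mathcal L^c=D+K^c+\Lambda\otimes1$, let $\rho_n=(K^c|h_2\otimes z^n)$ for $n\ge0$, and consider the hierarchy $$\frac{dw_t}{dt_n}=\{\smallint\rho_n{}_\chi w_t\}_1^{\mathcal W}\big|_{\chi=0},\qquad t=1,2,3,4.$$ **Proposition.** Data $N,w_1,\dots,w_4,T^c,H^c,K^c$ as above exist, and for all such data $w_1,\dots,w_4\in\mathcal W$ and the following hold. The first two systems of equations of the hierarchy are $$\frac{dw_1}{dt_0}=2w_1,\quad\frac{dw_2}{dt_0}=0,\quad\frac{dw_3}{dt_0}=0,\quad\frac{dw_4}{dt_0}=-2w_4,$$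 and $$\frac{dw_1}{dt_1}=w_1''-2(w_1w_2)'-2w_1w_3,\quad\frac{dw_2}{dt_1}=0,\quad\frac{dw_3}{dt_1}=-8w_1w_2w_4,\quad\frac{dw_4}{dt_1}=w_4''+2w_2w_4'+2w_3w_4.$$ The first three integrals of motion of the hierarchy are, in $\mathcal W/D\mathcal W$, $$\smallint\rho_0=-\smallint4w_2,\qquad\smallint\rho_1=4\smallint w_1w_4,\qquad\smallint\rho_2=\smallint\bigl(2w_1''w_4-4(w_1w_2)'w_4-4w_1w_3w_4\bigr).$$ -/

import Mathlib

open Filter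

noncomputable section

/-! Superalgebras of super differential polynomials -/

/-- The supercommutation relations `x y = (-1)^{p(x) p(y)} y x` between the variables
`u_i^{(n)}`, `(i, n) ∈ ι × ℕ`, where `u_i^{(n)}` has parity `p i + n` (the derivation is odd). -/
inductive SuperRel {ι : Type} (p : ι → ℕ) :
    FreeAlgebra ℂ (ι × ℕ) → FreeAlgebra ℂ (ι × ℕ) → Prop
  | supercomm (x y : ι × ℕ) : SuperRel p (FreeAlgebra.ι ℂ x * FreeAlgebra.ι ℂ y)
      ((-1 : ℂ) ^ ((p x.1 + x.2) * (p y.1 + y.2)) • (FreeAlgebra.ι ℂ y * FreeAlgebra.ι ℂ x))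

/-- `S(ℂ[D] ⊗ V)`: the free supercommutative algebra on the variables `u_i^{(n)} = D^n u_i`,
where `u_i` has parity `p i`. -/
abbrev SuperPoly {ι : Type} (p : ι → ℕ) : Type := RingQuot (SuperRel p)

namespace SuperPoly

variable {ι : Type} {p : ι → ℕ}

/-- The variable `u_i^{(n)}`. -/
def gen (p : ι → ℕ) (i : ι) (n : ℕ) : SuperPoly p :=
  RingQuot.mkAlgHom ℂ (SuperRel p) (FreeAlgebra.ι ℂ (i, n))

theorem gen_mul_gen (i j : ι) (m n : ℕ) :
    gen p i m * gen p j n = (-1 : ℂ) ^ ((p i + m) * (p j + n)) • (gen p j n * gen p i m) := by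
  have h := RingQuot.mkAlgHom_rel ℂ (SuperRel.supercomm (p := p) (i, m) (j, n))
  simpa [gen] using h

/-- Algebra homomorphisms out of `SuperPoly p`: images of the variables that satisfy the
supercommutation relations. -/
def lift {B : Type} [Ring B] [Algebra ℂ B] (v : ι → ℕ → B)
    (hv : ∀ i m j n, v i m * v j n = (-1 : ℂ) ^ ((p i + m) * (p j + n)) • (v j n * v i m)) :
    SuperPoly p →ₐ[ℂ] B :=
  RingQuot.liftAlgHom ℂ ⟨FreeAlgebra.lift ℂ (fun x => v x.1 x.2), by
    rintro _ _ ⟨x, y⟩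
    simpa using hv x.1 x.2 y.1 y.2⟩

theorem lift_gen {B : Type} [Ring B] [Algebra ℂ B] (v : ι → ℕ → B)
    (hv : ∀ i m j n, v i m * v j n = (-1 : ℂ) ^ ((p i + m) * (p j + n)) • (v j n * v i m))
    (i : ι) (n : ℕ) : lift (p := p) v hv (gen p i n) = v i n := by
  simp [lift, gen]

theorem induction {C : SuperPoly p → Prop} (hs : ∀ c : ℂ, C (algebraMap ℂ _ c))
    (hg : ∀ i n, C (gen p i n)) (ha : ∀ a b, C a → C b → C (a + b))
    (hm : ∀ a b, C a → C b → C (a * b)) (a : SuperPoly p) : C a := by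
  obtain ⟨x, rfl⟩ := RingQuot.mkAlgHom_surjective ℂ (SuperRel p) a
  induction x using FreeAlgebra.induction with
  | grade0 r => simpa using hs r
  | grade1 x => exact hg x.1 x.2
  | mul a b h1 h2 => simpa using hm _ _ h1 h2
  | add a b h1 h2 => simpa using ha _ _ h1 h2

/-- The parity automorphism: `a ↦ (-1)^{p(a)} a` on homogeneous elements. -/
def parityAut : SuperPoly p →ₐ[ℂ] SuperPoly p :=
  lift (fun i n => (-1 : ℂ) ^ (p i + n) • gen p i n) (by
    intro i m j n
    simp only [smul_mul_smul_comm]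
    rw [gen_mul_gen, smul_smul, smul_smul]
    congr 1
    ring)

/-- `a` is homogeneous of parity `k` (mod 2). -/
def IsHomogeneous (k : ℕ) (a : SuperPoly p) : Prop := parityAut a = (-1 : ℂ) ^ k • a

theorem parityAut_gen (i : ι) (n : ℕ) :
    parityAut (gen p i n) = (-1 : ℂ) ^ (p i + n) • gen p i n := lift_gen _ _ i n

theorem parityAut_parityAut (a : SuperPoly p) : parityAut (parityAut a) = a := by
  induction a using induction with
  | hs c => simp
  | hg i n =>
    rw [parityAut_gen, map_smul, parityAut_gen, smul_smul, ← pow_add, ← two_mul, pow_mul]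
    simp
  | ha a b h1 h2 => simp [h1, h2]
  | hm a b h1 h2 => simp [h1, h2]

/-- The component of parity `k` (mod 2) of `a`. -/
def parityPart (k : ℕ) (a : SuperPoly p) : SuperPoly p :=
  (1 / 2 : ℂ) • (a + (-1 : ℂ) ^ k • parityAut a)

theorem isHomogeneous_parityPart (k : ℕ) (a : SuperPoly p) :
    IsHomogeneous k (parityPart k a) := by
  have h : (-1 : ℂ) ^ k * (-1 : ℂ) ^ k = 1 := by rw [← mul_pow]; simp
  simp only [IsHomogeneous, parityPart, map_smul, map_add, parityAut_parityAut]
  rw [smul_comm ((-1 : ℂ) ^ k) (1 / 2 : ℂ), smul_add ((-1 : ℂ) ^ k), smul_smul ((-1 : ℂ) ^ k), h,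
    one_smul, add_comm (parityAut a)]

theorem gen_mul_of_isHomogeneous (i : ι) (n k : ℕ) (a : SuperPoly p) (ha : IsHomogeneous k a) :
    gen p i n * a = (-1 : ℂ) ^ ((p i + n) * k) • (a * gen p i n) := by
  have key : ∀ a : SuperPoly p,
      gen p i n * a = (parityAut ^ (p i + n) : SuperPoly p →ₐ[ℂ] SuperPoly p) a * gen p i n := by
    intro a
    induction a using induction with
    | hs c => simp [Algebra.commutes]
    | hg j m =>
      have h : ∀ r : ℕ, (parityAut ^ r : SuperPoly p →ₐ[ℂ] SuperPoly p) (gen p j m)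
          = (-1 : ℂ) ^ (r * (p j + m)) • gen p j m := by
        intro r
        induction r with
        | zero => simp
        | succ r ih =>
          rw [pow_succ', AlgHom.mul_apply, ih, map_smul, parityAut_gen, smul_smul]
          congr 1
          ring
      rw [h, gen_mul_gen, smul_mul_assoc]
    | ha a b h1 h2 => simp [mul_add, add_mul, h1, h2]
    | hm a b h1 h2 => rw [← mul_assoc, h1, mul_assoc, h2, ← mul_assoc, map_mul]
  have h : ∀ r : ℕ, (parityAut ^ r : SuperPoly p →ₐ[ℂ] SuperPoly p) a
      = (-1 : ℂ) ^ (r * k) • a := by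
    intro r
    induction r with
    | zero => simp
    | succ r ih =>
      rw [pow_succ', AlgHom.mul_apply, ih, map_smul, ha, smul_smul]
      congr 1
      ring
  rw [key, h, smul_mul_assoc]

/-- The algebra homomorphism `a ↦ (σ^q(a), d(a); 0, a)` into upper triangular matrices
(`σ` the parity automorphism) that encodes the superderivation `d` below. -/
def superDerHom (q : ℕ) (v : ι → ℕ → SuperPoly p) :
    SuperPoly p →ₐ[ℂ] Matrix (Fin 2) (Fin 2) (SuperPoly p) :=
  lift (fun i n => !![(-1 : ℂ) ^ (q * (p i + n)) • gen p i n, parityPart (q + (p i + n)) (v i n);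
      0, gen p i n]) (by
    intro i m j n
    have h1 := gen_mul_of_isHomogeneous i m _ _ (isHomogeneous_parityPart (q + (p j + n)) (v j n))
    have h2 := gen_mul_of_isHomogeneous j n _ _ (isHomogeneous_parityPart (q + (p i + m)) (v i m))
    have sq : ∀ r : ℕ, (-1 : ℂ) ^ r * (-1 : ℂ) ^ r = 1 := by
      intro r; rw [← mul_pow]; simp
    ext a b
    fin_cases a <;> fin_cases b
    · simp only [Matrix.mul_fin_two]
      simp only [Fin.zero_eta, Matrix.of_apply, Matrix.cons_val', Matrix.cons_val_zero,
        Matrix.cons_val_fin_one, mul_zero, add_zero, Matrix.smul_apply, smul_mul_smul_comm]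
      rw [gen_mul_gen, smul_smul, smul_smul]
      congr 1
      ring
    · simp only [Matrix.mul_fin_two]
      simp only [Fin.zero_eta, Fin.mk_one, Matrix.of_apply, Matrix.cons_val', Matrix.cons_val_zero,
        Matrix.cons_val_one, Matrix.cons_val_fin_one, Matrix.smul_apply, smul_mul_assoc]
      rw [h1, h2, smul_add, smul_smul, smul_smul, smul_smul, add_comm]
      congr 1
      · rw [← pow_add, ← pow_add, show (p i + m) * (p j + n) + q * (p j + n) +
          (p j + n) * (q + (p i + m)) = 2 * ((p i + m) * (p j + n) + q * (p j + n)) by ring,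
          pow_mul]
        simp
      · congr 1
        have := sq (q * (p i + m))
        calc (-1 : ℂ) ^ (q * (p i + m)) * (-1 : ℂ) ^ ((p i + m) * (q + (p j + n)))
            = ((-1 : ℂ) ^ (q * (p i + m)) * (-1 : ℂ) ^ (q * (p i + m))) *
              (-1 : ℂ) ^ ((p i + m) * (p j + n)) := by ring
          _ = _ := by rw [this, one_mul]
    · simp
    · simp only [Matrix.mul_fin_two]
      simp only [Fin.mk_one, Matrix.of_apply, Matrix.cons_val', Matrix.cons_val_one,
        Matrix.cons_val_fin_one, zero_mul, zero_add, Matrix.smul_apply]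
      rw [gen_mul_gen])

/-- The superderivation `d` of parity `q`, that is `d(ab) = d(a) b + (-1)^{q p(a)} a d(b)`, with
`d(u_i^{(n)}) = v i n`. A superderivation of parity `q` maps `u_i^{(n)}` to an element of parity
`q + p(u_i^{(n)})`; only the component of `v i n` of this parity is used. -/
def superDer (q : ℕ) (v : ι → ℕ → SuperPoly p) : SuperPoly p →ₗ[ℂ] SuperPoly p where
  toFun a := superDerHom q v a 0 1
  map_add' a b := by simp
  map_smul' c a := by simp

theorem superDer_gen (q : ℕ) (v : ι → ℕ → SuperPoly p) (i : ι) (n : ℕ)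
    (h : IsHomogeneous (q + (p i + n)) (v i n)) : superDer q v (gen p i n) = v i n := by
  have sq : ∀ r : ℕ, (-1 : ℂ) ^ r * (-1 : ℂ) ^ r = 1 := by
    intro r; rw [← mul_pow]; simp
  have : superDerHom q v (gen p i n) = _ := lift_gen _ _ i n
  simp only [superDer, LinearMap.coe_mk, AddHom.coe_mk, this]
  simp only [Matrix.of_apply, Matrix.cons_val', Matrix.cons_val_zero, Matrix.cons_val_one,
    Matrix.cons_val_fin_one, parityPart]
  rw [h, smul_smul, sq, one_smul, ← two_smul ℂ, smul_smul]
  norm_num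

/-- The odd derivation `D`, with `D(u_i^{(n)}) = u_i^{(n+1)}`. -/
def D : SuperPoly p →ₗ[ℂ] SuperPoly p := superDer 1 (fun i n => gen p i (n + 1))

theorem D_gen (i : ι) (n : ℕ) : D (gen p i n) = gen p i (n + 1) := by
  apply superDer_gen
  rw [IsHomogeneous, parityAut_gen]
  congr 1
  ring

/-! `χ`-brackets. An element `∑ χ^n a_n` of `𝒫[χ]` is given by its coefficients `n ↦ a_n`. -/

/-- Left multiplication by `χ`. -/
def chiMul (F : ℕ → SuperPoly p) : ℕ → SuperPoly p
  | 0 => 0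
  | n + 1 => F n

/-- The action of `D` on `𝒫[χ]`, from `D χ = - χ D - 2 χ^2`:
`D χ^{2k} a = χ^{2k} D a` and `D χ^{2k+1} a = - χ^{2k+1} D a - 2 χ^{2k+2} a`. -/
def chiD (F : ℕ → SuperPoly p) : ℕ → SuperPoly p
  | 0 => D (F 0)
  | n + 1 => (-1 : ℂ) ^ (n + 1) • D (F (n + 1)) - (if Even (n + 1) then (2 : ℂ) else 0) • F n

/-- The action of `χ + D` on `𝒫[χ]`. -/
def chiPlusD (F : ℕ → SuperPoly p) : ℕ → SuperPoly p := chiMul F + chiD F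

/-- `∑_n (-D-χ)^n F_n`, the substitution of `- χ - D` for `χ` (a finite sum for `F ∈ 𝒫[χ]`). -/
def chiFlip (F : ℕ → SuperPoly p) : ℕ → SuperPoly p := fun k =>
  ∑ᶠ n : ℕ, (-1 : ℂ) ^ n • (chiPlusD^[n] (Pi.single 0 (F n))) k

/-- The map `{a_χ ·}`, for `a` of parity `q`, determined by `{a_χ u_j} = V j`, right
sesquilinearity `{a_χ Db} = (-1)^{q+1} (D+χ) {a_χ b}` and the right Leibniz rule
`{a_χ bc} = {a_χ b} c + (-1)^{p(b)p(c)} {a_χ c} b`. The latter says that the coefficient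
`a_{(n)}` of `χ^n` is a superderivation of parity `q + n + 1`. -/
def rightExtend (q : ℕ) (V : ι → ℕ → SuperPoly p) (b : SuperPoly p) : ℕ → SuperPoly p :=
  fun n => superDer (q + n + 1) (fun j k => (-1 : ℂ) ^ (k * (q + 1)) • (chiPlusD^[k] (V j)) n) b

/-- The SUSY PVA `χ`-bracket on `S(ℂ[D] ⊗ V)` with given brackets `{u_i χ u_j} = B i j` between
the generators: the brackets `{u_j χ a}` come from the right Leibniz rule and right
sesquilinearity, then `{a_χ u_j} = (-1)^{p(a)p(u_j)} {u_j _{-χ-D} a}` by skew-symmetry, and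
finally `{a_χ b}` from the right Leibniz rule and right sesquilinearity again, for each of the two
homogeneous components of `a`. -/
def chiBracket (B : ι → ι → ℕ → SuperPoly p) (a b : SuperPoly p) : ℕ → SuperPoly p :=
  ∑ q : Fin 2, rightExtend q (fun j => (-1 : ℂ) ^ ((q : ℕ) * p j) •
    chiFlip (rightExtend (p j) (B j) (parityPart q a))) b

end SuperPoly

/-! The Lie superalgebra `𝔬𝔰𝔭(2|2)` -/

/-- A homogeneous basis of `𝔬𝔰𝔭(2|2)`. -/
inductive OspBasis : Type
  | f3 | f2 | f1 | h1 | h2 | e1 | e2 | e3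
  deriving DecidableEq

namespace OspBasis

instance : Fintype OspBasis :=
  ⟨{f3, f2, f1, h1, h2, e1, e2, e3}, by intro x; cases x <;> decide⟩

/-- Parity: `f₃, h₁, h₂, e₃` are even and `f₁, f₂, e₁, e₂` are odd. -/
def parity : OspBasis → ℕ
  | f3 | h1 | h2 | e3 => 0
  | f2 | f1 | e1 | e2 => 1

/-- The `ℤ`-grading: `𝔤_{-1} = ⟨f₂, f₃⟩`, `𝔤_0 = ⟨f₁, h₁, h₂, e₁⟩`, `𝔤_1 = ⟨e₂, e₃⟩`. -/
def deg : OspBasis → ℤ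
  | f3 | f2 => -1
  | f1 | h1 | h2 | e1 => 0
  | e2 | e3 => 1

/-- The brackets between basis elements: `[a, b] = ∑ n • c` over the listed pairs `(n, c)`. -/
def bracketList : OspBasis → OspBasis → List (ℤ × OspBasis)
  | f3, h1 => [(2, f3)] | f3, h2 => [(2, f3)]
  | f3, e1 => [(2, f2)] | f3, e2 => [(2, f1)]
  | f3, e3 => [(2, h1), (2, h2)]
  | f2, f1 => [(1, f3)] | f2, h1 => [(2, f2)] | f2, e2 => [(1, h2)] | f2, e3 => [(2, e1)]
  | f1, f2 => [(1, f3)] | f1, h2 => [(2, f1)] | f1, e1 => [(1, h1)] | f1, e3 => [(2, e2)]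
  | h1, f3 => [(-2, f3)] | h1, f2 => [(-2, f2)] | h1, e2 => [(2, e2)] | h1, e3 => [(2, e3)]
  | h2, f3 => [(-2, f3)] | h2, f1 => [(-2, f1)] | h2, e1 => [(2, e1)] | h2, e3 => [(2, e3)]
  | e1, f3 => [(-2, f2)] | e1, f1 => [(1, h1)] | e1, h2 => [(-2, e1)] | e1, e2 => [(1, e3)]
  | e2, f3 => [(-2, f1)] | e2, f2 => [(1, h2)] | e2, h1 => [(-2, e2)] | e2, e1 => [(1, e3)]
  | e3, f3 => [(-2, h1), (-2, h2)]
  | e3, f2 => [(-2, e1)] | e3, f1 => [(-2, e2)] | e3, h1 => [(-2, e3)] | e3, h2 => [(-2, e3)]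
  | _, _ => []

/-- The structure constants: the coefficient of `c` in `[a, b]`. -/
def structConst (a b c : OspBasis) : ℤ :=
  ((bracketList a b).map (fun x => if x.2 = c then x.1 else 0)).sum

/-- The invariant even supersymmetric bilinear form `(a|b)`. -/
def form : OspBasis → OspBasis → ℤ
  | e1, f1 => -2 | f1, e1 => 2
  | e2, f2 => -2 | f2, e2 => 2
  | e3, f3 => 4 | f3, e3 => 4
  | h1, h2 => -4 | h2, h1 => -4
  | _, _ => 0

/-- The realization of the basis by matrices in `𝔰𝔩(2|2)`. -/
def toMatrix : OspBasis → Matrix (Fin 4) (Fin 4) ℤ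
  | e1 => !![0, 0, 0, 0; 0, 0, 0, 1; 1, 0, 0, 0; 0, 0, 0, 0]
  | e2 => !![0, 0, 0, 1; 0, 0, 0, 0; 0, 1, 0, 0; 0, 0, 0, 0]
  | e3 => !![0, 0, 0, 0; 0, 0, 0, 0; 0, 0, 0, 2; 0, 0, 0, 0]
  | f1 => !![0, 0, 1, 0; 0, 0, 0, 0; 0, 0, 0, 0; 0, -1, 0, 0]
  | f2 => !![0, 0, 0, 0; 0, 0, 1, 0; 0, 0, 0, 0; -1, 0, 0, 0]
  | f3 => !![0, 0, 0, 0; 0, 0, 0, 0; 0, 0, 0, 0; 0, 0, -2, 0]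
  | h1 => !![1, 0, 0, 0; 0, -1, 0, 0; 0, 0, 1, 0; 0, 0, 0, -1]
  | h2 => !![-1, 0, 0, 0; 0, 1, 0, 0; 0, 0, 1, 0; 0, 0, 0, -1]

/-- The structure constants are those of the supercommutator of the matrices. -/
theorem supercommutator_toMatrix : ∀ a b : OspBasis,
    toMatrix a * toMatrix b - (-1) ^ (parity a * parity b) * (toMatrix b * toMatrix a)
      = ∑ c, structConst a b c • toMatrix c := by
  decide +kernel

/-- The form is the supertrace form of the matrices. -/
theorem form_eq_supertrace : ∀ a b : OspBasis, form a b =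
    (toMatrix a * toMatrix b) 0 0 + (toMatrix a * toMatrix b) 1 1
      - (toMatrix a * toMatrix b) 2 2 - (toMatrix a * toMatrix b) 3 3 := by
  decide +kernel

/-- The parity of `ā`, opposite to the parity of `a`. -/
def revParity (a : OspBasis) : ℕ := parity a + 1

end OspBasis

namespace Osp

open OspBasis

/-- `𝒫(𝔤̄) = S(ℂ[D] ⊗ 𝔤̄)` for `𝔤 = 𝔬𝔰𝔭(2|2)`. -/
abbrev PolyG : Type := SuperPoly revParity

/-- `D^n ā` in `𝒫(𝔤̄)`. -/
abbrev bar (a : OspBasis) (n : ℕ) : PolyG := SuperPoly.gen revParity a n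

/-- The affine bracket `{ā_χ b̄}₁ = (-1)^{p(a)} (\overline{[a,b]} + χ (a|b))` on generators. -/
def affineGen (a b : OspBasis) : ℕ → PolyG
  | 0 => (-1 : ℂ) ^ parity a • ∑ c, structConst a b c • bar c 0
  | 1 => (-1 : ℂ) ^ parity a • algebraMap ℂ PolyG (form a b : ℂ)
  | _ => 0

/-- The first affine SUSY PVA bracket on `𝒫(𝔤̄)`; `bracket₁ a b n` is the coefficient of `χ^n` in
`{a_χ b}₁`. -/
def bracket₁ (a b : PolyG) : ℕ → PolyG := SuperPoly.chiBracket affineGen a b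

/-- The differential subalgebra `𝒫 = S(ℂ[D] ⊗ 𝔟̄_-)` of `𝒫(𝔤̄)`, where `𝔟_- = 𝔤_{-1} ⊕ 𝔤_0`. -/
def polyB : Subalgebra ℂ PolyG := Algebra.adjoin ℂ {x | ∃ a n, deg a ≤ 0 ∧ x = bar a n}

/-- The values of `proj` on generators. -/
def projGen (a : OspBasis) (n : ℕ) : PolyG :=
  if deg a ≤ 0 then bar a n
  else if n = 0 then algebraMap ℂ PolyG (form f2 a : ℂ) else 0

/-- The projection `π : 𝒫(𝔤̄) → 𝒫(𝔤̄)/ℐ = 𝒫`, where `ℐ` is the differential ideal generated by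
`m̄ - (f|m)`, `m ∈ 𝔪 = 𝔤_1`, and `f = f₂`: the substitution `m̄ ↦ (f|m)` and `m̄^{(n)} ↦ 0` for
`n ≥ 1`, for all `m ∈ 𝔪`. -/
def proj : PolyG →ₐ[ℂ] PolyG :=
  SuperPoly.lift projGen (by
    have hs : ∀ (a : OspBasis) (n : ℕ), ¬ deg a ≤ 0 → projGen a n = 0 ∨
        (Even (revParity a + n) ∧ ∃ c : ℂ, projGen a n = algebraMap ℂ PolyG c) := by
      intro a n h
      by_cases hn : n = 0
      · subst hn
        cases a <;> simp_all [projGen, deg, form, revParity, parity]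
      · left
        simp [projGen, h, hn]
    intro a m b n
    by_cases ha : deg a ≤ 0
    · by_cases hb : deg b ≤ 0
      · simp only [projGen, ha, hb, if_true]
        exact SuperPoly.gen_mul_gen a b m n
      · rcases hs b n hb with h | ⟨he, c, h⟩
        · simp [h]
        · rw [h, (he.mul_left _).neg_one_pow, one_smul, Algebra.commutes]
    · rcases hs a m ha with h | ⟨he, c, h⟩
      · simp [h]
      · rw [h, (he.mul_right _).neg_one_pow, one_smul, Algebra.commutes])

/-- The generalized `W`-algebra `𝒲(𝔤, 𝔫, 𝔪, f)`, `𝔫 = 𝔪 = 𝔤_1`, `f = f₂`, as a subspace of `𝒫`: all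
`a` with `{n̄_χ a}₁ ∈ ℐ[χ]` for `n ∈ 𝔫`. -/
def wAlgebra : Set PolyG :=
  {a | a ∈ polyB ∧ ∀ n : OspBasis, deg n = 1 → ∀ k, proj (bracket₁ (bar n 0) a k) = 0}

/-- The derivation `φ ↦ {∫h _χ φ}₁|_{χ=0}`, where `{ _χ }₁` is the first reduced bracket on
`𝒲`. -/
def flow (h φ : PolyG) : PolyG := proj (bracket₁ h φ 0)

/-- Equality `∫a = ∫b` of functionals in `𝒲/D𝒲`. -/
def EqFunctional (a b : PolyG) : Prop := ∃ c ∈ wAlgebra, a - b = SuperPoly.D c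

/-! Lax operators. An element `∑ a ⊗ X_a` of `ĝ ⊗ 𝒫(𝔤̄)`, `ĝ = 𝔤((z⁻¹))`, is given by its
coordinates `X_a ∈ 𝒫(𝔤̄)((z⁻¹))`, and `HahnSeries ℤ PolyG` is used with the variable `z⁻¹`: the
coefficient of index `n` is that of `z^{-n}`. -/

/-- `ĝ ⊗ 𝒫(𝔤̄)`, completed with respect to `z⁻¹`. -/
abbrev LoopG : Type := OspBasis → HahnSeries ℤ PolyG

/-- `a z^k ⊗ u`. -/
def tens (a : OspBasis) (k : ℤ) (u : PolyG) : LoopG := Pi.single a (HahnSeries.single (-k) u)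

/-- The bracket `[a z^m ⊗ u, b z^n ⊗ v] = (-1)^{p(b)p(u)} [a,b] z^{m+n} ⊗ uv`. -/
def loopBracket (X Y : LoopG) : LoopG := fun c =>
  ∑ a, ∑ b, structConst a b c •
    ((X a).map (SuperPoly.parityAut ^ parity b : PolyG →ₐ[ℂ] PolyG) * Y b)

/-- The form `(a z^m ⊗ u | b z^n ⊗ v) = (-1)^{p(b)p(u)} δ_{m+n,0} (a|b) uv`. -/
def loopForm (X Y : LoopG) : PolyG :=
  (∑ a, ∑ b, form a b •
    ((X a).map (SuperPoly.parityAut ^ parity b : PolyG →ₐ[ℂ] PolyG) * Y b)).coeff 0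

/-- `[D, a z^m ⊗ u] = (-1)^{p(a)} a z^m ⊗ u'`. -/
def loopD (X : LoopG) : LoopG := fun a => (-1 : ℂ) ^ parity a • (X a).map SuperPoly.D

/-- All coefficients of `X` lie in `S`. -/
def CoeffsIn (S : Set PolyG) (X : LoopG) : Prop := ∀ a n, (X a).coeff n ∈ S

/-- `X` is homogeneous of parity `k`. -/
def LoopHomogeneous (k : ℕ) (X : LoopG) : Prop :=
  ∀ a n, SuperPoly.IsHomogeneous (k + parity a) ((X a).coeff n)

/-- All components of `X` have positive degree, where `z` has degree `-2`. -/
def PositiveDegree (X : LoopG) : Prop := ∀ a n, deg a + 2 * n ≤ 0 → (X a).coeff n = 0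

/-- The partial sum `X + ∑_{k<N} (ad T)^k ([T, ∂ + X]) / (k+1)!` of `e^{ad T}(∂ + X) - ∂`, for an
even `T`, where `∂ = D` or `∂ = D²` acts on `ĝ ⊗ 𝒫(𝔤̄)` by `d = [∂, ·]`, so `[T, ∂] = - d T`. -/
def expAdPartial (d : LoopG → LoopG) (T X : LoopG) (N : ℕ) : LoopG :=
  X + ∑ k ∈ Finset.range N,
    (1 / (k + 1).factorial : ℂ) • (loopBracket T)^[k] (loopBracket T X - d T)

/-- `e^{ad T}(∂ + X) = ∂ + Y`: the coefficients of the partial sums are eventually those of `Y`. -/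
def ExpAdEq (d : LoopG → LoopG) (T X Y : LoopG) : Prop :=
  ∀ a n, ∀ᶠ N in atTop, (expAdPartial d T X N a).coeff n = (Y a).coeff n

/-- `𝒬_u`, from the universal Lax operator `ℒ_u = D + 𝒬_u + f₂ ⊗ 1`. -/
def universalQ : LoopG :=
  (1 / 4 : ℂ) • tens e3 0 (bar f3 0) - (1 / 2 : ℂ) • tens e2 0 (bar f2 0)
    - (1 / 2 : ℂ) • tens e1 0 (bar f1 0) - (1 / 4 : ℂ) • tens h1 0 (bar h2 0)
    - (1 / 4 : ℂ) • tens h2 0 (bar h1 0) + (1 / 2 : ℂ) • tens f1 0 (bar e1 0)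

/-- `e₃ ⊗ w₄ + e₂ ⊗ w₃ + h₁ ⊗ w₂ + f₁ ⊗ w₁`. -/
def canonicalQ (w₁ w₂ w₃ w₄ : PolyG) : LoopG :=
  tens e3 0 w₄ + tens e2 0 w₃ + tens h1 0 w₂ + tens f1 0 w₁

/-- `Λ = f + z s` with `f = f₂` and `s = e₂`. -/
def Lam : LoopG := tens f2 0 1 + tens e2 1 1

/-- `Λ² = [Λ, Λ]/2`. -/
def LamSq : LoopG := (1 / 2 : ℂ) • loopBracket Lam Lam

/-- `D + canonicalQ w₁ w₂ w₃ w₄ + f₂ ⊗ 1 = e^{ad N} ℒ_u` is the canonical form of the universal Lax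
operator, with `N = e₂ ⊗ N₂ + e₃ ⊗ N₃` an even element of `𝔫 ⊗ 𝒫`. -/
structure IsCanonicalForm (N₂ N₃ w₁ w₂ w₃ w₄ : PolyG) : Prop where
  gauge_mem : N₂ ∈ polyB ∧ N₃ ∈ polyB
  gauge_even : LoopHomogeneous 0 (tens e2 0 N₂ + tens e3 0 N₃)
  canonical_mem : w₁ ∈ polyB ∧ w₂ ∈ polyB ∧ w₃ ∈ polyB ∧ w₄ ∈ polyB
  canonical_odd : LoopHomogeneous 1 (canonicalQ w₁ w₂ w₃ w₄)
  eq : ExpAdEq loopD (tens e2 0 N₂ + tens e3 0 N₃) (universalQ + tens f2 0 1)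
    (canonicalQ w₁ w₂ w₃ w₄ + tens f2 0 1)

/-- With `ℒ^c = D + canonicalQ w₁ w₂ w₃ w₄ + Λ ⊗ 1`, the triple `(T, H, K)` satisfies
`e^{ad T} [ℒ^c, ℒ^c]/2 = D² + H + Λ² ⊗ 1` and `e^{ad T} ℒ^c = D + K + Λ ⊗ 1`, where `T` is even, of
positive degree and in `im(ad Λ²) ⊗ 𝒲`, and `H` is in `ker(ad Λ²) ⊗ 𝒲`. Note that
`[D + X, D + X]/2 = D² + [D, X] + [X, X]/2` for odd `X`. -/
structure IsDressing (w₁ w₂ w₃ w₄ : PolyG) (T H K : LoopG) : Prop where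
  even : LoopHomogeneous 0 T
  pos : PositiveDegree T
  mem_im : ∃ Z : LoopG, CoeffsIn wAlgebra Z ∧ T = loopBracket LamSq Z
  mem_ker : CoeffsIn wAlgebra H ∧ loopBracket LamSq H = 0
  square : ExpAdEq (fun X => loopD (loopD X)) T
    (loopD (canonicalQ w₁ w₂ w₃ w₄ + Lam) + (1 / 2 : ℂ) •
      loopBracket (canonicalQ w₁ w₂ w₃ w₄ + Lam) (canonicalQ w₁ w₂ w₃ w₄ + Lam))
    (H + LamSq)
  lax : ExpAdEq loopD T (canonicalQ w₁ w₂ w₃ w₄ + Lam) (K + Lam)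

/-- The Hamiltonian density `ρ_n = (K^c | h₂ ⊗ z^n)`. -/
def density (K : LoopG) (n : ℕ) : PolyG := loopForm K (tens h2 n 1)

end Osp

end

/-!
The proof rests on two mechanisms: exact symbolic computation in `S(ℂ[D] ⊗ V)`, and the degree
filtrations of the loop algebra.

*Symbolic computation.* `SuperPoly.Formal` represents elements of a superalgebra of super
differential polynomials by rational combinations of words. Superderivations, `χ`-brackets with a
fixed left argument, substitutions and brackets of Lax operators are computed on these, and
`SuperPoly.Formal.eval_congr` turns an equality of normal forms into an equality in the algebra.
The coefficients of a `χ`-bracket are superderivations in the right argument, so that they are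
computed from their values on the variables.

*The canonical form.* As `𝔫 = 𝔤₁` sits in the highest degree, the gauge transformation
`e^{ad N}(D + x)` is a polynomial of order two in `N`. Its components along `h₂` and `e₁`, which vanish in the
canonical form, determine `N₂ = -h̄₁/4` and `N₃ = -f̄₁/4`, hence `w₁, …, w₄`
(`Osp.IsCanonicalForm.eq_formal`). That these explicit elements lie in `𝒲` is checked on the
finitely many coefficients of `{n̄_χ w_t}₁` that can be nonzero (`Osp.ev_mem_wAlgebra`). By the
Leibniz rule and right sesquilinearity (`SuperPoly.rightExtend_D`), `𝒲` is a differential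
subalgebra, so everything built from the `w_t` stays in it.

*Existence of the dressing.* `Λ² = z h₂`, and `ad h₂` is diagonal with the eigenvalues `0, ±2` in
the basis. So the components of `e^{ad T}[ℒ^c, ℒ^c]/2` outside the kernel of `ad Λ²` can be removed
degree by degree: a change of `T` in degree `j` alters them in degree `j - 2` by `-[Λ², ·]` of the
change, and otherwise in higher degrees only (`Osp.coeff_expAd_sub`). The resulting iteration
stabilizes in every degree and preserves parity and membership in `𝒲` (`Osp.exists_isDressing`).

*The densities.* For an arbitrary dressing, the vanishing of the components outside `ker (ad Λ²)`
shows that the coefficient `z⁰` of `T` is zero and that those of `z⁻¹` and `z⁻²` solve explicit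
linear equations with a unique solution in the image of `ad h₂` (`Osp.IsDressing.level_eq`). The
pairing with `h₂ ⊗ zⁿ` selects the coefficient of `h₁ ⊗ z⁻ⁿ` in `K`, in which the coefficient `z⁻³`
of `T` does not occur for `n ≤ 2`. Thus `ρ₀, ρ₁, ρ₂` are known exactly
(`Osp.IsDressing.density_eq`). The first two flows are then symbolic computations, and `ρ₂` differs
from the asserted density by the derivative of an element of `𝒲` (`Osp.ev_formalRho₂`).
-/

noncomputable section

/-! ### Superderivations -/

namespace SuperPoly

variable {ι : Type} {p : ι → ℕ}

theorem neg_one_pow_mul_self (r : ℕ) : (-1 : ℂ) ^ r * (-1 : ℂ) ^ r = 1 := by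
  rw [← mul_pow]; simp

theorem parityAut_pow_apply_of_isHomogeneous (r k : ℕ) (a : SuperPoly p) (ha : IsHomogeneous k a) :
    (parityAut ^ r : SuperPoly p →ₐ[ℂ] SuperPoly p) a = (-1 : ℂ) ^ (r * k) • a := by
  induction r with
  | zero => simp
  | succ r ih =>
    rw [pow_succ', AlgHom.mul_apply, ih, map_smul, ha, smul_smul]
    congr 1
    ring

theorem parityAut_pow_add_two (r : ℕ) :
    (parityAut ^ (r + 2) : SuperPoly p →ₐ[ℂ] SuperPoly p) = parityAut ^ r := by
  refine AlgHom.ext fun a => ?_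
  rw [pow_add, AlgHom.mul_apply, pow_two, AlgHom.mul_apply, parityAut_parityAut]

/-- The remaining entries of the matrix that encodes a superderivation. -/
theorem superDerHom_zero_zero (q : ℕ) (v : ι → ℕ → SuperPoly p) (a : SuperPoly p) :
    superDerHom q v a 0 0 = (parityAut ^ q : SuperPoly p →ₐ[ℂ] SuperPoly p) a ∧
    superDerHom q v a 1 0 = 0 ∧ superDerHom q v a 1 1 = a := by
  induction a using induction with
  | hs c => simp [Matrix.algebraMap_matrix_apply]
  | hg i n =>
    have h : superDerHom q v (gen p i n) = _ := lift_gen _ _ i n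
    rw [h, parityAut_pow_apply_of_isHomogeneous q (p i + n) _ (parityAut_gen i n)]
    simp
  | ha a b h1 h2 => simp [h1, h2]
  | hm a b h1 h2 => simp [Matrix.mul_apply, h1, h2]

/-- Without any assumption on the parity of `v i n`, its component of the right parity is
what remains. -/
theorem superDer_gen' (q : ℕ) (v : ι → ℕ → SuperPoly p) (i : ι) (n : ℕ) :
    superDer q v (gen p i n) = parityPart (q + (p i + n)) (v i n) := by
  have : superDerHom q v (gen p i n) = _ := lift_gen _ _ i n
  simp [superDer, this]

theorem superDer_mul (q : ℕ) (v : ι → ℕ → SuperPoly p) (a b : SuperPoly p) :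
    superDer q v (a * b) = (parityAut ^ q : SuperPoly p →ₐ[ℂ] SuperPoly p) a * superDer q v b +
      superDer q v a * b := by
  simp [superDer, Matrix.mul_apply, superDerHom_zero_zero]

/-- The Leibniz rule of a superderivation of parity `q`. -/
def IsSuperDer (q : ℕ) (d : SuperPoly p →ₗ[ℂ] SuperPoly p) : Prop :=
  ∀ a b, d (a * b) = (parityAut ^ q : SuperPoly p →ₐ[ℂ] SuperPoly p) a * d b + d a * b

theorem isSuperDer_superDer (q : ℕ) (v : ι → ℕ → SuperPoly p) : IsSuperDer q (superDer q v) :=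
  superDer_mul q v

theorem IsSuperDer.map_one {q : ℕ} {d : SuperPoly p →ₗ[ℂ] SuperPoly p} (hd : IsSuperDer q d) :
    d 1 = 0 := by
  have h := hd 1 1
  simpa using h

theorem IsSuperDer.map_algebraMap {q : ℕ} {d : SuperPoly p →ₗ[ℂ] SuperPoly p}
    (hd : IsSuperDer q d) (c : ℂ) : d (algebraMap ℂ _ c) = 0 := by
  rw [Algebra.algebraMap_eq_smul_one, map_smul, hd.map_one, smul_zero]

theorem IsSuperDer.ext {q : ℕ} {d₁ d₂ : SuperPoly p →ₗ[ℂ] SuperPoly p} (h₁ : IsSuperDer q d₁)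
    (h₂ : IsSuperDer q d₂) (h : ∀ i n, d₁ (gen p i n) = d₂ (gen p i n)) : d₁ = d₂ := by
  ext a
  induction a using induction with
  | hs c => rw [h₁.map_algebraMap, h₂.map_algebraMap]
  | hg i n => exact h i n
  | ha a b e1 e2 => rw [map_add, map_add, e1, e2]
  | hm a b e1 e2 => rw [h₁, h₂, e1, e2]

theorem isSuperDer_D : IsSuperDer 1 (D : SuperPoly p →ₗ[ℂ] SuperPoly p) := isSuperDer_superDer _ _

theorem D_mul (a b : SuperPoly p) : D (a * b) = parityAut a * D b + D a * b := by
  simpa using isSuperDer_D a b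

theorem D_algebraMap (c : ℂ) : D (algebraMap ℂ (SuperPoly p) c) = 0 :=
  isSuperDer_D.map_algebraMap c

theorem IsHomogeneous.add {k : ℕ} {a b : SuperPoly p} (ha : IsHomogeneous k a)
    (hb : IsHomogeneous k b) : IsHomogeneous k (a + b) := by
  rw [IsHomogeneous, map_add, ha, hb, smul_add]

theorem isHomogeneous_zero (k : ℕ) : IsHomogeneous k (0 : SuperPoly p) := by simp [IsHomogeneous]

theorem IsHomogeneous.smul {k : ℕ} {a : SuperPoly p} (ha : IsHomogeneous k a) (c : ℂ) :
    IsHomogeneous k (c • a) := by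
  rw [IsHomogeneous, map_smul, ha, smul_comm]

theorem IsHomogeneous.sub {k : ℕ} {a b : SuperPoly p} (ha : IsHomogeneous k a)
    (hb : IsHomogeneous k b) : IsHomogeneous k (a - b) := by
  rw [IsHomogeneous, map_sub, ha, hb, smul_sub]

theorem IsHomogeneous.mul {k l : ℕ} {a b : SuperPoly p} (ha : IsHomogeneous k a)
    (hb : IsHomogeneous l b) : IsHomogeneous (k + l) (a * b) := by
  rw [IsHomogeneous, map_mul, ha, hb, smul_mul_smul_comm, pow_add]

theorem IsHomogeneous.congr {k l : ℕ} {a : SuperPoly p} (ha : IsHomogeneous k a)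
    (h : k % 2 = l % 2) : IsHomogeneous l a := by
  rw [IsHomogeneous, ha, neg_one_pow_eq_pow_mod_two, h, ← neg_one_pow_eq_pow_mod_two]

theorem isHomogeneous_gen (i : ι) (n : ℕ) : IsHomogeneous (p i + n) (gen p i n) :=
  parityAut_gen i n

theorem IsHomogeneous.parityAut_pow {k : ℕ} {a : SuperPoly p} (ha : IsHomogeneous k a) (r : ℕ) :
    IsHomogeneous k ((parityAut ^ r : SuperPoly p →ₐ[ℂ] SuperPoly p) a) := by
  rw [parityAut_pow_apply_of_isHomogeneous r k a ha]
  exact ha.smul _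

theorem parityPart_eq_self {k : ℕ} {a : SuperPoly p} (ha : IsHomogeneous k a) :
    parityPart k a = a := by
  rw [parityPart, ha, smul_smul, neg_one_pow_mul_self, one_smul, ← two_smul ℂ, smul_smul]
  norm_num

theorem parityPart_eq_zero {k l : ℕ} {a : SuperPoly p} (ha : IsHomogeneous k a)
    (h : l % 2 ≠ k % 2) : parityPart l a = 0 := by
  have e : (-1 : ℂ) ^ l * (-1 : ℂ) ^ k = -1 := by
    rw [← pow_add]
    exact Odd.neg_one_pow (by rw [Nat.odd_iff]; omega)
  rw [parityPart, ha, smul_smul, e]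
  simp

/-- A superderivation of parity `q` given by its values on the variables is homogeneous. -/
theorem superDer_parityAut (q : ℕ) (v : ι → ℕ → SuperPoly p) (a : SuperPoly p) :
    superDer q v (parityAut a) = (-1 : ℂ) ^ q • parityAut (superDer q v a) := by
  induction a using induction with
  | hs c => simp [(isSuperDer_superDer q v).map_algebraMap]
  | hg i n =>
    rw [parityAut_gen, map_smul, superDer_gen', isHomogeneous_parityPart, smul_smul,
      pow_add _ q, ← mul_assoc, neg_one_pow_mul_self, one_mul]
  | ha a b h1 h2 => simp [h1, h2]
  | hm a b h1 h2 =>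
    have h : (parityAut ^ q : SuperPoly p →ₐ[ℂ] SuperPoly p) (parityAut a) =
        parityAut ((parityAut ^ q : SuperPoly p →ₐ[ℂ] SuperPoly p) a) := by
      rw [← AlgHom.mul_apply, ← AlgHom.mul_apply, ← pow_succ, ← pow_succ']
    rw [map_mul, superDer_mul, superDer_mul, h1, h2, h, map_add, map_mul, map_mul, smul_add,
      mul_smul_comm, smul_mul_assoc]

theorem IsHomogeneous.superDer {k : ℕ} {a : SuperPoly p} (ha : IsHomogeneous k a) (q : ℕ)
    (v : ι → ℕ → SuperPoly p) : IsHomogeneous (q + k) (superDer q v a) := by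
  have h := superDer_parityAut q v a
  rw [ha, map_smul] at h
  rw [IsHomogeneous, pow_add, mul_smul, h, smul_smul, neg_one_pow_mul_self, one_smul]

theorem D_parityAut (a : SuperPoly p) : D (parityAut a) = - parityAut (D a) := by
  have h := superDer_parityAut 1 (fun i n => gen p i (n + 1)) a
  rw [pow_one] at h
  change D (parityAut a) = (-1 : ℂ) • parityAut (D a) at h
  rw [h]
  module

theorem D_parityAut_pow (q : ℕ) (a : SuperPoly p) :
    D ((parityAut ^ q : SuperPoly p →ₐ[ℂ] SuperPoly p) a) =
      (-1 : ℂ) ^ q • (parityAut ^ q : SuperPoly p →ₐ[ℂ] SuperPoly p) (D a) := by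
  induction q with
  | zero => simp
  | succ q ih =>
    rw [pow_succ', AlgHom.mul_apply, AlgHom.mul_apply, D_parityAut, ih, map_smul, pow_succ]
    module

theorem IsHomogeneous.D {k : ℕ} {a : SuperPoly p} (ha : IsHomogeneous k a) :
    IsHomogeneous (k + 1) (D a) :=
  (ha.superDer 1 _).congr (by rw [add_comm])

/-- The supercommutator of `D` and a superderivation is a superderivation. -/
theorem isSuperDer_commutator_D (q : ℕ) (v : ι → ℕ → SuperPoly p) :
    IsSuperDer (q + 1) (superDer q v ∘ₗ D - (-1 : ℂ) ^ q • D ∘ₗ superDer q v) := by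
  intro a b
  have h : (parityAut ^ q : SuperPoly p →ₐ[ℂ] SuperPoly p) (parityAut a) =
        (parityAut ^ (q + 1) : SuperPoly p →ₐ[ℂ] SuperPoly p) a := by
    rw [← AlgHom.mul_apply, ← pow_succ]
  have h' : parityAut ((parityAut ^ q : SuperPoly p →ₐ[ℂ] SuperPoly p) a) =
        (parityAut ^ (q + 1) : SuperPoly p →ₐ[ℂ] SuperPoly p) a := by
    rw [← AlgHom.mul_apply, ← pow_succ']
  simp only [LinearMap.sub_apply, LinearMap.comp_apply, LinearMap.smul_apply, D_mul, superDer_mul,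
    map_add, h, h', superDer_parityAut, D_parityAut_pow, smul_mul_assoc, mul_sub, sub_mul,
    smul_add, mul_smul_comm, smul_smul, neg_one_pow_mul_self, one_smul]
  abel

/-! ### Brackets with a fixed left argument -/

theorem chiPlusD_apply_zero (F : ℕ → SuperPoly p) : chiPlusD F 0 = D (F 0) := by
  simp [chiPlusD, chiMul, chiD]

theorem chiPlusD_apply_succ (F : ℕ → SuperPoly p) (n : ℕ) :
    chiPlusD F (n + 1) = (-1 : ℂ) ^ (n + 1) • (D (F (n + 1)) - F n) := by
  by_cases h : Even (n + 1)
  · simp only [chiPlusD, chiMul, chiD, Pi.add_apply, if_pos h, h.neg_one_pow, one_smul, two_smul]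
    module
  · simp only [chiPlusD, chiMul, chiD, Pi.add_apply, if_neg h,
      (Nat.not_even_iff_odd.1 h).neg_one_pow]
    module

theorem iterate_chiPlusD_apply_zero (F : ℕ → SuperPoly p) (k : ℕ) :
    (chiPlusD^[k] F) 0 = D^[k] (F 0) := by
  induction k with
  | zero => rfl
  | succ k ih => rw [Function.iterate_succ_apply', Function.iterate_succ_apply',
      chiPlusD_apply_zero, ih]

theorem iterate_chiPlusD_eq_zero {F : ℕ → SuperPoly p} {m : ℕ} (hF : ∀ n, m ≤ n → F n = 0)
    (k n : ℕ) (h : m + k ≤ n) : (chiPlusD^[k] F) n = 0 := by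
  induction k generalizing n with
  | zero => exact hF n h
  | succ k ih =>
    obtain ⟨n, rfl⟩ : ∃ n', n = n' + 1 := ⟨n - 1, by omega⟩
    rw [Function.iterate_succ_apply', chiPlusD_apply_succ, ih _ (by omega), ih _ (by omega)]
    simp

theorem chiPlusD_zero : chiPlusD (0 : ℕ → SuperPoly p) = 0 := by
  ext n
  cases n <;> simp [chiPlusD_apply_zero, chiPlusD_apply_succ]

theorem iterate_chiPlusD_zero (k : ℕ) : chiPlusD^[k] (0 : ℕ → SuperPoly p) = 0 :=
  Function.iterate_fixed chiPlusD_zero k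

theorem isHomogeneous_chiPlusD {s : ℕ} {F : ℕ → SuperPoly p}
    (hF : ∀ n, IsHomogeneous (s + n) (F n)) (n : ℕ) : IsHomogeneous (s + 1 + n) (chiPlusD F n) := by
  cases n with
  | zero =>
    rw [chiPlusD_apply_zero]
    exact (hF 0).D
  | succ n =>
    rw [chiPlusD_apply_succ]
    exact (((hF (n + 1)).D.congr (by omega)).sub ((hF n).congr (by omega))).smul _

theorem isHomogeneous_iterate_chiPlusD {s : ℕ} {F : ℕ → SuperPoly p}
    (hF : ∀ n, IsHomogeneous (s + n) (F n)) (k n : ℕ) :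
    IsHomogeneous (s + k + n) ((chiPlusD^[k] F) n) := by
  induction k generalizing n with
  | zero => exact hF n
  | succ k ih =>
    rw [Function.iterate_succ_apply']
    exact isHomogeneous_chiPlusD ih n

theorem chiFlip_zero : chiFlip (0 : ℕ → SuperPoly p) = 0 := by
  ext k
  simp [chiFlip, iterate_chiPlusD_zero]

/-- The substitution `χ ↦ -χ - D` in a polynomial of degree less than `m`. -/
theorem chiFlip_eq_sum {F : ℕ → SuperPoly p} {m : ℕ} (hF : ∀ n, m ≤ n → F n = 0) (k : ℕ) :
    chiFlip F k = ∑ n ∈ Finset.range m,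
      (-1 : ℂ) ^ n • (chiPlusD^[n] (Pi.single 0 (F n))) k := by
  rw [chiFlip]
  apply finsum_eq_sum_of_support_subset
  intro n hn
  rw [Finset.coe_range, Set.mem_Iio]
  by_contra h
  rw [Function.mem_support, hF n (by omega)] at hn
  simp [iterate_chiPlusD_zero] at hn

theorem rightExtend_zero (q : ℕ) (b : SuperPoly p) : rightExtend q 0 b = 0 := by
  ext n
  have h : superDer (q + n + 1) (fun (j : ι) k =>
      (-1 : ℂ) ^ (k * (q + 1)) • (chiPlusD^[k] ((0 : ι → ℕ → SuperPoly p) j)) n) = 0 := by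
    apply IsSuperDer.ext (isSuperDer_superDer _ _) (q := q + n + 1)
    · intro a b; simp
    · intro i m
      rw [superDer_gen', Pi.zero_apply, iterate_chiPlusD_zero]
      simp [parityPart]
  rw [rightExtend, h]
  rfl

theorem rightExtend_apply_zero (q : ℕ) (V : ι → ℕ → SuperPoly p) (n : ℕ) :
    rightExtend q V 0 n = 0 := by
  simp [rightExtend]

/-- The bracket `{a_χ ·}` of a homogeneous element `a`. -/
theorem chiBracket_of_isHomogeneous (B : ι → ι → ℕ → SuperPoly p) {q : ℕ} (hq : q < 2)
    {a : SuperPoly p} (ha : IsHomogeneous q a) (b : SuperPoly p) :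
    chiBracket B a b = rightExtend q (fun j => (-1 : ℂ) ^ (q * p j) •
      chiFlip (rightExtend (p j) (B j) a)) b := by
  have h : ∀ r : ℕ, r % 2 ≠ q % 2 → rightExtend r (fun j => (-1 : ℂ) ^ (r * p j) •
      chiFlip (rightExtend (p j) (B j) (parityPart r a))) b = 0 := by
    intro r hr
    have e : (fun j => (-1 : ℂ) ^ (r * p j) •
        chiFlip (rightExtend (p j) (B j) (parityPart r a))) = 0 := by
      ext j n
      have : rightExtend (p j) (B j) 0 = 0 := funext fun n => rightExtend_apply_zero _ _ n
      rw [parityPart_eq_zero ha hr, this, chiFlip_zero]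
      simp
    rw [e, rightExtend_zero]
  rw [chiBracket, Fin.sum_univ_two]
  obtain rfl | rfl : q = 0 ∨ q = 1 := by omega
  · rw [show ((0 : Fin 2) : ℕ) = 0 from rfl, show ((1 : Fin 2) : ℕ) = 1 from rfl,
      h 1 (by norm_num), add_zero, parityPart_eq_self ha]
  · rw [show ((0 : Fin 2) : ℕ) = 0 from rfl, show ((1 : Fin 2) : ℕ) = 1 from rfl,
      h 0 (by norm_num), zero_add, parityPart_eq_self ha]

/-- Right sesquilinearity `{a_χ Db} = (-1)^{q+1} (D + χ) {a_χ b}`, where `q` is the parity of `a`,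
for homogeneous values on the variables. -/
theorem rightExtend_D (q : ℕ) (V : ι → ℕ → SuperPoly p)
    (hV : ∀ j n, IsHomogeneous (q + 1 + p j + n) (V j n)) (b : SuperPoly p) (n : ℕ) :
    rightExtend q V (D b) n = (-1 : ℂ) ^ (q + 1) • chiPlusD (rightExtend q V b) n := by
  have hg : ∀ i k n, rightExtend q V (gen p i k) n =
      (-1 : ℂ) ^ (k * (q + 1)) • (chiPlusD^[k] (V i)) n := by
    intro i k n
    exact superDer_gen _ _ _ _
      (((isHomogeneous_iterate_chiPlusD (hV i) k n).smul _).congr (by congr 1; ring))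
  -- `d n` is the coefficient of `χ ^ n` in the bracket
  obtain ⟨d, hdr, hd, hcomm⟩ : ∃ d : ℕ → SuperPoly p →ₗ[ℂ] SuperPoly p,
      (∀ b n, rightExtend q V b n = d n b) ∧ (∀ n, IsSuperDer (q + n + 1) (d n)) ∧
      ∀ n, IsSuperDer (q + n + 1 + 1) (d n ∘ₗ D - (-1 : ℂ) ^ (q + n + 1) • D ∘ₗ d n) :=
    ⟨fun n => superDer (q + n + 1) (fun j k => (-1 : ℂ) ^ (k * (q + 1)) • (chiPlusD^[k] (V j)) n),
      fun _ _ => rfl, fun n => isSuperDer_superDer _ _, fun n => isSuperDer_commutator_D _ _⟩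
  have key0 : d 0 ∘ₗ D - (-1 : ℂ) ^ (q + 0 + 1) • D ∘ₗ d 0 = 0 := by
    apply (hcomm 0).ext (fun a b => by simp)
    intro i k
    rw [LinearMap.sub_apply, LinearMap.comp_apply, LinearMap.smul_apply, LinearMap.comp_apply,
      D_gen, ← hdr, ← hdr, hg, hg, Function.iterate_succ_apply', chiPlusD_apply_zero, map_smul,
      smul_smul, add_one_mul, pow_add]
    simp [mul_comm]
  have keyS : ∀ n, d (n + 1) ∘ₗ D - (-1 : ℂ) ^ (q + (n + 1) + 1) • D ∘ₗ d (n + 1) =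
      (-1 : ℂ) ^ (q + n + 1) • d n := by
    intro n
    apply (hcomm (n + 1)).ext
    · intro a b
      rw [show q + (n + 1) + 1 + 1 = (q + n + 1) + 2 by ring, parityAut_pow_add_two]
      simp only [LinearMap.smul_apply, hd n a b, smul_add, mul_smul_comm, smul_mul_assoc]
    · intro i k
      rw [LinearMap.sub_apply, LinearMap.comp_apply, LinearMap.smul_apply, LinearMap.smul_apply,
        LinearMap.comp_apply, D_gen, ← hdr, ← hdr, ← hdr, hg, hg, hg,
        Function.iterate_succ_apply', chiPlusD_apply_succ, map_smul,
        smul_smul, smul_sub, smul_smul, smul_smul]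
      have e1 : (-1 : ℂ) ^ ((k + 1) * (q + 1)) * (-1) ^ (n + 1) =
          (-1) ^ (q + (n + 1) + 1) * (-1) ^ (k * (q + 1)) := by ring
      have e2 : (-1 : ℂ) ^ (q + n + 1) * (-1) ^ (k * (q + 1)) =
          - ((-1 : ℂ) ^ ((k + 1) * (q + 1)) * (-1) ^ (n + 1)) := by ring
      rw [e2, e1]
      module
  cases n with
  | zero =>
    have := LinearMap.congr_fun key0 b
    simp only [LinearMap.sub_apply, LinearMap.comp_apply, LinearMap.smul_apply,
      LinearMap.zero_apply, sub_eq_zero] at this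
    rw [chiPlusD_apply_zero, hdr, hdr, this, add_zero]
  | succ n =>
    have := LinearMap.congr_fun (keyS n) b
    simp only [LinearMap.sub_apply, LinearMap.comp_apply, LinearMap.smul_apply,
      sub_eq_iff_eq_add] at this
    rw [chiPlusD_apply_succ, hdr, hdr, hdr, this, smul_smul, smul_sub, ← pow_add,
      show q + 1 + (n + 1) = q + n + 1 + 1 by ring, show q + (n + 1) + 1 = q + n + 1 + 1 by ring,
      pow_succ]
    module

end SuperPoly

/-! ### Symbolic computation in superalgebras of super differential polynomials -/

namespace SuperPoly

/-- A formal linear combination of words in the variables `u_i^{(n)}`, with rational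
coefficients: the input of exact computations in `SuperPoly p`. -/
abbrev Formal (ι : Type) : Type := List (ℚ × List (ι × ℕ))

variable {ι : Type} {p : ι → ℕ}

theorem gen_mul_self_of_odd (i : ι) (n : ℕ) (h : (p i + n) % 2 = 1) :
    gen p i n * gen p i n = 0 := by
  have e := gen_mul_gen (p := p) i i n n
  rw [Odd.neg_one_pow (by rw [← Nat.odd_iff] at h; exact h.mul h)] at e
  have e' : (2 : ℂ) • (gen p i n * gen p i n) = 0 := by
    rw [two_smul]
    nth_rewrite 1 [e]
    module
  exact (smul_eq_zero_iff_right two_ne_zero).1 e'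

namespace Formal

/-- The product of the variables in a word. -/
def evalWord (p : ι → ℕ) : List (ι × ℕ) → SuperPoly p
  | [] => 1
  | x :: l => gen p x.1 x.2 * evalWord p l

/-- The element of `SuperPoly p` that a formal linear combination stands for. -/
def eval (p : ι → ℕ) : Formal ι → SuperPoly p
  | [] => 0
  | t :: P => (t.1 : ℂ) • evalWord p t.2 + eval p P

/-- The variable `u_i^{(n)}`. -/
def var (i : ι) (n : ℕ) : Formal ι := [(1, [(i, n)])]

/-- The constant `c`. -/
def const (c : ℚ) : Formal ι := [(c, [])]

/-- Multiplication by a rational number. -/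
def smul (c : ℚ) (P : Formal ι) : Formal ι := P.map fun t => (c * t.1, t.2)

/-- The sum, as the concatenation of lists: equal words are not collected. -/
def add (P Q : Formal ι) : Formal ι := P ++ Q

/-- Left multiplication by a term. -/
def termMul (t : ℚ × List (ι × ℕ)) (P : Formal ι) : Formal ι :=
  P.map fun s => (t.1 * s.1, t.2 ++ s.2)

/-- The product; words are concatenated and not sorted. -/
def mul : Formal ι → Formal ι → Formal ι
  | [], _ => []
  | t :: P, Q => termMul t Q ++ mul P Q

/-- The parity of a word. -/
def wordParity (p : ι → ℕ) : List (ι × ℕ) → ℕ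
  | [] => 0
  | x :: l => p x.1 + x.2 + wordParity p l

/-- The sign `(-1)^n`. -/
def sign (n : ℕ) : ℚ := if n % 2 = 0 then 1 else -1

/-- The parity automorphism, on symbolic elements. -/
def parityAut (p : ι → ℕ) (P : Formal ι) : Formal ι :=
  P.map fun t => (sign (wordParity p t.2) * t.1, t.2)

/-- The component of parity `k` (mod 2), on symbolic elements. -/
def parityPart (p : ι → ℕ) (k : ℕ) (P : Formal ι) : Formal ι :=
  P.filter fun t => wordParity p t.2 % 2 = k % 2

/-- A superderivation of parity `q` with values `v` on the variables, on words. -/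
def derWord (p : ι → ℕ) (q : ℕ) (v : ι → ℕ → Formal ι) : List (ι × ℕ) → Formal ι
  | [] => []
  | x :: l => add (mul (v x.1 x.2) [(1, l)])
      (termMul (sign (q * (p x.1 + x.2)), [x]) (derWord p q v l))

/-- A superderivation of parity `q` with values `v` on the variables. -/
def der (p : ι → ℕ) (q : ℕ) (v : ι → ℕ → Formal ι) : Formal ι → Formal ι
  | [] => []
  | t :: P => add (smul t.1 (derWord p q v t.2)) (der p q v P)

/-- The odd derivation `D`, on symbolic elements. -/
def D (p : ι → ℕ) (P : Formal ι) : Formal ι := der p 1 (fun i n => var i (n + 1)) P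

/-- Substitution of `v i n` for the variables, on words. -/
def substWord (v : ι → ℕ → Formal ι) : List (ι × ℕ) → Formal ι
  | [] => const 1
  | x :: l => mul (v x.1 x.2) (substWord v l)

/-- Substitution of `v i n` for the variables. -/
def subst (v : ι → ℕ → Formal ι) : Formal ι → Formal ι
  | [] => []
  | t :: P => add (smul t.1 (substWord v t.2)) (subst v P)

theorem eval_append (P Q : Formal ι) : eval p (P ++ Q) = eval p P + eval p Q := by
  induction P with
  | nil => simp [eval]
  | cons t P ih => rw [List.cons_append, eval, eval, ih, add_assoc]

theorem eval_add (P Q : Formal ι) : eval p (add P Q) = eval p P + eval p Q := eval_append P Q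

theorem eval_var (i : ι) (n : ℕ) : eval p (var i n) = gen p i n := by
  simp [var, eval, evalWord]

theorem eval_const (c : ℚ) : eval p (const c) = algebraMap ℂ _ (c : ℂ) := by
  simp [const, eval, evalWord, Algebra.algebraMap_eq_smul_one]

theorem eval_smul (c : ℚ) (P : Formal ι) : eval p (smul c P) = (c : ℂ) • eval p P := by
  induction P with
  | nil => simp [smul, eval]
  | cons t P ih =>
    rw [smul, List.map_cons, eval, eval, ← smul, ih, smul_add, smul_smul]
    push_cast
    rfl

theorem evalWord_append (l m : List (ι × ℕ)) :
    evalWord p (l ++ m) = evalWord p l * evalWord p m := by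
  induction l with
  | nil => simp [evalWord]
  | cons x l ih => rw [List.cons_append, evalWord, evalWord, ih, mul_assoc]

theorem eval_termMul (t : ℚ × List (ι × ℕ)) (P : Formal ι) :
    eval p (termMul t P) = ((t.1 : ℂ) • evalWord p t.2) * eval p P := by
  induction P with
  | nil => simp [termMul, eval]
  | cons s P ih =>
    rw [termMul, List.map_cons, eval, eval, ← termMul, ih, mul_add, smul_mul_smul_comm,
      evalWord_append]
    push_cast
    rfl

theorem eval_mul (P Q : Formal ι) : eval p (mul P Q) = eval p P * eval p Q := by
  induction P with
  | nil => simp [mul, eval]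
  | cons t P ih => rw [mul, eval_append, eval_termMul, ih, eval, add_mul]

theorem cast_sign (n : ℕ) : ((sign n : ℚ) : ℂ) = (-1 : ℂ) ^ n := by
  rw [neg_one_pow_eq_pow_mod_two]
  rcases Nat.mod_two_eq_zero_or_one n with h | h <;> simp [sign, h]

theorem isHomogeneous_evalWord (l : List (ι × ℕ)) :
    IsHomogeneous (wordParity p l) (evalWord p l) := by
  induction l with
  | nil => simp [wordParity, evalWord, IsHomogeneous]
  | cons x l ih => exact (isHomogeneous_gen x.1 x.2).mul ih

theorem eval_parityAut (P : Formal ι) :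
    eval p (parityAut p P) = SuperPoly.parityAut (eval p P) := by
  induction P with
  | nil => simp [parityAut, eval]
  | cons t P ih =>
    rw [parityAut, List.map_cons, eval, eval, ← parityAut, ih, map_add, map_smul,
      isHomogeneous_evalWord, smul_smul]
    push_cast
    rw [cast_sign, mul_comm]

theorem eval_iterate_parityAut (k : ℕ) (P : Formal ι) :
    eval p ((parityAut p)^[k] P) =
      (SuperPoly.parityAut ^ k : SuperPoly p →ₐ[ℂ] SuperPoly p) (eval p P) := by
  induction k with
  | zero => simp
  | succ k ih => rw [Function.iterate_succ_apply', eval_parityAut, ih, pow_succ', AlgHom.mul_apply]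

theorem parityPart_add (k : ℕ) (a b : SuperPoly p) :
    SuperPoly.parityPart k (a + b) = SuperPoly.parityPart k a + SuperPoly.parityPart k b := by
  simp only [SuperPoly.parityPart, map_add]
  module

theorem parityPart_smul (k : ℕ) (c : ℂ) (a : SuperPoly p) :
    SuperPoly.parityPart k (c • a) = c • SuperPoly.parityPart k a := by
  simp only [SuperPoly.parityPart, map_smul]
  module

theorem eval_parityPart (k : ℕ) (P : Formal ι) :
    eval p (parityPart p k P) = SuperPoly.parityPart k (eval p P) := by
  induction P with
  | nil => simp [parityPart, eval, SuperPoly.parityPart]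
  | cons t P ih =>
    rw [eval, parityPart_add, parityPart_smul, ← ih, parityPart, List.filter_cons]
    by_cases h : wordParity p t.2 % 2 = k % 2
    · rw [if_pos (by simpa using h), eval, parityPart_eq_self
        ((isHomogeneous_evalWord t.2).congr h)]
      rfl
    · rw [if_neg (by simpa using h), parityPart_eq_zero (isHomogeneous_evalWord t.2) (Ne.symm h),
        smul_zero, zero_add]
      rfl

/-- Homogeneity can be read off the words. -/
theorem isHomogeneous_eval {k : ℕ} {P : Formal ι}
    (h : P.all (fun t => wordParity p t.2 % 2 == k % 2) = true) : IsHomogeneous k (eval p P) := by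
  have e : parityPart p k P = P := by
    rw [parityPart, List.filter_eq_self]
    intro t ht
    simpa using (List.all_eq_true.1 h) t ht
  rw [← e, eval_parityPart]
  exact isHomogeneous_parityPart _ _

/-- A symbolic superderivation computes any superderivation with the same values on the
variables. -/
theorem eval_der {q : ℕ} {d : SuperPoly p →ₗ[ℂ] SuperPoly p} (hd : IsSuperDer q d)
    {v : ι → ℕ → Formal ι} (hv : ∀ i n, d (gen p i n) = eval p (v i n)) (P : Formal ι) :
    eval p (der p q v P) = d (eval p P) := by
  have hw : ∀ l, eval p (derWord p q v l) = d (evalWord p l) := by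
    intro l
    induction l with
    | nil => simp [derWord, eval, evalWord, hd.map_one]
    | cons x l ih =>
      have e : evalWord p (x :: l) = gen p x.1 x.2 * evalWord p l := rfl
      rw [derWord, eval_add, eval_mul, eval_termMul, ih, e, hd, hv, add_comm,
        parityAut_pow_apply_of_isHomogeneous _ _ _ (isHomogeneous_gen x.1 x.2)]
      simp [cast_sign, eval, evalWord]
  induction P with
  | nil => simp [der, eval]
  | cons t P ih => rw [der, eval_add, eval_smul, hw, ih, eval, map_add, map_smul]

theorem eval_D (P : Formal ι) : eval p (D p P) = SuperPoly.D (eval p P) :=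
  eval_der isSuperDer_D (fun i n => by rw [D_gen, eval_var]) P

theorem eval_iterate_D (k : ℕ) (P : Formal ι) :
    eval p ((D p)^[k] P) = SuperPoly.D^[k] (eval p P) := by
  induction k with
  | zero => rfl
  | succ k ih => rw [Function.iterate_succ_apply', eval_D, ih, Function.iterate_succ_apply']

theorem eval_superDer (q : ℕ) (v : ι → ℕ → Formal ι) (P : Formal ι) :
    eval p (der p q (fun i n => parityPart p (q + (p i + n)) (v i n)) P) =
      superDer q (fun i n => eval p (v i n)) (eval p P) :=
  eval_der (isSuperDer_superDer _ _) (fun i n => by rw [superDer_gen', eval_parityPart]) P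

theorem eval_subst {p' : ι → ℕ} (F : SuperPoly p →ₐ[ℂ] SuperPoly p') {v : ι → ℕ → Formal ι}
    (hv : ∀ i n, F (gen p i n) = eval p' (v i n)) (P : Formal ι) :
    eval p' (subst v P) = F (eval p P) := by
  have hw : ∀ l, eval p' (substWord v l) = F (evalWord p l) := by
    intro l
    induction l with
    | nil => simp [substWord, eval_const, evalWord]
    | cons x l ih => rw [substWord, eval_mul, ih, evalWord, map_mul, hv]
  induction P with
  | nil => simp [subst, eval]
  | cons t P ih => rw [subst, eval_add, eval_smul, hw, ih, eval, map_add, map_smul]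

/-! ### Normal forms -/

section Norm

variable [DecidableEq ι] (p) (code : ι → ℕ)

/-- Insertion of a variable in front of a sorted word, with the resulting sign or zero. The order of
the variables comes from an arbitrary function `code`. -/
def insertVar (x : ι × ℕ) : List (ι × ℕ) → ℚ × List (ι × ℕ)
  | [] => (1, [x])
  | y :: l =>
    if x = y ∧ (p x.1 + x.2) % 2 = 1 then (0, [])
    else if code x.1 < code y.1 ∨ (code x.1 = code y.1 ∧ x.2 ≤ y.2) then (1, x :: y :: l)
    else ((sign ((p x.1 + x.2) * (p y.1 + y.2))) * (insertVar x l).1, y :: (insertVar x l).2)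

/-- The sorted form of a word, with the sign from the supercommutation relations; the
coefficient is zero if an odd variable is repeated. -/
def sortWord : List (ι × ℕ) → ℚ × List (ι × ℕ)
  | [] => (1, [])
  | x :: l => ((sortWord l).1 * (insertVar p code x (sortWord l).2).1,
      (insertVar p code x (sortWord l).2).2)

/-- Addition of a term to a combination of distinct words. -/
def collect (t : ℚ × List (ι × ℕ)) : Formal ι → Formal ι
  | [] => if t.1 = 0 then [] else [t]
  | s :: P => if t.2 = s.2 then (if t.1 + s.1 = 0 then P else (t.1 + s.1, s.2) :: P)
      else s :: collect t P

/-- The normal form: words are sorted and collected, and zero coefficients are dropped. -/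
def norm : Formal ι → Formal ι
  | [] => []
  | t :: P => collect (t.1 * (sortWord p code t.2).1, (sortWord p code t.2).2) (norm P)

variable {p}

theorem evalWord_insertVar (x : ι × ℕ) (l : List (ι × ℕ)) :
    ((insertVar p code x l).1 : ℂ) • evalWord p (insertVar p code x l).2 =
      gen p x.1 x.2 * evalWord p l := by
  induction l with
  | nil => simp [insertVar, evalWord]
  | cons y l ih =>
    rw [insertVar]
    split_ifs with h1 h2
    · obtain ⟨rfl, h⟩ := h1
      rw [show evalWord p (x :: l) = gen p x.1 x.2 * evalWord p l from rfl, ← mul_assoc,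
        gen_mul_self_of_odd _ _ h]
      simp
    · simp [evalWord]
    · push_cast
      rw [evalWord, evalWord, mul_smul, ← mul_smul_comm, ih, ← mul_assoc, ← mul_assoc,
        gen_mul_gen x.1 y.1, cast_sign, smul_mul_assoc]

theorem evalWord_sortWord (l : List (ι × ℕ)) :
    ((sortWord p code l).1 : ℂ) • evalWord p (sortWord p code l).2 = evalWord p l := by
  induction l with
  | nil => simp [sortWord, evalWord]
  | cons x l ih =>
    rw [sortWord, evalWord, ← ih]
    push_cast
    rw [mul_smul, evalWord_insertVar, mul_smul_comm]

theorem eval_collect (t : ℚ × List (ι × ℕ)) (P : Formal ι) :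
    eval p (collect t P) = (t.1 : ℂ) • evalWord p t.2 + eval p P := by
  induction P with
  | nil =>
    rw [collect]
    split_ifs with h <;> simp [eval, h]
  | cons s P ih =>
    rw [collect]
    split_ifs with h1 h2
    · have : (t.1 : ℂ) + (s.1 : ℂ) = 0 := by exact_mod_cast h2
      rw [eval, h1, ← add_assoc, ← add_smul, this, zero_smul, zero_add]
    · rw [eval, eval, h1]
      push_cast
      rw [add_smul, add_assoc]
    · rw [eval, ih, eval]
      abel

theorem eval_norm (P : Formal ι) : eval p (norm p code P) = eval p P := by
  induction P with
  | nil => rfl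
  | cons t P ih =>
    rw [norm, eval_collect, ih, eval]
    push_cast
    rw [mul_smul, evalWord_sortWord]

/-- Two combinations have the same value if their difference has the empty normal form. Equalities
between explicit elements are proved by this criterion, checked by evaluation in the kernel. -/
theorem eval_congr {P Q : Formal ι} (h : norm p code (add P (smul (-1) Q)) = []) :
    eval p P = eval p Q := by
  have e := eval_norm (p := p) code (add P (smul (-1) Q))
  rw [h, eval_add, eval_smul] at e
  rw [← sub_eq_zero]
  calc eval p P - eval p Q = eval p P + ((-1 : ℚ) : ℂ) • eval p Q := by push_cast; module
    _ = 0 := e.symm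

end Norm

end Formal

end SuperPoly

/-! ### Symbolic computation of `χ`-brackets -/

namespace SuperPoly

namespace Formal

variable {ι : Type} {p : ι → ℕ}

/-- The action of `χ + D`, on symbolic elements of `𝒫[χ]`. -/
def chiPlusD (p : ι → ℕ) (F : ℕ → Formal ι) : ℕ → Formal ι
  | 0 => D p (F 0)
  | n + 1 => smul (sign (n + 1)) (add (D p (F (n + 1))) (smul (-1) (F n)))

theorem eval_chiPlusD (F : ℕ → Formal ι) :
    (fun n => eval p (chiPlusD p F n)) = SuperPoly.chiPlusD (fun n => eval p (F n)) := by
  ext n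
  cases n with
  | zero => rw [chiPlusD, eval_D, chiPlusD_apply_zero]
  | succ n =>
    rw [chiPlusD, eval_smul, eval_add, eval_smul, eval_D, chiPlusD_apply_succ, cast_sign]
    push_cast
    module

theorem eval_iterate_chiPlusD (F : ℕ → Formal ι) (k : ℕ) :
    (fun n => eval p ((chiPlusD p)^[k] F n)) = SuperPoly.chiPlusD^[k] (fun n => eval p (F n)) := by
  induction k with
  | zero => rfl
  | succ k ih => rw [Function.iterate_succ_apply', Function.iterate_succ_apply', eval_chiPlusD, ih]

/-- The map `{a_χ ·}` for `a` of parity `q` with `{a_χ u_i} = V i`, on symbolic elements. -/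
def rightExtend (p : ι → ℕ) (q : ℕ) (V : ι → ℕ → Formal ι) (P : Formal ι) (n : ℕ) : Formal ι :=
  der p (q + n + 1) (fun i k => parityPart p (q + n + 1 + (p i + k))
    (smul (sign (k * (q + 1))) ((chiPlusD p)^[k] (V i) n))) P

theorem eval_rightExtend (q : ℕ) (V : ι → ℕ → Formal ι) (P : Formal ι) (n : ℕ) :
    eval p (rightExtend p q V P n) =
      SuperPoly.rightExtend q (fun i n => eval p (V i n)) (eval p P) n := by
  rw [rightExtend, eval_superDer, SuperPoly.rightExtend]
  congr 2
  ext i k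
  rw [eval_smul, cast_sign, ← eval_iterate_chiPlusD]

/-- The degree in `χ` of `{a_χ b}` is bounded by the order of `b`. -/
theorem rightExtend_eval_eq_zero (q : ℕ) {V : ι → ℕ → SuperPoly p} {m n : ℕ}
    (hV : ∀ i k, m ≤ k → V i k = 0) {P : Formal ι}
    (hP : P.all (fun t => t.2.all fun x => decide (m + x.2 ≤ n)) = true) :
    SuperPoly.rightExtend q V (eval p P) n = 0 := by
  rw [SuperPoly.rightExtend]
  set d := superDer (q + n + 1)
    (fun j k => (-1 : ℂ) ^ (k * (q + 1)) • (SuperPoly.chiPlusD^[k] (V j)) n) with hd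
  have hw : ∀ l : List (ι × ℕ), (l.all fun x => decide (m + x.2 ≤ n)) = true →
      d (evalWord p l) = 0 := by
    intro l hl
    induction l with
    | nil => exact (isSuperDer_superDer _ _).map_one
    | cons x l ih =>
      rw [List.all_cons, Bool.and_eq_true, decide_eq_true_eq] at hl
      have e : d (gen p x.1 x.2) = 0 := by
        rw [hd, superDer_gen', iterate_chiPlusD_eq_zero (hV x.1) _ _ hl.1]
        simp [SuperPoly.parityPart]
      rw [evalWord, hd, superDer_mul, ← hd, ih hl.2, e, mul_zero, zero_mul, add_zero]
  induction P with
  | nil => exact map_zero d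
  | cons t P ih =>
    rw [List.all_cons, Bool.and_eq_true] at hP
    rw [eval, map_add, map_smul, hw _ hP.1, ih hP.2, smul_zero, add_zero]

/-- The sum of the symbolic elements `f x` over a list. -/
def sum {α : Type} (l : List α) (f : α → Formal ι) : Formal ι := l.flatMap f

theorem eval_sum {α : Type} (l : List α) (f : α → Formal ι) :
    eval p (sum l f) = (l.map fun x => eval p (f x)).sum := by
  induction l with
  | nil => rfl
  | cons x l ih =>
    rw [sum, List.flatMap_cons, eval_append, ← sum, ih, List.map_cons, List.sum_cons]

theorem eval_sum_range (m : ℕ) (f : ℕ → Formal ι) :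
    eval p (sum (List.range m) f) = ∑ n ∈ Finset.range m, eval p (f n) := by
  rw [eval_sum]
  rfl

end Formal

end SuperPoly

/-! ### The projection onto `𝒫` -/

namespace Osp

open OspBasis SuperPoly

theorem proj_gen (a : OspBasis) (n : ℕ) : proj (bar a n) = projGen a n := lift_gen _ _ a n

theorem isHomogeneous_projGen (a : OspBasis) (n : ℕ) :
    IsHomogeneous (revParity a + n) (projGen a n) := by
  rw [projGen]
  split_ifs with h1 h2
  · exact isHomogeneous_gen a n
  · subst h2
    cases a <;> simp [deg] at h1 <;> simp [form, revParity, parity, IsHomogeneous]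
  · exact isHomogeneous_zero _

theorem proj_parityAut (x : PolyG) : proj (parityAut x) = parityAut (proj x) := by
  induction x using SuperPoly.induction with
  | hs c => simp
  | hg i n => rw [parityAut_gen, map_smul, proj_gen, isHomogeneous_projGen]
  | ha a b h1 h2 => simp [h1, h2]
  | hm a b h1 h2 => simp [h1, h2]

theorem proj_D (x : PolyG) : proj (D x) = D (proj x) := by
  induction x using SuperPoly.induction with
  | hs c => simp [D_algebraMap]
  | hg i n =>
    rw [D_gen, proj_gen, proj_gen, projGen, projGen]
    by_cases h1 : deg i ≤ 0
    · rw [if_pos h1, if_pos h1, D_gen]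
    · rw [if_neg h1, if_neg h1, if_neg n.succ_ne_zero]
      split_ifs
      · rw [D_algebraMap]
      · rw [map_zero]
  | ha a b h1 h2 => simp [h1, h2]
  | hm a b h1 h2 => simp only [D_mul, map_add, map_mul, h1, h2, proj_parityAut]

theorem bar_mem_polyB {a : OspBasis} (ha : deg a ≤ 0) (n : ℕ) : bar a n ∈ polyB :=
  Algebra.subset_adjoin ⟨a, n, ha, rfl⟩

theorem parityAut_mem_polyB {x : PolyG} (hx : x ∈ polyB) : parityAut x ∈ polyB := by
  induction hx using Algebra.adjoin_induction with
  | mem x h =>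
    obtain ⟨a, n, ha, rfl⟩ := h
    rw [parityAut_gen]
    exact polyB.smul_mem (bar_mem_polyB ha n) _
  | algebraMap c => simp
  | add x y _ _ h1 h2 => rw [map_add]; exact polyB.add_mem h1 h2
  | mul x y _ _ h1 h2 => rw [map_mul]; exact polyB.mul_mem h1 h2

theorem D_mem_polyB {x : PolyG} (hx : x ∈ polyB) : D x ∈ polyB := by
  induction hx using Algebra.adjoin_induction with
  | mem x h =>
    obtain ⟨a, n, ha, rfl⟩ := h
    rw [D_gen]
    exact bar_mem_polyB ha _
  | algebraMap c => rw [D_algebraMap]; exact polyB.zero_mem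
  | add x y _ _ h1 h2 => rw [map_add]; exact polyB.add_mem h1 h2
  | mul x y hx hy h1 h2 =>
    rw [D_mul]
    exact polyB.add_mem (polyB.mul_mem (parityAut_mem_polyB hx) h2) (polyB.mul_mem h1 hy)

/-! ### Symbolic computation in `𝒫(𝔤̄)` -/

/-- A numbering of the basis. -/
def code : OspBasis → ℕ
  | f3 => 0 | f2 => 1 | f1 => 2 | h1 => 3 | h2 => 4 | e1 => 5 | e2 => 6 | e3 => 7

/-- Symbolic elements of `𝒫(𝔤̄)`. -/
abbrev FormalG : Type := Formal OspBasis

/-- The element of `𝒫(𝔤̄)` that a symbolic element stands for. -/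
abbrev ev (P : FormalG) : PolyG := Formal.eval revParity P

/-- Normal forms of symbolic elements. -/
abbrev nf (P : FormalG) : FormalG := Formal.norm revParity code P

theorem ev_nf (P : FormalG) : ev (nf P) = ev P := Formal.eval_norm code P

theorem sum_structConst_smul {M : Type*} [AddCommGroup M] (a b : OspBasis) (u : OspBasis → M) :
    ∑ c, structConst a b c • u c = ((bracketList a b).map fun x => x.1 • u x.2).sum := by
  simp only [structConst]
  generalize bracketList a b = l
  induction l with
  | nil => simp
  | cons x l ih => simp [add_smul, Finset.sum_add_distrib, ih, ite_smul]

/-- The affine bracket between the variables. -/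
def formalAffine (a b : OspBasis) : ℕ → FormalG
  | 0 => (bracketList a b).map fun x => (Formal.sign (parity a) * x.1, [(x.2, 0)])
  | 1 => if form a b = 0 then [] else Formal.const (Formal.sign (parity a) * form a b)
  | _ => []

theorem ev_formalAffine (a b : OspBasis) (n : ℕ) : ev (formalAffine a b n) = affineGen a b n := by
  match n with
  | 0 =>
    rw [formalAffine, affineGen, sum_structConst_smul]
    generalize bracketList a b = l
    induction l with
    | nil => simp [Formal.eval]
    | cons x l ih =>
      simp only [ev, List.map_cons, List.sum_cons, Formal.eval, smul_add] at ih ⊢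
      rw [ih]
      push_cast
      rw [Formal.cast_sign, mul_smul, Int.cast_smul_eq_zsmul]
      simp [Formal.evalWord]
  | 1 =>
    rw [formalAffine, affineGen]
    split_ifs with h
    · simp [h, Formal.eval]
    · rw [ev, Formal.eval_const, Rat.cast_mul, Formal.cast_sign, Rat.cast_intCast, map_mul,
        Algebra.smul_def]
  | n + 2 => rfl

/-- The projection `π`, on symbolic elements. -/
def formalProj (P : FormalG) : FormalG :=
  Formal.subst (fun a n => if deg a ≤ 0 then Formal.var a n
    else if n = 0 then Formal.const (form f2 a) else []) P

theorem ev_formalProj (P : FormalG) : ev (formalProj P) = proj (ev P) := by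
  apply Formal.eval_subst proj
  intro a n
  rw [proj_gen, projGen]
  split_ifs with h1 h2
  · rw [Formal.eval_var]
  · rw [Formal.eval_const]
    simp
  · rfl

theorem affineGen_eq_zero (a b : OspBasis) (n : ℕ) (h : 2 ≤ n) : affineGen a b n = 0 := by
  obtain ⟨n, rfl⟩ := Nat.exists_eq_add_of_le' h
  rfl

theorem isHomogeneous_affineGen (a b : OspBasis) (n : ℕ) :
    IsHomogeneous (revParity a % 2 + 1 + revParity b + n) (affineGen a b n) := by
  by_cases hn : 2 ≤ n
  · rw [affineGen_eq_zero a b n hn]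
    exact isHomogeneous_zero _
  · have h : ∀ (a b : OspBasis) (n : Fin 2), (formalAffine a b n).all (fun t =>
        Formal.wordParity revParity t.2 % 2 == (revParity a % 2 + 1 + revParity b + n) % 2)
        = true := by
      decide +kernel
    rw [← ev_formalAffine]
    exact Formal.isHomogeneous_eval (h a b ⟨n, by omega⟩)

/-- The bracket `{ā_χ ·}₁` of a variable: skew-symmetry of the affine bracket. -/
theorem bracket₁_bar (a : OspBasis) (b : PolyG) :
    bracket₁ (bar a 0) b = rightExtend (revParity a % 2) (affineGen a) b := by
  rw [bracket₁, chiBracket_of_isHomogeneous affineGen (q := revParity a % 2) (Nat.mod_lt _ two_pos)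
    ((isHomogeneous_gen a 0).congr (by simp))]
  congr 1
  ext j k
  have hF : rightExtend (revParity j) (affineGen j) (bar a 0) = fun n =>
      parityPart (revParity j + n + 1 + (revParity a + 0)) (affineGen j a n) := by
    ext n
    rw [rightExtend, superDer_gen']
    simp
  rw [hF, Pi.smul_apply, chiFlip_eq_sum (m := 2)
    (fun n hn => by rw [affineGen_eq_zero j a n hn]; simp [parityPart])]
  simp only [Finset.sum_range_succ, Finset.sum_range_zero, zero_add, pow_zero, one_smul, pow_one,
    Function.iterate_zero, id_eq, Function.iterate_one]
  match k with
  | 0 =>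
    have h : ∀ a j : OspBasis, nf (Formal.add
        (Formal.smul (Formal.sign (revParity a % 2 * revParity j))
        (Formal.add (Formal.parityPart revParity (revParity j + 0 + 1 + (revParity a + 0))
          (formalAffine j a 0)) (Formal.smul (-1) (Formal.D revParity (Formal.parityPart revParity
            (revParity j + 1 + 1 + (revParity a + 0)) (formalAffine j a 1))))))
        (Formal.smul (-1) (formalAffine a j 0))) = [] := by
      decide +kernel
    have := Formal.eval_congr code (h a j)
    simp only [Formal.eval_smul, Formal.eval_add, Formal.eval_parityPart, Formal.eval_D,
      ev_formalAffine, Formal.cast_sign] at this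
    rw [chiPlusD_apply_zero, Pi.single_eq_same, Pi.single_eq_same, ← this]
    push_cast
    rfl
  | 1 =>
    have h : ∀ a j : OspBasis, nf (Formal.add
        (Formal.smul (Formal.sign (revParity a % 2 * revParity j))
        (Formal.smul (-1) (Formal.parityPart revParity (revParity j + 1 + 1 + (revParity a + 0))
          (formalAffine j a 1))))
        (Formal.smul (-1) (formalAffine a j 1))) = [] := by
      decide +kernel
    have := Formal.eval_congr code (h a j)
    simp only [Formal.eval_smul, Formal.eval_parityPart, ev_formalAffine, Formal.cast_sign] at this
    rw [chiPlusD_apply_succ, Pi.single_eq_same, ← this]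
    simp
  | k + 2 =>
    rw [chiPlusD_apply_succ]
    simp [affineGen]

/-! ### The generalized `W`-algebra is a differential subalgebra -/

theorem mem_wAlgebra {x : PolyG} : x ∈ wAlgebra ↔ x ∈ polyB ∧ ∀ a : OspBasis, deg a = 1 → ∀ k,
    proj (rightExtend (revParity a % 2) (affineGen a) x k) = 0 := by
  simp only [wAlgebra, Set.mem_ofPred_eq, bracket₁_bar]

/-- `𝒲` is closed under `D`, by right sesquilinearity of the brackets `{n̄_χ ·}₁` and since `ℐ`
is a differential ideal. -/
theorem D_mem_wAlgebra {x : PolyG} (hx : x ∈ wAlgebra) : D x ∈ wAlgebra := by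
  rw [mem_wAlgebra] at hx ⊢
  refine ⟨D_mem_polyB hx.1, fun a ha k => ?_⟩
  rw [rightExtend_D _ _ (isHomogeneous_affineGen a), map_smul]
  cases k with
  | zero => rw [chiPlusD_apply_zero, proj_D, hx.2 a ha, map_zero, smul_zero]
  | succ k =>
    rw [chiPlusD_apply_succ, map_smul, map_sub, proj_D, hx.2 a ha, hx.2 a ha, map_zero, sub_zero,
      smul_zero, smul_zero]

theorem parityAut_mem_wAlgebra {x : PolyG} (hx : x ∈ wAlgebra) : parityAut x ∈ wAlgebra := by
  rw [mem_wAlgebra] at hx ⊢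
  refine ⟨parityAut_mem_polyB hx.1, fun a ha k => ?_⟩
  have h := hx.2 a ha k
  rw [rightExtend] at h ⊢
  rw [superDer_parityAut, map_smul, proj_parityAut, h, map_zero, smul_zero]

/-- `𝒲` as a subalgebra. -/
def wSubalgebra : Subalgebra ℂ PolyG where
  carrier := wAlgebra
  mul_mem' := by
    intro x y hx hy
    rw [mem_wAlgebra] at hx hy ⊢
    refine ⟨polyB.mul_mem hx.1 hy.1, fun a ha k => ?_⟩
    have h1 := hx.2 a ha k
    have h2 := hy.2 a ha k
    rw [rightExtend] at h1 h2 ⊢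
    rw [superDer_mul, map_add, map_mul, map_mul, h1, h2, mul_zero, zero_mul, add_zero]
  add_mem' := by
    intro x y hx hy
    rw [mem_wAlgebra] at hx hy ⊢
    refine ⟨polyB.add_mem hx.1 hy.1, fun a ha k => ?_⟩
    have h1 := hx.2 a ha k
    have h2 := hy.2 a ha k
    rw [rightExtend] at h1 h2 ⊢
    rw [map_add, map_add, h1, h2, add_zero]
  algebraMap_mem' := by
    intro c
    rw [mem_wAlgebra]
    refine ⟨polyB.algebraMap_mem c, fun a ha k => ?_⟩
    rw [rightExtend, (isSuperDer_superDer _ _).map_algebraMap, map_zero]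

/-! ### Generators of the `W`-algebra and Hamiltonian flows -/

theorem ev_mem_polyB {P : FormalG}
    (h : P.all (fun t => t.2.all fun x => decide (deg x.1 ≤ 0)) = true) : ev P ∈ polyB := by
  have hw : ∀ l : List (OspBasis × ℕ), (l.all fun x => decide (deg x.1 ≤ 0)) = true →
      Formal.evalWord revParity l ∈ polyB := by
    intro l hl
    induction l with
    | nil => exact polyB.one_mem
    | cons x l ih =>
      rw [List.all_cons, Bool.and_eq_true, decide_eq_true_eq] at hl
      exact polyB.mul_mem (bar_mem_polyB hl.1 _) (ih hl.2)
  induction P with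
  | nil => exact polyB.zero_mem
  | cons t P ih =>
    rw [List.all_cons, Bool.and_eq_true] at h
    exact polyB.add_mem (polyB.smul_mem (hw _ h.1) _) (ih h.2)

/-- A criterion for membership in `𝒲`, for polynomials in the variables and their first
derivatives: the coefficients of `χ^k` in the brackets have to be checked for `k < 3` only. -/
theorem ev_mem_wAlgebra {P : FormalG}
    (hB : P.all (fun t => t.2.all fun x => decide (deg x.1 ≤ 0)) = true)
    (h1 : P.all (fun t => t.2.all fun x => decide (2 + x.2 ≤ 3)) = true)
    (h : ∀ (a : OspBasis) (k : Fin 3), deg a = 1 → nf (formalProj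
      (Formal.rightExtend revParity (revParity a % 2) (formalAffine a) P k)) = []) :
    ev P ∈ wAlgebra := by
  rw [mem_wAlgebra]
  refine ⟨ev_mem_polyB hB, fun a ha k => ?_⟩
  by_cases hk : 3 ≤ k
  · rw [Formal.rightExtend_eval_eq_zero (m := 2) _ (affineGen_eq_zero a), map_zero]
    simp only [List.all_eq_true, decide_eq_true_eq] at h1 ⊢
    exact fun t ht x hx => (h1 t ht x hx).trans hk
  · have e : affineGen a = fun b n => ev (formalAffine a b n) := by
      ext b n
      rw [ev_formalAffine]
    have := h a ⟨k, by omega⟩ ha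
    rw [e, ← Formal.eval_rightExtend, ← ev_formalProj, ← ev_nf, this]
    rfl

/-- `w₁ = ē₁/2`. -/
def formalW₁ : FormalG := [(1 / 2, [(e1, 0)])]

/-- `w₂ = -h̄₂/4`. -/
def formalW₂ : FormalG := [(-1 / 4, [(h2, 0)])]

/-- `w₃ = ē₁f̄₁/4 - f̄₂/2 - h̄₁h̄₂/8 - h̄₁'/4`. -/
def formalW₃ : FormalG :=
  [(1 / 4, [(e1, 0), (f1, 0)]), (-1 / 2, [(f2, 0)]), (-1 / 8, [(h1, 0), (h2, 0)]),
    (-1 / 4, [(h1, 1)])]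

/-- `w₄ = -f̄₁h̄₁/8 - f̄₁h̄₂/8 + f̄₁'/4 + f̄₃/4`. -/
def formalW₄ : FormalG :=
  [(-1 / 8, [(f1, 0), (h1, 0)]), (-1 / 8, [(f1, 0), (h2, 0)]), (1 / 4, [(f1, 1)]),
    (1 / 4, [(f3, 0)])]

theorem ev_formalW₁_mem : ev formalW₁ ∈ wAlgebra :=
  ev_mem_wAlgebra (by decide +kernel) (by decide +kernel) (by decide +kernel)

theorem ev_formalW₂_mem : ev formalW₂ ∈ wAlgebra :=
  ev_mem_wAlgebra (by decide +kernel) (by decide +kernel) (by decide +kernel)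

theorem ev_formalW₃_mem : ev formalW₃ ∈ wAlgebra :=
  ev_mem_wAlgebra (by decide +kernel) (by decide +kernel) (by decide +kernel)

theorem ev_formalW₄_mem : ev formalW₄ ∈ wAlgebra :=
  ev_mem_wAlgebra (by decide +kernel) (by decide +kernel) (by decide +kernel)

/-- The value on the variable `ū_j` of the flow of `∫P`, for an odd `P` of order less than
`N - 1`. It is `± ∑ (-D)^n F_n`, where `{ū_j χ P}₁ = ∑ χ^n F_n`. -/
def formalFlowGen (N : ℕ) (P : FormalG) (j : OspBasis) : FormalG :=
  nf (Formal.smul (Formal.sign (revParity j)) (Formal.sum (List.range N) fun n =>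
    Formal.smul (Formal.sign n) ((Formal.D revParity)^[n]
      (nf (Formal.rightExtend revParity (revParity j) (formalAffine j) P n)))))

/-- The flow of `∫P`, for an odd `P` of order less than `N - 1`. -/
def formalFlow (N : ℕ) (P Q : FormalG) : FormalG :=
  formalProj (Formal.der revParity 2 (fun j k => Formal.parityPart revParity
    (2 + (revParity j + k)) ((Formal.D revParity)^[k] (formalFlowGen N P j))) Q)

/-- The symbolic flow is the Hamiltonian flow. Only the coefficient of `χ⁰` in `{a_χ b}₁` is
needed, which is an evolutionary derivation in `b`. -/
theorem ev_formalFlow {N : ℕ} {P : FormalG}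
    (hP : P.all (fun t => Formal.wordParity revParity t.2 % 2 == 1) = true)
    (hN : P.all (fun t => t.2.all fun x => decide (2 + x.2 ≤ N)) = true) (Q : FormalG) :
    ev (formalFlow N P Q) = flow (ev P) (ev Q) := by
  have hgen : ∀ j, ev (formalFlowGen N P j) = ((-1 : ℂ) ^ (1 * revParity j) •
      chiFlip (rightExtend (revParity j) (affineGen j) (ev P))) 0 := by
    intro j
    have e : affineGen j = fun b n => ev (formalAffine j b n) := by
      ext b n
      rw [ev_formalAffine]
    have hz : ∀ n, N ≤ n → rightExtend (revParity j) (affineGen j) (ev P) n = 0 := by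
      intro n hn
      apply Formal.rightExtend_eval_eq_zero (m := 2) _ (affineGen_eq_zero j)
      simp only [List.all_eq_true, decide_eq_true_eq] at hN ⊢
      exact fun t ht x hx => (hN t ht x hx).trans hn
    rw [formalFlowGen, ev_nf, ev, Formal.eval_smul, Formal.eval_sum_range, Formal.cast_sign,
      one_mul, Pi.smul_apply, chiFlip_eq_sum hz]
    congr 1
    apply Finset.sum_congr rfl
    intro n _
    rw [Formal.eval_smul, Formal.cast_sign, Formal.eval_iterate_D, Formal.eval_norm,
      Formal.eval_rightExtend, iterate_chiPlusD_apply_zero, Pi.single_eq_same, e]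
  rw [formalFlow, ev_formalProj, flow, bracket₁, chiBracket_of_isHomogeneous affineGen (q := 1)
    (by norm_num) (Formal.isHomogeneous_eval hP), ev, Formal.eval_superDer, rightExtend]
  congr 3
  ext j k
  rw [Formal.eval_iterate_D, show Formal.eval revParity (formalFlowGen N P j) = _ from hgen j,
    iterate_chiPlusD_apply_zero,
    (show Even (k * (1 + 1)) from ⟨k, by ring⟩).neg_one_pow, one_smul]

/-- Symbolic form of the density `-4 w₂`. -/
def formalRho₀ : FormalG := Formal.smul (-4) formalW₂

/-- Symbolic form of the density `4 w₁ w₄`. -/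
def formalRho₁ : FormalG := nf (Formal.smul 4 (Formal.mul formalW₁ formalW₄))

/-- A flow is computed by comparing normal forms. -/
theorem flow_congr {N : ℕ} {P Q R : FormalG}
    (hP : P.all (fun t => Formal.wordParity revParity t.2 % 2 == 1) = true)
    (hN : P.all (fun t => t.2.all fun x => decide (2 + x.2 ≤ N)) = true)
    (h : nf (Formal.add (formalFlow N P Q) (Formal.smul (-1) R)) = []) :
    flow (ev P) (ev Q) = ev R := by
  rw [← ev_formalFlow hP hN]
  exact Formal.eval_congr code h

theorem flow_formalRho₀ :
    flow (ev formalRho₀) (ev formalW₁) = ev (Formal.smul 2 formalW₁) ∧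
    flow (ev formalRho₀) (ev formalW₂) = ev [] ∧
    flow (ev formalRho₀) (ev formalW₃) = ev [] ∧
    flow (ev formalRho₀) (ev formalW₄) = ev (Formal.smul (-2) formalW₄) := by
  refine ⟨flow_congr (N := 2) ?_ ?_ ?_, flow_congr (N := 2) ?_ ?_ ?_,
    flow_congr (N := 2) ?_ ?_ ?_, flow_congr (N := 2) ?_ ?_ ?_⟩ <;> decide +kernel

open Formal in
theorem flow_formalRho₁ :
    flow (ev formalRho₁) (ev formalW₁) = ev (add (Formal.D revParity (Formal.D revParity formalW₁))
      (add (smul (-2) (Formal.D revParity (mul formalW₁ formalW₂)))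
        (smul (-2) (mul formalW₁ formalW₃)))) ∧
    flow (ev formalRho₁) (ev formalW₂) = ev [] ∧
    flow (ev formalRho₁) (ev formalW₃) = ev (smul (-8) (mul (mul formalW₁ formalW₂) formalW₄)) ∧
    flow (ev formalRho₁) (ev formalW₄) = ev (add (Formal.D revParity (Formal.D revParity formalW₄))
      (add (smul 2 (mul formalW₂ (Formal.D revParity formalW₄)))
        (smul 2 (mul formalW₃ formalW₄)))) := by
  refine ⟨flow_congr (N := 3) ?_ ?_ ?_, flow_congr (N := 3) ?_ ?_ ?_,
    flow_congr (N := 3) ?_ ?_ ?_, flow_congr (N := 3) ?_ ?_ ?_⟩ <;> decide +kernel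

/-! ### Brackets of loops -/

theorem structConst_parity {a b c : OspBasis} (h : structConst a b c ≠ 0) :
    (parity a + parity b) % 2 = parity c % 2 := by
  have : ∀ a b c : OspBasis, structConst a b c ≠ 0 →
      (parity a + parity b) % 2 = parity c % 2 := by decide +kernel
  exact this a b c h

theorem structConst_deg (a b c : OspBasis) (h : structConst a b c ≠ 0) :
    deg c = deg a + deg b := by
  have : ∀ a b c : OspBasis, structConst a b c ≠ 0 → deg c = deg a + deg b := by decide +kernel
  exact this a b c h

/-- The bracket of `𝔤 ⊗ 𝒫(𝔤̄)`, in coordinates. -/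
def vecBracket (x y : OspBasis → PolyG) : OspBasis → PolyG := fun c =>
  ∑ a, ∑ b, (structConst a b c : ℂ) •
    ((parityAut ^ parity b : PolyG →ₐ[ℂ] PolyG) (x a) * y b)

/-- The action of `D` on `𝔤 ⊗ 𝒫(𝔤̄)`, in coordinates. -/
def vecD (x : OspBasis → PolyG) : OspBasis → PolyG := fun a => (-1 : ℂ) ^ parity a • D (x a)

/-- The coefficient of `z^{-n}`. -/
def level (n : ℤ) (X : LoopG) : OspBasis → PolyG := fun a => (X a).coeff n

theorem coeff_loopBracket (X Y : LoopG) (c : OspBasis) (n : ℤ) :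
    (loopBracket X Y c).coeff n = ∑ a, ∑ b, (structConst a b c : ℂ) •
      ((X a).map (parityAut ^ parity b : PolyG →ₐ[ℂ] PolyG) * Y b).coeff n := by
  simp only [loopBracket, HahnSeries.coeff_sum, HahnSeries.coeff_smul]
  refine Finset.sum_congr rfl fun a _ => Finset.sum_congr rfl fun b _ => ?_
  exact (Int.cast_smul_eq_zsmul ℂ _ _).symm

theorem coeff_mul_mem {S : Submodule ℂ PolyG} {x y : HahnSeries ℤ PolyG} {n : ℤ}
    (h : ∀ i j, i + j = n → x.coeff i * y.coeff j ∈ S) : (x * y).coeff n ∈ S := by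
  rw [HahnSeries.coeff_mul]
  exact S.sum_mem fun ij hij => h _ _ (by simpa using (Finset.mem_antidiagonal.1 hij).2.2)

/-- A coefficient of a bracket lies in a subspace that contains all the products it consists of. -/
theorem coeff_loopBracket_mem {S : Submodule ℂ PolyG} {X Y : LoopG} {c : OspBasis} {n : ℤ}
    (h : ∀ a b i j, i + j = n → structConst a b c ≠ 0 →
      (parityAut ^ parity b : PolyG →ₐ[ℂ] PolyG) ((X a).coeff i) * (Y b).coeff j ∈ S) :
    (loopBracket X Y c).coeff n ∈ S := by
  rw [coeff_loopBracket]
  refine S.sum_mem fun a _ => S.sum_mem fun b _ => ?_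
  by_cases h0 : structConst a b c = 0
  · rw [h0, Int.cast_zero, zero_smul]
    exact S.zero_mem
  · exact S.smul_mem _ (coeff_mul_mem fun i j hij => h a b i j hij h0)

theorem coeff_mul_eq_sum_Icc {x y : HahnSeries ℤ PolyG} {i j : ℤ} (hx : ∀ k < i, x.coeff k = 0)
    (hy : ∀ k < j, y.coeff k = 0) (n : ℤ) :
    (x * y).coeff n = ∑ k ∈ Finset.Icc i (n - j), x.coeff k * y.coeff (n - k) := by
  rw [HahnSeries.coeff_mul]
  refine Finset.sum_bij_ne_zero (fun ij _ _ => ij.1) ?_ ?_ ?_ ?_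
  · intro ij hij h
    have hij := (Finset.mem_antidiagonal.1 hij).2.2
    rw [Finset.mem_Icc]
    constructor
    · by_contra hlt
      exact h (by rw [hx _ (not_le.1 hlt), zero_mul])
    · by_contra hlt
      exact h (by rw [hy ij.2 (by omega), mul_zero])
  · intro a ha _ b hb _ hab
    have ha := (Finset.mem_antidiagonal.1 ha).2.2
    have hb := (Finset.mem_antidiagonal.1 hb).2.2
    ext
    · exact hab
    · omega
  · intro k _ hk
    refine ⟨(k, n - k), ?_, hk, rfl⟩
    rw [Finset.mem_antidiagonal]
    exact ⟨fun h => hk (by rw [h, zero_mul]), fun h => hk (by rw [h, mul_zero]), by simp⟩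
  · intro ij hij _
    have hij := (Finset.mem_antidiagonal.1 hij).2.2
    rw [show n - ij.1 = ij.2 by omega]

theorem level_loopBracket {X Y : LoopG} {i j : ℤ} (hX : ∀ k < i, level k X = 0)
    (hY : ∀ k < j, level k Y = 0) (n : ℤ) :
    level n (loopBracket X Y) =
      ∑ k ∈ Finset.Icc i (n - j), vecBracket (level k X) (level (n - k) Y) := by
  ext c
  rw [level, coeff_loopBracket, Finset.sum_apply]
  simp only [vecBracket]
  rw [Finset.sum_comm (s := Finset.Icc i (n - j))]
  refine Finset.sum_congr rfl fun a _ => ?_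
  rw [Finset.sum_comm (s := Finset.Icc i (n - j))]
  refine Finset.sum_congr rfl fun b _ => ?_
  rw [coeff_mul_eq_sum_Icc (i := i) (j := j)
    (fun k hk => by
      have := congrFun (hX k hk) a
      simp only [level, Pi.zero_apply] at this
      simp [this])
    (fun k hk => congrFun (hY k hk) b), Finset.smul_sum]
  rfl

theorem level_loopD (n : ℤ) (X : LoopG) : level n (loopD X) = vecD (level n X) := by
  ext a
  simp [level, loopD, vecD]

theorem map_add_hahnSeries (f : PolyG →ₐ[ℂ] PolyG) (x y : HahnSeries ℤ PolyG) :
    (x + y).map f = x.map f + y.map f := by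
  ext n
  simp

theorem loopBracket_add_left (X X' Y : LoopG) :
    loopBracket (X + X') Y = loopBracket X Y + loopBracket X' Y := by
  ext c n
  simp only [Pi.add_apply, HahnSeries.coeff_add, coeff_loopBracket, map_add_hahnSeries, add_mul,
    smul_add, Finset.sum_add_distrib]

theorem loopBracket_add_right (X Y Y' : LoopG) :
    loopBracket X (Y + Y') = loopBracket X Y + loopBracket X Y' := by
  ext c n
  simp only [Pi.add_apply, HahnSeries.coeff_add, coeff_loopBracket, mul_add, smul_add,
    Finset.sum_add_distrib]

/-- A form of `sub_add_cancel` that can be used for rewriting in `LoopG`: the instances in the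
general lemma agree with those of `HahnSeries` only after unfolding. -/
theorem loop_sub_add_cancel (X Y : LoopG) : X - Y + Y = X := sub_add_cancel X Y

theorem loop_eq_sub_of_add_eq {X Y Z : LoopG} (h : X + Y = Z) : X = Z - Y := by
  subst h
  ext a n
  simp

theorem loopBracket_sub_left (X X' Y : LoopG) :
    loopBracket (X - X') Y = loopBracket X Y - loopBracket X' Y := by
  apply loop_eq_sub_of_add_eq
  rw [← loopBracket_add_left, loop_sub_add_cancel]

theorem loopBracket_sub_right (X Y Y' : LoopG) :
    loopBracket X (Y - Y') = loopBracket X Y - loopBracket X Y' := by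
  apply loop_eq_sub_of_add_eq
  rw [← loopBracket_add_right, loop_sub_add_cancel]

theorem loopD_sub (X Y : LoopG) : loopD (X - Y) = loopD X - loopD Y := by
  ext a n
  simp [loopD, smul_sub]

theorem loopD_add (X Y : LoopG) : loopD (X + Y) = loopD X + loopD Y := by
  ext a n
  simp [loopD, smul_add]

/-- The loop `∑ a z^{-n} ⊗ x_a`. -/
def monoLoop (n : ℤ) (x : OspBasis → PolyG) : LoopG := fun a => HahnSeries.single n (x a)

theorem level_monoLoop (m n : ℤ) (x : OspBasis → PolyG) :
    level m (monoLoop n x) = if m = n then x else 0 := by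
  ext a
  split_ifs with h
  · subst h
    simp [level, monoLoop]
  · simp [level, monoLoop, HahnSeries.coeff_single_of_ne h]

theorem loopBracket_monoLoop (m n : ℤ) (x y : OspBasis → PolyG) :
    loopBracket (monoLoop m x) (monoLoop n y) = monoLoop (m + n) (vecBracket x y) := by
  have hm : ∀ (f : PolyG →ₐ[ℂ] PolyG) (u : PolyG),
      (HahnSeries.single m u).map f = HahnSeries.single m (f u) := by
    intro f u
    ext k
    by_cases h : k = m
    · subst h; simp
    · simp [HahnSeries.coeff_single_of_ne h]
  ext c k
  simp only [coeff_loopBracket, monoLoop, hm, HahnSeries.single_mul_single, vecBracket]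
  by_cases h : k = m + n
  · subst h
    simp
  · simp [HahnSeries.coeff_single_of_ne h]

theorem loopD_monoLoop (n : ℤ) (x : OspBasis → PolyG) :
    loopD (monoLoop n x) = monoLoop n (vecD x) := by
  ext a k
  by_cases h : k = n
  · subst h; simp [loopD, monoLoop, vecD]
  · simp [loopD, monoLoop, vecD, HahnSeries.coeff_single_of_ne h]

theorem monoLoop_add (n : ℤ) (x y : OspBasis → PolyG) :
    monoLoop n (x + y) = monoLoop n x + monoLoop n y := by
  ext a k
  simp [monoLoop]

theorem monoLoop_smul (n : ℤ) (r : ℂ) (x : OspBasis → PolyG) :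
    monoLoop n (r • x) = r • monoLoop n x := by
  ext a k
  by_cases h : k = n
  · subst h; simp [monoLoop]
  · simp [monoLoop, HahnSeries.coeff_single_of_ne h]

theorem monoLoop_sub (n : ℤ) (x y : OspBasis → PolyG) :
    monoLoop n (x - y) = monoLoop n x - monoLoop n y := by
  ext a k
  simp [monoLoop]

theorem monoLoop_injective (n : ℤ) : Function.Injective (monoLoop n) := by
  intro x y h
  have := congrArg (level n) h
  simpa [level_monoLoop] using this

theorem tens_eq_monoLoop (a : OspBasis) (k : ℤ) (u : PolyG) :
    tens a k u = monoLoop (-k) (Pi.single a u) := by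
  ext b n
  by_cases h : b = a
  · subst h; simp [tens, monoLoop]
  · simp [tens, monoLoop, h]

/-! ### Filtrations and exponentials -/

/-- `X` is in the step `d` of the filtration for which `a z^{-n} ⊗ u` has weight `wt a + m n`. -/
def InFiltration (wt : OspBasis → ℤ) (m d : ℤ) (X : LoopG) : Prop :=
  ∀ a n, wt a + m * n < d → (X a).coeff n = 0

section Filtration

variable {wt : OspBasis → ℤ} {m : ℤ}

theorem InFiltration.mono {d e : ℤ} {X : LoopG} (hX : InFiltration wt m d X) (h : e ≤ d) :
    InFiltration wt m e X := fun a n hn => hX a n (hn.trans_le h)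

theorem InFiltration.add {d : ℤ} {X Y : LoopG} (hX : InFiltration wt m d X)
    (hY : InFiltration wt m d Y) : InFiltration wt m d (X + Y) := fun a n hn => by
  rw [Pi.add_apply, HahnSeries.coeff_add, hX a n hn, hY a n hn, add_zero]

theorem InFiltration.sub {d : ℤ} {X Y : LoopG} (hX : InFiltration wt m d X)
    (hY : InFiltration wt m d Y) : InFiltration wt m d (X - Y) := fun a n hn => by
  rw [Pi.sub_apply, HahnSeries.coeff_sub, hX a n hn, hY a n hn, sub_zero]

theorem InFiltration.smul {d : ℤ} {X : LoopG} (hX : InFiltration wt m d X) (c : ℂ) :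
    InFiltration wt m d (c • X) := fun a n hn => by
  rw [Pi.smul_apply, HahnSeries.coeff_smul, hX a n hn, smul_zero]

theorem InFiltration.loopD {d : ℤ} {X : LoopG} (hX : InFiltration wt m d X) :
    InFiltration wt m d (loopD X) := fun a n hn => by
  simp [Osp.loopD, hX a n hn]

theorem InFiltration.loopBracket
    (hwt : ∀ a b c, structConst a b c ≠ 0 → wt c = wt a + wt b) {d e : ℤ} {X Y : LoopG}
    (hX : InFiltration wt m d X) (hY : InFiltration wt m e Y) :
    InFiltration wt m (d + e) (loopBracket X Y) := by
  intro c n hn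
  rw [← Submodule.mem_bot ℂ]
  refine coeff_loopBracket_mem fun a b i j hij h => ?_
  rw [Submodule.mem_bot]
  have := hwt a b c h
  by_cases hi : wt a + m * i < d
  · rw [hX a i hi, map_zero, zero_mul]
  · rw [hY b j (by subst hij; rw [mul_add] at hn; omega), mul_zero]

/-- The terms of the exponential series are in increasing steps of the filtration. -/
theorem inFiltration_iterate (hwt : ∀ a b c, structConst a b c ≠ 0 → wt c = wt a + wt b) {e : ℤ}
    {T A : LoopG} (hT : InFiltration wt m 1 T) (hA : InFiltration wt m e A) (k : ℕ) :
    InFiltration wt m (e + k) ((loopBracket T)^[k] A) := by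
  induction k with
  | zero => simpa using hA
  | succ k ih =>
    rw [Function.iterate_succ_apply']
    exact (hT.loopBracket hwt ih).mono (by push_cast; omega)

/-- The coefficients of the partial sums of the exponential series stabilize. -/
theorem coeff_expAdPartial_eq (hwt : ∀ a b c, structConst a b c ≠ 0 → wt c = wt a + wt b)
    {d : LoopG → LoopG} {T X : LoopG} {e : ℤ} (hT : InFiltration wt m 1 T)
    (hA : InFiltration wt m e (loopBracket T X - d T)) {a : OspBasis} {n : ℤ} {M N : ℕ}
    (hM : wt a + m * n < e + M) (hMN : M ≤ N) :
    (expAdPartial d T X N a).coeff n = (expAdPartial d T X M a).coeff n := by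
  induction N, hMN using Nat.le_induction with
  | base => rfl
  | succ N hMN ih =>
    have h : expAdPartial d T X (N + 1) = expAdPartial d T X N +
        (1 / (N + 1).factorial : ℂ) • (loopBracket T)^[N] (loopBracket T X - d T) := by
      rw [expAdPartial, expAdPartial, Finset.sum_range_succ, add_assoc]
    have hc := ((inFiltration_iterate hwt hT hA N).smul (1 / (N + 1).factorial : ℂ)) a n (by omega)
    rw [h, Pi.add_apply, HahnSeries.coeff_add, hc, add_zero, ih]

theorem ExpAdEq.coeff_eq (hwt : ∀ a b c, structConst a b c ≠ 0 → wt c = wt a + wt b)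
    {d : LoopG → LoopG} {T X Y : LoopG} {e : ℤ} (h : ExpAdEq d T X Y) (hT : InFiltration wt m 1 T)
    (hA : InFiltration wt m e (loopBracket T X - d T)) {a : OspBasis} {n : ℤ} {M : ℕ}
    (hM : wt a + m * n < e + M) : (Y a).coeff n = (expAdPartial d T X M a).coeff n := by
  obtain ⟨N, h1, h2⟩ := ((h a n).and (eventually_ge_atTop M)).exists
  rw [← h1, coeff_expAdPartial_eq hwt hT hA hM h2]

theorem expAdEq_of_coeff_eq (hwt : ∀ a b c, structConst a b c ≠ 0 → wt c = wt a + wt b)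
    {d : LoopG → LoopG} {T X Y : LoopG} {e : ℤ} (hT : InFiltration wt m 1 T)
    (hA : InFiltration wt m e (loopBracket T X - d T))
    (h : ∀ a n, ∃ M : ℕ, wt a + m * n < e + M ∧
      (Y a).coeff n = (expAdPartial d T X M a).coeff n) : ExpAdEq d T X Y := by
  intro a n
  obtain ⟨M, h1, h2⟩ := h a n
  filter_upwards [eventually_ge_atTop M] with N hN
  rw [h2, coeff_expAdPartial_eq hwt hT hA h1 hN]

end Filtration

/-! ### Parity and coefficients of loops -/

/-- The elements of `𝒲` that may occur as coefficients of `a` in a loop of parity `k`. -/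
def goodCoeff (k : ℕ) (a : OspBasis) : Submodule ℂ PolyG where
  carrier := {u | IsHomogeneous (k + parity a) u ∧ u ∈ wAlgebra}
  add_mem' hx hy := ⟨hx.1.add hy.1, wSubalgebra.add_mem hx.2 hy.2⟩
  zero_mem' := ⟨isHomogeneous_zero _, wSubalgebra.zero_mem⟩
  smul_mem' c _ hx := ⟨hx.1.smul c, wSubalgebra.smul_mem hx.2 c⟩

/-- `X` has parity `k` and coefficients in `𝒲`. -/
def IsGood (k : ℕ) (X : LoopG) : Prop := ∀ a n, (X a).coeff n ∈ goodCoeff k a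

theorem parityAut_pow_mem_wAlgebra {x : PolyG} (hx : x ∈ wAlgebra) (k : ℕ) :
    (parityAut ^ k : PolyG →ₐ[ℂ] PolyG) x ∈ wAlgebra := by
  induction k with
  | zero => exact hx
  | succ k ih =>
    rw [pow_succ', AlgHom.mul_apply]
    exact parityAut_mem_wAlgebra ih

theorem IsGood.add {k : ℕ} {X Y : LoopG} (hX : IsGood k X) (hY : IsGood k Y) :
    IsGood k (X + Y) := fun a n => (goodCoeff k a).add_mem (hX a n) (hY a n)

theorem IsGood.sub {k : ℕ} {X Y : LoopG} (hX : IsGood k X) (hY : IsGood k Y) :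
    IsGood k (X - Y) := fun a n => (goodCoeff k a).sub_mem (hX a n) (hY a n)

theorem IsGood.smul {k : ℕ} {X : LoopG} (hX : IsGood k X) (c : ℂ) :
    IsGood k (c • X) := fun a n => (goodCoeff k a).smul_mem c (hX a n)

theorem isGood_zero (k : ℕ) : IsGood k 0 := fun a _ => (goodCoeff k a).zero_mem

theorem IsGood.sum {k : ℕ} {s : Finset ℕ} {f : ℕ → LoopG} (h : ∀ i ∈ s, IsGood k (f i)) :
    IsGood k (∑ i ∈ s, f i) := by
  induction s using Finset.induction_on with
  | empty => simpa using isGood_zero k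
  | insert x s hx ih =>
    rw [Finset.sum_insert hx]
    exact (h x (by simp)).add (ih fun y hy => h y (by simp [hy]))

theorem IsGood.congr {k l : ℕ} {X : LoopG} (hX : IsGood k X) (h : k % 2 = l % 2) : IsGood l X :=
  fun a n => ⟨(hX a n).1.congr (by omega), (hX a n).2⟩

theorem IsGood.loopBracket {k l : ℕ} {X Y : LoopG} (hX : IsGood k X) (hY : IsGood l Y) :
    IsGood (k + l) (loopBracket X Y) := by
  intro c n
  refine coeff_loopBracket_mem fun a b i j _ h => ?_
  have hp := structConst_parity h
  exact ⟨(((hX a i).1.parityAut_pow _).mul (hY b j).1).congr (by omega),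
    wSubalgebra.mul_mem (parityAut_pow_mem_wAlgebra (hX a i).2 _) (hY b j).2⟩

theorem IsGood.loopD {k : ℕ} {X : LoopG} (hX : IsGood k X) : IsGood (k + 1) (loopD X) :=
  fun a n => ⟨((hX a n).1.D.congr (by omega)).smul _,
    wSubalgebra.smul_mem (D_mem_wAlgebra (hX a n).2) _⟩

theorem IsGood.expAdPartial {d : LoopG → LoopG} {T X : LoopG}
    (hd : IsGood 0 (d T)) (hT : IsGood 0 T) (hX : IsGood 0 X) (N : ℕ) :
    IsGood 0 (expAdPartial d T X N) := by
  refine hX.add (IsGood.sum fun k hk => IsGood.smul ?_ _)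
  clear hk
  induction k with
  | zero => exact ((hT.loopBracket hX).congr rfl).sub hd
  | succ k ih =>
    rw [Function.iterate_succ_apply']
    exact hT.loopBracket ih

/-! ### The square of `Λ` -/

theorem level_loopBracket_monoLoop_left (m n : ℤ) (x : OspBasis → PolyG) (Y : LoopG) :
    level n (loopBracket (monoLoop m x) Y) = vecBracket x (level (n - m) Y) := by
  ext c
  rw [level, coeff_loopBracket, vecBracket]
  refine Finset.sum_congr rfl fun a _ => Finset.sum_congr rfl fun b _ => ?_
  congr 1
  have : (monoLoop m x a).map (parityAut ^ parity b : PolyG →ₐ[ℂ] PolyG) =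
      HahnSeries.single m ((parityAut ^ parity b : PolyG →ₐ[ℂ] PolyG) (x a)) := by
    ext k
    by_cases h : k = m
    · subst h; simp [monoLoop]
    · simp [monoLoop, HahnSeries.coeff_single_of_ne h]
  rw [this, HahnSeries.coeff_single_mul]
  rfl

theorem level_loopBracket_monoLoop_right (m n : ℤ) (x : OspBasis → PolyG) (Y : LoopG) :
    level n (loopBracket Y (monoLoop m x)) = vecBracket (level (n - m) Y) x := by
  ext c
  rw [level, coeff_loopBracket, vecBracket]
  refine Finset.sum_congr rfl fun a _ => Finset.sum_congr rfl fun b _ => ?_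
  rw [monoLoop, HahnSeries.coeff_mul_single]
  rfl

/-- The eigenvalues of `ad h₂`. -/
def eig : OspBasis → ℤ
  | e1 | e3 => 2
  | f1 | f3 => -2
  | _ => 0

theorem vecBracket_h2_left (y : OspBasis → PolyG) (c : OspBasis) :
    vecBracket (Pi.single h2 1) y c = (eig c : ℂ) • y c := by
  have h : ∀ b c, structConst h2 b c = if b = c then eig c else 0 := by decide +kernel
  rw [vecBracket, Finset.sum_eq_single h2 _ (by simp), Finset.sum_eq_single c _ (by simp)]
  · simp [h]
  · intro b _ hb
    simp [h, hb]
  · intro a _ ha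
    exact Finset.sum_eq_zero fun b _ => by simp [ha]

theorem vecBracket_h2_right (y : OspBasis → PolyG) (c : OspBasis) :
    vecBracket y (Pi.single h2 1) c = -(eig c : ℂ) • y c := by
  have h : ∀ b c, structConst b h2 c = if b = c then -eig c else 0 := by decide +kernel
  rw [vecBracket, Finset.sum_comm, Finset.sum_eq_single h2 _ (by simp),
    Finset.sum_eq_single c _ (by simp)]
  · simp [h, parity]
  · intro b _ hb
    simp [h, hb]
  · intro a _ ha
    exact Finset.sum_eq_zero fun b _ => by simp [ha]

theorem vecBracket_single (a b : OspBasis) (u v : PolyG) :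
    vecBracket (Pi.single a u) (Pi.single b v) = fun c =>
      (structConst a b c : ℂ) • ((parityAut ^ parity b : PolyG →ₐ[ℂ] PolyG) u * v) := by
  ext c
  rw [vecBracket, Finset.sum_eq_single a _ (by simp), Finset.sum_eq_single b _ (by simp)]
  · simp
  · intro b' _ hb
    simp [hb]
  · intro a' _ ha
    exact Finset.sum_eq_zero fun b _ => by simp [ha]

/-- `Λ² = z h₂`. -/
theorem lamSq_eq : LamSq = monoLoop (-1) (Pi.single h2 1) := by
  have h : ∀ c, structConst f2 f2 c = 0 ∧ structConst e2 e2 c = 0 ∧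
      structConst f2 e2 c = (if c = h2 then 1 else 0) ∧
      structConst e2 f2 c = (if c = h2 then 1 else 0) := by decide +kernel
  rw [LamSq, Lam, tens_eq_monoLoop, tens_eq_monoLoop]
  simp only [loopBracket_add_left, loopBracket_add_right, loopBracket_monoLoop, vecBracket_single]
  ext c n
  by_cases hc : c = h2
  · subst hc
    by_cases hn : n = -1
    · subst hn
      simp [monoLoop, h, ← two_smul ℂ, smul_smul]
    · simp [monoLoop, h, HahnSeries.coeff_single_of_ne hn]
  · simp [monoLoop, h, hc]

theorem coeff_lamSq_bracket (Z : LoopG) (a : OspBasis) (n : ℤ) :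
    (loopBracket LamSq Z a).coeff n = (eig a : ℂ) • (Z a).coeff (n + 1) := by
  have h := congrFun (level_loopBracket_monoLoop_left (-1) n (Pi.single h2 1) Z) a
  rw [vecBracket_h2_left, sub_neg_eq_add] at h
  rw [lamSq_eq]
  exact h

theorem coeff_bracket_lamSq (Z : LoopG) (a : OspBasis) (n : ℤ) :
    (loopBracket Z LamSq a).coeff n = -(eig a : ℂ) • (Z a).coeff (n + 1) := by
  have h := congrFun (level_loopBracket_monoLoop_right (-1) n (Pi.single h2 1) Z) a
  rw [vecBracket_h2_right, sub_neg_eq_add] at h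
  rw [lamSq_eq]
  exact h

theorem coeff_lamSq_of_eig_ne_zero {a : OspBasis} (ha : eig a ≠ 0) (n : ℤ) :
    (LamSq a).coeff n = 0 := by
  have : a ≠ h2 := by rintro rfl; exact ha rfl
  simp [lamSq_eq, monoLoop, this]

/-! ### Existence of the dressing -/

/-- The series with the given coefficients of index at least `-2`. All loops in the construction of
the dressing have powers `z^k` with `k ≤ 2` only. -/
def cut (f : ℤ → PolyG) : HahnSeries ℤ PolyG :=
  HahnSeries.ofSuppBddBelow (fun n => if n < -2 then 0 else f n)
    ⟨-2, fun _ hn => not_lt.1 fun h => hn (if_pos h)⟩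

theorem coeff_cut (f : ℤ → PolyG) (n : ℤ) : (cut f).coeff n = if n < -2 then 0 else f n := rfl

/-- `D²`. -/
def loopDD (X : LoopG) : LoopG := loopD (loopD X)

/-- The limit of the series for `e^{ad T}(∂ + X) - ∂`, for `T` of positive degree and `X` of degree
at least `-2`: the coefficient of `a z^{-n}`, of degree `deg a + 2 n`, does not change after
`deg a + 2 n + 2` terms. -/
def expAd (d : LoopG → LoopG) (T X : LoopG) : LoopG := fun a =>
  cut fun n => (expAdPartial d T X (deg a + 2 * n + 2).toNat a).coeff n

theorem deg_le (a : OspBasis) : -1 ≤ deg a ∧ deg a ≤ 1 := by cases a <;> decide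

section

variable {d : LoopG → LoopG} {T X : LoopG}

theorem coeff_expAdPartial (d : LoopG → LoopG) (T X : LoopG) (N : ℕ) (a : OspBasis) (n : ℤ) :
    (expAdPartial d T X N a).coeff n = (X a).coeff n + ∑ k ∈ Finset.range N,
      (1 / (k + 1).factorial : ℂ) • ((loopBracket T)^[k] (loopBracket T X - d T) a).coeff n := by
  simp [expAdPartial]

theorem inFiltration_first (hT : InFiltration deg 2 1 T) (hdT : InFiltration deg 2 1 (d T))
    (hX : InFiltration deg 2 (-2) X) : InFiltration deg 2 (-1) (loopBracket T X - d T) :=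
  ((hT.loopBracket structConst_deg hX).mono (by norm_num)).sub (hdT.mono (by norm_num))

/-- The coefficients of the limit are those of all later partial sums, including the ones that
`cut` sets to zero. -/
theorem coeff_expAd (hT : InFiltration deg 2 1 T) (hdT : InFiltration deg 2 1 (d T))
    (hX : InFiltration deg 2 (-2) X) {a : OspBasis} {n : ℤ} {N : ℕ} (hN : deg a + 2 * n + 2 ≤ N) :
    (expAd d T X a).coeff n = (expAdPartial d T X N a).coeff n := by
  have hA := inFiltration_first hT hdT hX
  rw [expAd, coeff_cut]
  split_ifs with h
  · have := deg_le a
    rw [coeff_expAdPartial_eq structConst_deg hT hA (M := 0) (by push_cast; omega) (Nat.zero_le _)]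
    rw [coeff_expAdPartial]
    simp [hX a n (by omega)]
  · rw [coeff_expAdPartial_eq structConst_deg hT hA (M := (deg a + 2 * n + 2).toNat)
      (N := N) (by omega) (by omega)]

theorem expAdEq_expAd (hT : InFiltration deg 2 1 T) (hdT : InFiltration deg 2 1 (d T))
    (hX : InFiltration deg 2 (-2) X) : ExpAdEq d T X (expAd d T X) :=
  expAdEq_of_coeff_eq structConst_deg hT (inFiltration_first hT hdT hX) fun a n =>
    ⟨(deg a + 2 * n + 2).toNat, by omega, coeff_expAd hT hdT hX (by omega)⟩

theorem inFiltration_loopDD {wt : OspBasis → ℤ} {m e : ℤ} (hT : InFiltration wt m e T) :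
    InFiltration wt m e (loopDD T) :=
  hT.loopD.loopD

/-- A change of `T` in degree `j` changes the terms of the exponential series in increasing
degrees. -/
theorem inFiltration_iterate_sub {T' : LoopG} {j : ℤ} (hT : InFiltration deg 2 1 T)
    (hT' : InFiltration deg 2 1 T') (hj : InFiltration deg 2 j (T' - T))
    (hX : InFiltration deg 2 (-2) X) (k : ℕ) :
    InFiltration deg 2 (j - 2 + k) ((loopBracket T')^[k] (loopBracket T' X - loopDD T') -
      (loopBracket T)^[k] (loopBracket T X - loopDD T)) := by
  induction k with
  | zero =>
    have e : loopBracket T' X - loopDD T' - (loopBracket T X - loopDD T) =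
        loopBracket (T' - T) X - loopDD (T' - T) := by
      rw [loopBracket_sub_left, loopDD, loopDD, loopDD, loopD_sub, loopD_sub]
      ext a n
      simp only [Pi.sub_apply, HahnSeries.coeff_sub]
      module
    rw [Function.iterate_zero, id_eq, Function.iterate_zero, id_eq, e]
    exact ((hj.loopBracket structConst_deg hX).mono (by push_cast; omega)).sub
      ((inFiltration_loopDD hj).mono (by push_cast; omega))
  | succ k ih =>
    rw [Function.iterate_succ_apply', Function.iterate_succ_apply']
    have hA' := inFiltration_iterate structConst_deg hT'
      (inFiltration_first hT' (inFiltration_loopDD hT') hX) k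
    generalize (loopBracket T')^[k] (loopBracket T' X - loopDD T') = A' at *
    generalize (loopBracket T)^[k] (loopBracket T X - loopDD T) = A at *
    have e : loopBracket T' A' - loopBracket T A =
        loopBracket (T' - T) A' + loopBracket T (A' - A) := by
      rw [loopBracket_sub_left, loopBracket_sub_right]
      ext a n
      simp only [Pi.sub_apply, Pi.add_apply, HahnSeries.coeff_sub, HahnSeries.coeff_add]
      module
    rw [e]
    exact ((hj.loopBracket structConst_deg hA').mono (by push_cast; omega)).add
      ((hT.loopBracket structConst_deg ih).mono (by push_cast; omega))

/-- The effect of a change of `T` in degree `j` to first order. -/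
theorem coeff_expAd_sub {T' X' : LoopG} {j : ℤ} (hT : InFiltration deg 2 1 T)
    (hT' : InFiltration deg 2 1 T') (hj : InFiltration deg 2 j (T' - T))
    (hX' : InFiltration deg 2 (-1) X') (hX : InFiltration deg 2 (-2) (X' + LamSq))
    (a : OspBasis) (n : ℤ) (h : deg a + 2 * n < j - 1) :
    (expAd loopDD T' (X' + LamSq) a).coeff n = (expAd loopDD T (X' + LamSq) a).coeff n -
      (eig a : ℂ) • ((T' - T) a).coeff (n + 1) := by
  rw [coeff_expAd hT (inFiltration_loopDD hT) hX (N := (deg a + 2 * n + 2).toNat + 1) (by omega),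
    coeff_expAd hT' (inFiltration_loopDD hT') hX (N := (deg a + 2 * n + 2).toNat + 1) (by omega),
    coeff_expAdPartial, coeff_expAdPartial, Finset.sum_range_succ', Finset.sum_range_succ']
  have hk : ∀ k : ℕ,
      ((loopBracket T')^[k + 1] (loopBracket T' (X' + LamSq) - loopDD T') a).coeff n =
      ((loopBracket T)^[k + 1] (loopBracket T (X' + LamSq) - loopDD T) a).coeff n := by
    intro k
    have := inFiltration_iterate_sub hT hT' hj hX (k + 1) a n (by push_cast; omega)
    rw [Pi.sub_apply, HahnSeries.coeff_sub] at this
    exact sub_eq_zero.1 this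
  have h1 := hj.loopBracket structConst_deg hX' a n (by omega)
  have h2 := inFiltration_loopDD hj a n (by omega)
  have h3 := coeff_bracket_lamSq (T' - T) a n
  simp only [loopBracket_sub_left, loopDD, loopD_sub, Pi.sub_apply, HahnSeries.coeff_sub]
    at h1 h2 h3
  simp only [hk]
  simp only [Function.iterate_zero, id_eq, loopBracket_add_right, loopDD, Pi.sub_apply,
    Pi.add_apply, HahnSeries.coeff_sub, HahnSeries.coeff_add]
  rw [sub_eq_zero] at h1 h2
  rw [sub_eq_iff_eq_add] at h3
  rw [h1, h2, h3]
  simp only [zero_add, Nat.factorial_one, Nat.cast_one, div_one]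
  module

end

/-- A step of the Newton iteration for `T`: the components of `e^{ad T}(D² + X)` outside the kernel
of `ad Λ²` are removed to first order. -/
def newtonStep (X T : LoopG) : LoopG := fun a =>
  if eig a = 0 then 0 else
    cut fun n => (T a).coeff n + (1 / eig a : ℂ) • (expAd loopDD T X a).coeff (n - 1)

/-- The Newton iterates, starting at `T = 0`. -/
def newton (X : LoopG) (m : ℕ) : LoopG := (newtonStep X)^[m] 0

/-- The limit of the Newton iteration: the coefficients of the iterates stabilize. -/
def newtonLimit (X : LoopG) : LoopG := fun a =>
  cut fun n => (newton X (deg a + 2 * n).toNat a).coeff n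

theorem newton_succ (X : LoopG) (m : ℕ) : newton X (m + 1) = newtonStep X (newton X m) :=
  Function.iterate_succ_apply' _ _ _

theorem newton_apply_of_eig_eq_zero (X : LoopG) (m : ℕ) {a : OspBasis} (ha : eig a = 0) :
    newton X m a = 0 := by
  cases m with
  | zero => rfl
  | succ m => rw [newton_succ, newtonStep, if_pos ha]

theorem expAdPartial_zero (X : LoopG) (N : ℕ) : expAdPartial loopDD 0 X N = X := by
  have h0 : loopDD 0 = 0 := by
    ext a n
    simp [loopDD, loopD]
  have hb : ∀ Y, loopBracket 0 Y = 0 := by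
    intro Y
    ext c n
    rw [coeff_loopBracket]
    have : ∀ f : PolyG →ₐ[ℂ] PolyG, (0 : HahnSeries ℤ PolyG).map f = 0 := by
      intro f
      ext n
      simp
    simp [this]
  have h1 : loopBracket 0 X - loopDD 0 = 0 := by
    rw [hb, h0]
    ext a n
    simp
  have hk : ∀ k, (loopBracket 0)^[k] (loopBracket 0 X - loopDD 0) = 0 := by
    intro k
    cases k with
    | zero => exact h1
    | succ k => rw [Function.iterate_succ_apply', hb]
  ext a n
  rw [coeff_expAdPartial]
  simp [hk]

/-- The `m`-th Newton iterate solves the equation up to degree `m - 1`, and the next one differs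
from it in degree `m + 1` only. -/
theorem newton_spec {X' : LoopG} (hX' : InFiltration deg 2 (-1) X')
    (hX : InFiltration deg 2 (-2) (X' + LamSq)) (m : ℕ) :
    InFiltration deg 2 1 (newton (X' + LamSq) m) ∧
    (∀ a n, eig a ≠ 0 → deg a + 2 * n < m - 1 →
      (expAd loopDD (newton (X' + LamSq) m) (X' + LamSq) a).coeff n = 0) ∧
    InFiltration deg 2 (m + 1) (newton (X' + LamSq) (m + 1) - newton (X' + LamSq) m) := by
  have hstep : ∀ m, InFiltration deg 2 1 (newton (X' + LamSq) m) →
      ∀ a n, eig a ≠ 0 → ((newton (X' + LamSq) (m + 1) - newton (X' + LamSq) m) a).coeff n =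
        (1 / eig a : ℂ) •
          (expAd loopDD (newton (X' + LamSq) m) (X' + LamSq) a).coeff (n - 1) := by
    intro m hm a n ha
    have hda := deg_le a
    rw [Pi.sub_apply, HahnSeries.coeff_sub, newton_succ, newtonStep, if_neg ha, coeff_cut]
    split_ifs with h
    · rw [hm a n (by omega), coeff_expAd hm (inFiltration_loopDD hm) hX (N := 0)
        (by push_cast; omega), coeff_expAdPartial, hX a (n - 1) (by omega)]
      simp
    · module
  have hdiff : ∀ m : ℕ, InFiltration deg 2 1 (newton (X' + LamSq) m) →
      (∀ a n, eig a ≠ 0 → deg a + 2 * n < m - 1 →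
        (expAd loopDD (newton (X' + LamSq) m) (X' + LamSq) a).coeff n = 0) →
      InFiltration deg 2 (m + 1) (newton (X' + LamSq) (m + 1) - newton (X' + LamSq) m) := by
    intro m hm h a n hn
    by_cases ha : eig a = 0
    · rw [Pi.sub_apply, newton_apply_of_eig_eq_zero _ _ ha, newton_apply_of_eig_eq_zero _ _ ha]
      simp
    · rw [hstep m hm a n ha, h a (n - 1) ha (by omega), smul_zero]
  induction m with
  | zero =>
    have h0 : InFiltration deg 2 1 (newton (X' + LamSq) 0) := fun a n _ => rfl
    have h1 : ∀ a n, eig a ≠ 0 → deg a + 2 * n < (0 : ℕ) - 1 →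
        (expAd loopDD (newton (X' + LamSq) 0) (X' + LamSq) a).coeff n = 0 := by
      intro a n ha hn
      rw [coeff_expAd h0 (inFiltration_loopDD h0) hX (N := (deg a + 2 * n + 2).toNat) (by omega),
        show newton (X' + LamSq) 0 = 0 from rfl, expAdPartial_zero, Pi.add_apply,
        HahnSeries.coeff_add, coeff_lamSq_of_eig_ne_zero ha, hX' a n (by push_cast at hn; omega),
        add_zero]
    exact ⟨h0, h1, hdiff 0 h0 h1⟩
  | succ m ih =>
    obtain ⟨hm, hY, hd⟩ := ih
    have h0 : InFiltration deg 2 1 (newton (X' + LamSq) (m + 1)) := by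
      have := (hd.mono (by omega : (1 : ℤ) ≤ m + 1)).add hm
      rwa [loop_sub_add_cancel] at this
    have h1 : ∀ a n, eig a ≠ 0 → deg a + 2 * n < (m + 1 : ℕ) - 1 →
        (expAd loopDD (newton (X' + LamSq) (m + 1)) (X' + LamSq) a).coeff n = 0 := by
      intro a n ha hn
      have ha' : (eig a : ℂ) ≠ 0 := by exact_mod_cast ha
      rw [coeff_expAd_sub hm h0 hd hX' hX a n (by push_cast at hn; omega),
        hstep m hm a (n + 1) ha, add_sub_cancel_right, smul_smul, mul_one_div_cancel ha', one_smul,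
        sub_self]
    exact ⟨h0, h1, hdiff (m + 1) h0 h1⟩

theorem inFiltration_newtonLimit_sub {X' : LoopG} (hX' : InFiltration deg 2 (-1) X')
    (hX : InFiltration deg 2 (-2) (X' + LamSq)) (m : ℕ) :
    InFiltration deg 2 (m + 1) (newtonLimit (X' + LamSq) - newton (X' + LamSq) m) := by
  have hmono : ∀ l k : ℕ, InFiltration deg 2 (l + 1)
      (newton (X' + LamSq) (l + k) - newton (X' + LamSq) l) := by
    intro l k
    induction k with
    | zero => intro a n _; simp
    | succ k ih =>
      intro a n hn
      have h1 := ih a n hn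
      have h2 := (newton_spec hX' hX (l + k)).2.2 a n (by push_cast; omega)
      rw [Pi.sub_apply, HahnSeries.coeff_sub, sub_eq_zero] at h1 h2 ⊢
      rw [← h1, ← h2]
      rfl
  intro a n hn
  have hda := deg_le a
  rw [Pi.sub_apply, HahnSeries.coeff_sub, newtonLimit, coeff_cut]
  split_ifs with h
  · rw [(newton_spec hX' hX m).1 a n (by omega), sub_zero]
  · have h1 := hmono (deg a + 2 * n).toNat (m - (deg a + 2 * n).toNat) a n (by omega)
    rw [Nat.add_sub_cancel' (by omega), Pi.sub_apply, HahnSeries.coeff_sub, sub_eq_zero] at h1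
    rw [h1, sub_self]

theorem inFiltration_newtonLimit {X' : LoopG} (hX' : InFiltration deg 2 (-1) X')
    (hX : InFiltration deg 2 (-2) (X' + LamSq)) :
    InFiltration deg 2 1 (newtonLimit (X' + LamSq)) := by
  have := (inFiltration_newtonLimit_sub hX' hX 0).add
    ((newton_spec hX' hX 0).1.mono (by norm_num))
  rw [loop_sub_add_cancel] at this
  exact this.mono (by norm_num)

/-- The limit of the Newton iteration solves the equation. -/
theorem expAd_newtonLimit {X' : LoopG} (hX' : InFiltration deg 2 (-1) X')
    (hX : InFiltration deg 2 (-2) (X' + LamSq)) {a : OspBasis} (ha : eig a ≠ 0) (n : ℤ) :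
    (expAd loopDD (newtonLimit (X' + LamSq)) (X' + LamSq) a).coeff n = 0 := by
  have hm := newton_spec hX' hX (deg a + 2 * n + 2).toNat
  have hs := inFiltration_newtonLimit_sub hX' hX (deg a + 2 * n + 2).toNat
  rw [coeff_expAd_sub hm.1 (inFiltration_newtonLimit hX' hX) hs hX' hX a n (by omega),
    hm.2.1 a n ha (by omega), hs a (n + 1) (by omega), smul_zero, sub_zero]

theorem isGood_expAd {d : LoopG → LoopG} {T X : LoopG} (hd : IsGood 0 (d T)) (hT : IsGood 0 T)
    (hX : IsGood 0 X) : IsGood 0 (expAd d T X) := by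
  intro a n
  rw [expAd, coeff_cut]
  split_ifs
  · exact (goodCoeff 0 a).zero_mem
  · exact hd.expAdPartial hT hX _ _ _

theorem isGood_newton {X : LoopG} (hX : IsGood 0 X) (m : ℕ) : IsGood 0 (newton X m) := by
  induction m with
  | zero => exact isGood_zero 0
  | succ m ih =>
    intro a n
    rw [newton_succ, newtonStep]
    split_ifs with h
    · exact (goodCoeff 0 a).zero_mem
    · rw [coeff_cut]
      split_ifs
      · exact (goodCoeff 0 a).zero_mem
      · exact (goodCoeff 0 a).add_mem (ih a n) ((goodCoeff 0 a).smul_mem _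
          (isGood_expAd (d := loopDD) (ih.loopD.loopD.congr (l := 0) rfl) ih hX a _))

theorem isGood_newtonLimit {X : LoopG} (hX : IsGood 0 X) : IsGood 0 (newtonLimit X) := by
  intro a n
  rw [newtonLimit, coeff_cut]
  split_ifs
  · exact (goodCoeff 0 a).zero_mem
  · exact isGood_newton hX _ _ _

theorem inFiltration_monoLoop {wt : OspBasis → ℤ} {m d n : ℤ} {x : OspBasis → PolyG}
    (h : ∀ a, wt a + m * n < d → x a = 0) : InFiltration wt m d (monoLoop n x) := by
  intro a k hk
  by_cases hkn : k = n
  · subst hkn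
    simp [monoLoop, h a hk]
  · simp [monoLoop, HahnSeries.coeff_single_of_ne hkn]

theorem isGood_monoLoop {k : ℕ} {n : ℤ} {x : OspBasis → PolyG}
    (h : ∀ a, x a ∈ goodCoeff k a) : IsGood k (monoLoop n x) := by
  intro a m
  by_cases hmn : m = n
  · subst hmn
    simpa [monoLoop] using h a
  · simp [monoLoop, HahnSeries.coeff_single_of_ne hmn]

theorem isGood_tens {k : ℕ} {a : OspBasis} {n : ℤ} {u : PolyG} (h : u ∈ goodCoeff k a) :
    IsGood k (tens a n u) := by
  rw [tens_eq_monoLoop]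
  apply isGood_monoLoop
  intro b
  by_cases hb : b = a
  · subst hb
    simpa using h
  · simp [hb]

theorem inFiltration_tens {d : ℤ} (a : OspBasis) (n : ℤ) (u : PolyG) (h : d ≤ deg a - 2 * n) :
    InFiltration deg 2 d (tens a n u) := by
  rw [tens_eq_monoLoop]
  apply inFiltration_monoLoop
  intro b hb
  have : b ≠ a := by
    rintro rfl
    omega
  simp [this]

theorem one_mem_goodCoeff (k : ℕ) {a : OspBasis} (h : (k + parity a) % 2 = 0) :
    (1 : PolyG) ∈ goodCoeff k a :=
  ⟨(show IsHomogeneous 0 (1 : PolyG) by simp [IsHomogeneous]).congr (by omega),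
    wSubalgebra.one_mem⟩

/-- The Lax operator of the canonical form can be dressed if the coefficients are in `𝒲`: `T` is the
limit of the Newton iteration for `X' + Λ² = [D + q + Λ, D + q + Λ]/2 - D²`. -/
theorem exists_isDressing {w₁ w₂ w₃ w₄ : PolyG} (h₁ : w₁ ∈ goodCoeff 1 f1)
    (h₂ : w₂ ∈ goodCoeff 1 h1) (h₃ : w₃ ∈ goodCoeff 1 e2) (h₄ : w₄ ∈ goodCoeff 1 e3) :
    ∃ T H K, IsDressing w₁ w₂ w₃ w₄ T H K := by
  obtain ⟨q, hq⟩ : ∃ q, canonicalQ w₁ w₂ w₃ w₄ = q := ⟨_, rfl⟩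
  have hqg : IsGood 1 q := hq ▸
    (((isGood_tens h₄).add (isGood_tens h₃)).add (isGood_tens h₂)).add (isGood_tens h₁)
  have hqf : InFiltration deg 2 0 q := by
    rw [← hq]
    refine ((InFiltration.add ?_ ?_).add ?_).add ?_ <;> exact inFiltration_tens _ _ _ (by decide)
  have hLg : IsGood 1 Lam := (isGood_tens (one_mem_goodCoeff 1 rfl)).add
    (isGood_tens (one_mem_goodCoeff 1 rfl))
  have hLf : InFiltration deg 2 (-1) Lam := by
    refine InFiltration.add ?_ ?_ <;> exact inFiltration_tens _ _ _ (by decide)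
  have hL2g : IsGood 0 LamSq := ((hLg.loopBracket hLg).congr (l := 0) rfl).smul _
  have hL2f : InFiltration deg 2 (-2) LamSq :=
    ((hLf.loopBracket structConst_deg hLf).mono le_rfl).smul _
  obtain ⟨X', hX'⟩ : ∃ X', loopD (q + Lam) + (1 / 2 : ℂ) • (loopBracket q q + loopBracket q Lam +
    loopBracket Lam q) = X' := ⟨_, rfl⟩
  have hXe : loopD (q + Lam) + (1 / 2 : ℂ) • loopBracket (q + Lam) (q + Lam) = X' + LamSq := by
    rw [← hX', LamSq, loopBracket_add_left, loopBracket_add_right, loopBracket_add_right]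
    ext a n
    simp only [Pi.add_apply, Pi.smul_apply, HahnSeries.coeff_add, HahnSeries.coeff_smul]
    module
  have hX'f : InFiltration deg 2 (-1) X' := by
    rw [← hX']
    exact ((hqf.mono (by norm_num)).add hLf).loopD.add
      (((((hqf.loopBracket structConst_deg hqf).mono (by norm_num)).add
        ((hqf.loopBracket structConst_deg hLf).mono (by norm_num))).add
          ((hLf.loopBracket structConst_deg hqf).mono (by norm_num))).smul _)
  have hXf : InFiltration deg 2 (-2) (X' + LamSq) := (hX'f.mono (by norm_num)).add hL2f
  have hXg : IsGood 0 (X' + LamSq) := by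
    rw [← hXe]
    exact ((hqg.add hLg).loopD.congr (l := 0) rfl).add
      ((((hqg.add hLg).loopBracket (hqg.add hLg)).congr (l := 0) rfl).smul _)
  have hTf := inFiltration_newtonLimit hX'f hXf
  have hTg := isGood_newtonLimit hXg
  have hT0 : ∀ a, eig a = 0 → newtonLimit (X' + LamSq) a = 0 := by
    intro a ha
    ext n
    rw [newtonLimit, coeff_cut, newton_apply_of_eig_eq_zero _ _ ha]
    simp
  have hY : ∀ a, eig a ≠ 0 → ∀ n,
      (expAd loopDD (newtonLimit (X' + LamSq)) (X' + LamSq) a).coeff n = 0 :=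
    fun a ha n => expAd_newtonLimit hX'f hXf ha n
  obtain ⟨T, hT⟩ : ∃ T, newtonLimit (X' + LamSq) = T := ⟨_, rfl⟩
  rw [hT] at hTf hTg hT0 hY
  refine ⟨T, expAd loopDD T (X' + LamSq) - LamSq, expAd loopD T (q + Lam) - Lam,
    fun a n => (hTg a n).1, fun a n hn => hTf a n (by omega),
    ⟨fun a => cut fun n => (1 / eig a : ℂ) • (T a).coeff (n - 1), ?_, ?_⟩, ⟨?_, ?_⟩, ?_, ?_⟩
  · intro a n
    rw [coeff_cut]
    split_ifs
    · exact wSubalgebra.zero_mem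
    · exact wSubalgebra.smul_mem (hTg a _).2 _
  · ext a n
    rw [coeff_lamSq_bracket, coeff_cut]
    by_cases ha : eig a = 0
    · simp [ha, hT0]
    · have ha' : (eig a : ℂ) ≠ 0 := by exact_mod_cast ha
      have hda := deg_le a
      split_ifs with h
      · rw [hTf a n (by omega), smul_zero]
      · rw [smul_smul, mul_one_div_cancel ha', one_smul, add_sub_cancel_right]
  · intro a n
    have hYg := isGood_expAd (d := loopDD) (hTg.loopD.loopD.congr (l := 0) rfl) hTg hXg
    exact wSubalgebra.sub_mem (hYg a n).2 (hL2g a n).2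
  · ext a n
    rw [coeff_lamSq_bracket, Pi.sub_apply, HahnSeries.coeff_sub]
    by_cases ha : eig a = 0
    · simp [ha]
    · rw [hY a ha, coeff_lamSq_of_eig_ne_zero ha]
      simp
  · rw [hq, hXe, loop_sub_add_cancel]
    exact expAdEq_expAd hTf (inFiltration_loopDD hTf) hXf
  · rw [hq, loop_sub_add_cancel]
    exact expAdEq_expAd hTf hTf.loopD (((hqf.mono (by norm_num)).add hLf).mono (by norm_num))

/-! ### Symbolic computation in `𝔤 ⊗ 𝒫(𝔤̄)` -/

/-- Symbolic elements of `𝔤 ⊗ 𝒫(𝔤̄)`. -/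
abbrev FormalVec : Type := OspBasis → FormalG

/-- The element of `𝔤 ⊗ 𝒫(𝔤̄)` that a symbolic element stands for. -/
def vev (x : FormalVec) : OspBasis → PolyG := fun a => ev (x a)

/-- The basis of `𝔬𝔰𝔭(2|2)` as a list, in the order of the enumeration of the type. -/
def basisList : List OspBasis := [f3, f2, f1, h1, h2, e1, e2, e3]

theorem sum_basis {M : Type*} [AddCommMonoid M] (f : OspBasis → M) :
    ∑ a, f a = (basisList.map f).sum := rfl

/-- The bracket of `𝔤 ⊗ 𝒫(𝔤̄)`, on symbolic elements. -/
def formalBracket (x y : FormalVec) : FormalVec := fun c =>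
  nf (Formal.sum basisList fun a => Formal.sum basisList fun b =>
    if structConst a b c = 0 then [] else Formal.smul (structConst a b c)
      (Formal.mul ((Formal.parityAut revParity)^[parity b] (x a)) (y b)))

theorem vecBracket_vev (x y : FormalVec) :
    vecBracket (vev x) (vev y) = vev (formalBracket x y) := by
  ext c
  rw [vev, formalBracket, ev_nf, ev, Formal.eval_sum, vecBracket, sum_basis]
  congr 2
  ext a
  rw [Formal.eval_sum, sum_basis]
  congr 2
  ext b
  split_ifs with h
  · rw [h, Int.cast_zero, zero_smul]
    rfl
  · rw [Formal.eval_smul, Formal.eval_mul, Formal.eval_iterate_parityAut, Rat.cast_intCast]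
    rfl

/-- The action of `D` on `𝔤 ⊗ 𝒫(𝔤̄)`, on symbolic elements. -/
def formalVecD (x : FormalVec) : FormalVec := fun a =>
  Formal.smul (Formal.sign (parity a)) (Formal.D revParity (x a))

theorem vecD_vev (x : FormalVec) : vecD (vev x) = vev (formalVecD x) := by
  ext a
  rw [vev, formalVecD, ev, Formal.eval_smul, Formal.cast_sign, Formal.eval_D]
  rfl

/-- The sum in `𝔤 ⊗ 𝒫(𝔤̄)`, on symbolic elements, in normal form. -/
def formalVecAdd (x y : FormalVec) : FormalVec := fun a => nf (Formal.add (x a) (y a))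

theorem vev_add (x y : FormalVec) : vev x + vev y = vev (formalVecAdd x y) := by
  ext a
  change ev (x a) + ev (y a) = ev (nf _)
  rw [ev_nf]
  exact (Formal.eval_add _ _).symm

/-- Multiplication by a rational number in `𝔤 ⊗ 𝒫(𝔤̄)`, on symbolic elements. -/
def formalVecSmul (c : ℚ) (x : FormalVec) : FormalVec := fun a => Formal.smul c (x a)

theorem smul_vev (c : ℚ) (x : FormalVec) : (c : ℂ) • vev x = vev (formalVecSmul c x) := by
  ext a
  exact (Formal.eval_smul c (x a)).symm

theorem vev_sub (x y : FormalVec) :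
    vev x - vev y = vev (formalVecAdd x (formalVecSmul (-1) y)) := by
  rw [← vev_add, ← smul_vev]
  ext a
  simp only [Pi.sub_apply, Pi.add_apply, Pi.smul_apply]
  push_cast
  module

theorem vev_congr {x y : FormalVec}
    (h : ∀ a, nf (Formal.add (x a) (Formal.smul (-1) (y a))) = []) :
    vev x = vev y :=
  funext fun a => Formal.eval_congr code (h a)

/-! ### The canonical form of the universal Lax operator -/

/-- `e^{ad n}(D + x) - D` for `n ∈ 𝔤₁ ⊗ 𝒫(𝔤̄)`. -/
def gauge (n x : OspBasis → PolyG) : OspBasis → PolyG :=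
  x + (vecBracket n x - vecD n) + (1 / 2 : ℂ) • vecBracket n (vecBracket n x - vecD n)

/-- For `n ∈ 𝔤₁ ⊗ 𝒫(𝔤̄)` the exponential series stops after the second order: `[n, x] - Dn` has
components in degrees at least `0` only, and the degrees are bounded by `1`. -/
theorem expAdEq_monoLoop_iff {n x y : OspBasis → PolyG} (hn : ∀ a, deg a < 1 → n a = 0) :
    ExpAdEq loopD (monoLoop 0 n) (monoLoop 0 x) (monoLoop 0 y) ↔ y = gauge n x := by
  have hT : InFiltration deg 0 1 (monoLoop 0 n) :=
    inFiltration_monoLoop fun a ha => hn a (by omega)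
  have hX : InFiltration deg 0 (-1) (monoLoop 0 x) :=
    inFiltration_monoLoop fun a ha => by have := deg_le a; omega
  have hA : InFiltration deg 0 0
      (loopBracket (monoLoop 0 n) (monoLoop 0 x) - loopD (monoLoop 0 n)) :=
    ((hT.loopBracket structConst_deg hX).mono (by norm_num)).sub (hT.loopD.mono (by norm_num))
  have h2 : expAdPartial loopD (monoLoop 0 n) (monoLoop 0 x) 2 = monoLoop 0 (gauge n x) := by
    have e : loopBracket (monoLoop 0 n) (monoLoop 0 x) - loopD (monoLoop 0 n) =
        monoLoop 0 (vecBracket n x - vecD n) := by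
      rw [loopBracket_monoLoop, loopD_monoLoop, monoLoop_sub, add_zero]
    ext a k
    rw [coeff_expAdPartial, Finset.sum_range_succ, Finset.sum_range_one, Function.iterate_zero,
      id_eq, Function.iterate_one, e, loopBracket_monoLoop, gauge, monoLoop_add, monoLoop_add,
      monoLoop_smul, add_zero]
    simp [add_assoc]
  constructor
  · intro h
    apply monoLoop_injective 0
    ext a k
    have := deg_le a
    rw [h.coeff_eq structConst_deg hT hA (M := 2) (by push_cast; omega), h2]
  · rintro rfl
    refine expAdEq_of_coeff_eq structConst_deg hT hA fun a k => ⟨2, ?_, ?_⟩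
    · have := deg_le a
      push_cast
      omega
    · rw [h2]

/-- The element of `𝔤 ⊗ 𝒫(𝔤̄)` with the given coordinates. -/
def vec (uf3 uf2 uf1 uh1 uh2 ue1 ue2 ue3 : PolyG) : OspBasis → PolyG
  | f3 => uf3 | f2 => uf2 | f1 => uf1 | h1 => uh1 | h2 => uh2 | e1 => ue1 | e2 => ue2 | e3 => ue3

/-- The symbolic element of `𝔤 ⊗ 𝒫(𝔤̄)` with the given coordinates. -/
def formalVec (uf3 uf2 uf1 uh1 uh2 ue1 ue2 ue3 : FormalG) : FormalVec
  | f3 => uf3 | f2 => uf2 | f1 => uf1 | h1 => uh1 | h2 => uh2 | e1 => ue1 | e2 => ue2 | e3 => ue3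

theorem vev_formalVec (u₁ u₂ u₃ u₄ u₅ u₆ u₇ u₈ : FormalG) :
    vev (formalVec u₁ u₂ u₃ u₄ u₅ u₆ u₇ u₈) =
      vec (ev u₁) (ev u₂) (ev u₃) (ev u₄) (ev u₅) (ev u₆) (ev u₇) (ev u₈) := by
  ext a
  cases a <;> rfl

theorem canonicalQ_add_f2 (w₁ w₂ w₃ w₄ : PolyG) :
    canonicalQ w₁ w₂ w₃ w₄ + tens f2 0 1 = monoLoop 0 (vec 0 1 w₁ w₂ 0 0 w₃ w₄) := by
  simp only [canonicalQ, tens_eq_monoLoop, neg_zero, ← monoLoop_add]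
  congr 1
  ext a
  cases a <;> simp [vec]

/-- The coordinates of `ℒ_u - D`. -/
def universalVec : FormalVec :=
  formalVec [] (Formal.const 1) [(1 / 2, [(e1, 0)])] [(-1 / 4, [(h2, 0)])] [(-1 / 4, [(h1, 0)])]
    [(-1 / 2, [(f1, 0)])] [(-1 / 2, [(f2, 0)])] [(1 / 4, [(f3, 0)])]

theorem universalQ_add_f2 : universalQ + tens f2 0 1 = monoLoop 0 (vev universalVec) := by
  rw [universalVec, vev_formalVec]
  simp only [universalQ, tens_eq_monoLoop, neg_zero, ← monoLoop_add, ← monoLoop_sub,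
    ← monoLoop_smul]
  congr 1
  ext a
  cases a <;> simp [vec, Formal.eval, Formal.evalWord, Formal.const, neg_div] <;> module

theorem gauge_eq (N₂ N₃ : PolyG) :
    tens e2 0 N₂ + tens e3 0 N₃ = monoLoop 0 (vec 0 0 0 0 0 0 N₂ N₃) := by
  simp only [tens_eq_monoLoop, neg_zero, ← monoLoop_add]
  congr 1
  ext a
  cases a <;> simp [vec]

/-- `N₂ = -h̄₁/4`. -/
def formalN₂ : FormalG := [(-1 / 4, [(h1, 0)])]

/-- `N₃ = -f̄₁/4`. -/
def formalN₃ : FormalG := [(-1 / 4, [(f1, 0)])]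

/-- The universal Lax operator is brought to its canonical form by `N = e₂ ⊗ N₂ + e₃ ⊗ N₃`. -/
theorem gauge_formal :
    gauge (vec 0 0 0 0 0 0 (ev formalN₂) (ev formalN₃)) (vev universalVec) =
      vec 0 1 (ev formalW₁) (ev formalW₂) 0 0 (ev formalW₃) (ev formalW₄) := by
  have h1 : (1 : PolyG) = ev (Formal.const 1) := by
    rw [ev, Formal.eval_const]
    simp
  have h2 : (1 / 2 : ℂ) = ((1 / 2 : ℚ) : ℂ) := by norm_num
  rw [h1, show (0 : PolyG) = ev [] from rfl, ← vev_formalVec, ← vev_formalVec, gauge,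
    vecBracket_vev, vecD_vev, vev_sub, vecBracket_vev, h2, smul_vev, vev_add, vev_add]
  apply vev_congr
  decide +kernel

theorem ev_mem_goodCoeff {k : ℕ} {a : OspBasis} {P : FormalG} (hP : ev P ∈ wAlgebra)
    (h : P.all (fun t => Formal.wordParity revParity t.2 % 2 == (k + parity a) % 2) = true) :
    ev P ∈ goodCoeff k a := ⟨Formal.isHomogeneous_eval h, hP⟩

theorem isCanonicalForm_formal : IsCanonicalForm (ev formalN₂) (ev formalN₃) (ev formalW₁)
    (ev formalW₂) (ev formalW₃) (ev formalW₄) where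
  gauge_mem := ⟨ev_mem_polyB (by decide +kernel), ev_mem_polyB (by decide +kernel)⟩
  gauge_even := by
    rw [gauge_eq]
    intro a n
    rw [monoLoop]
    by_cases hn : n = 0
    · subst hn
      rw [HahnSeries.coeff_single_same]
      cases a
      case e2 => exact Formal.isHomogeneous_eval (by decide +kernel)
      case e3 => exact Formal.isHomogeneous_eval (by decide +kernel)
      all_goals exact isHomogeneous_zero _
    · rw [HahnSeries.coeff_single_of_ne hn]
      exact isHomogeneous_zero _
  canonical_mem := ⟨ev_formalW₁_mem.1, ev_formalW₂_mem.1, ev_formalW₃_mem.1, ev_formalW₄_mem.1⟩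
  canonical_odd := by
    have : IsGood 1 (canonicalQ (ev formalW₁) (ev formalW₂) (ev formalW₃) (ev formalW₄)) :=
      (((isGood_tens (ev_mem_goodCoeff ev_formalW₄_mem (by decide +kernel))).add
      (isGood_tens (ev_mem_goodCoeff ev_formalW₃_mem (by decide +kernel)))).add
      (isGood_tens (ev_mem_goodCoeff ev_formalW₂_mem (by decide +kernel)))).add
      (isGood_tens (ev_mem_goodCoeff ev_formalW₁_mem (by decide +kernel)))
    exact fun a n => (this a n).1
  eq := by
    rw [universalQ_add_f2, canonicalQ_add_f2, gauge_eq, expAdEq_monoLoop_iff, gauge_formal]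
    intro a ha
    cases a <;> first | rfl | (exact absurd ha (by decide))

/-- The canonical form of the universal Lax operator is unique. -/
theorem IsCanonicalForm.eq_formal {N₂ N₃ w₁ w₂ w₃ w₄ : PolyG}
    (h : IsCanonicalForm N₂ N₃ w₁ w₂ w₃ w₄) :
    w₁ = ev formalW₁ ∧ w₂ = ev formalW₂ ∧ w₃ = ev formalW₃ ∧ w₄ = ev formalW₄ := by
  have hn : ∀ a, deg a < 1 → vec 0 0 0 0 0 0 N₂ N₃ a = 0 := by
    intro a ha
    cases a <;> first | rfl | (exact absurd ha (by decide))
  have he := h.eq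
  rw [universalQ_add_f2, canonicalQ_add_f2, gauge_eq, expAdEq_monoLoop_iff hn] at he
  have hN₂ : parityAut N₂ = (-1 : ℂ) • N₂ := by
    have := h.gauge_even e2 0
    rw [gauge_eq] at this
    simpa [monoLoop, vec, IsHomogeneous, parity] using this
  have hN₃ : parityAut N₃ = N₃ := by
    have := h.gauge_even e3 0
    rw [gauge_eq] at this
    simpa [monoLoop, vec, IsHomogeneous, parity] using this
  -- the components along `h₂` and `e₁` determine `N₂` and `N₃`
  have e₂ := congrFun he h2
  have e₃ := congrFun he e1
  rw [universalVec, vev_formalVec] at e₂ e₃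
  simp [gauge, vecBracket, sum_basis, basisList, structConst, bracketList, vec, vecD, parity,
    Formal.eval, Formal.evalWord, Formal.const, hN₂, hN₃] at e₂ e₃
  have h₂ : N₂ = ev formalN₂ := by
    simp only [ev, formalN₂, Formal.eval, Formal.evalWord, mul_one, add_zero]
    push_cast
    linear_combination (norm := module) e₂
  have h₃ : N₃ = ev formalN₃ := by
    simp only [ev, formalN₃, Formal.eval, Formal.evalWord, mul_one, add_zero]
    push_cast
    linear_combination (norm := module) (1 / 2 : ℂ) • e₃
  rw [h₂, h₃, gauge_formal] at he
  exact ⟨congrFun he f1, congrFun he h1, congrFun he e2, congrFun he e3⟩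

/-! ### The dressing to low order in `z⁻¹` -/

theorem vecBracket_zero_right (x : OspBasis → PolyG) : vecBracket x 0 = 0 := by
  ext c
  simp [vecBracket]

/-- The first terms of `e^{ad T}(∂ + u + z v)` for `T = z⁻¹ T₁ + z⁻² T₂ + z⁻³ T₃ + ⋯`. -/
theorem level_expAd {d : LoopG → LoopG} {δ : (OspBasis → PolyG) → OspBasis → PolyG} {T Y : LoopG}
    {u v : OspBasis → PolyG} (hT : ∀ n < 1, level n T = 0)
    (hd : ∀ n, level n (d T) = δ (level n T)) (hδ : δ 0 = 0)
    (h : ExpAdEq d T (monoLoop 0 u + monoLoop (-1) v) Y) :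
    level 0 Y = u + vecBracket (level 1 T) v ∧
    level 1 Y = (vecBracket (level 1 T) u + vecBracket (level 2 T) v - δ (level 1 T)) +
      (1 / 2 : ℂ) • vecBracket (level 1 T) (vecBracket (level 1 T) v) ∧
    level 2 Y = (vecBracket (level 2 T) u + vecBracket (level 3 T) v - δ (level 2 T)) +
      (1 / 2 : ℂ) • (vecBracket (level 1 T)
        (vecBracket (level 1 T) u + vecBracket (level 2 T) v - δ (level 1 T)) +
          vecBracket (level 2 T) (vecBracket (level 1 T) v)) +
      (1 / 6 : ℂ) • vecBracket (level 1 T) (vecBracket (level 1 T)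
        (vecBracket (level 1 T) v)) := by
  obtain ⟨X, hX⟩ : ∃ X, monoLoop 0 u + monoLoop (-1) v = X := ⟨_, rfl⟩
  rw [hX] at h
  have hXl : ∀ n, level n X = (if n = 0 then u else 0) + if n = -1 then v else 0 := by
    intro n
    rw [← level_monoLoop, ← level_monoLoop, ← hX]
    rfl
  have hXn : ∀ n < -1, level n X = 0 := by
    intro n hn
    rw [hXl, if_neg (by omega), if_neg (by omega), add_zero]
  have hTf : InFiltration 0 1 1 T := fun a n hn =>
    congrFun (hT n (by simpa using hn)) a
  have hXf : InFiltration 0 1 (-1) X := fun a n hn =>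
    congrFun (hXn n (by simpa using hn)) a
  have hdf : InFiltration 0 1 1 (d T) := by
    intro a n hn
    have := congrFun (hd n) a
    rwa [hT n (by simpa using hn), hδ] at this
  have hwt : ∀ a b c, structConst a b c ≠ 0 →
      (0 : OspBasis → ℤ) c = (0 : OspBasis → ℤ) a + (0 : OspBasis → ℤ) b := fun _ _ _ _ => rfl
  obtain ⟨A, hA⟩ : ∃ A, loopBracket T X - d T = A := ⟨_, rfl⟩
  have hAf : InFiltration 0 1 0 A := by
    rw [← hA]
    exact ((hTf.loopBracket hwt hXf).mono (by norm_num)).sub (hdf.mono (by norm_num))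
  have hAn : ∀ n < 0, level n A = 0 := fun n hn => funext fun a => hAf a n (by simpa using hn)
  have hBf := hTf.loopBracket hwt hAf
  have hBn : ∀ n < 1, level n (loopBracket T A) = 0 :=
    fun n hn => funext fun a => hBf a n (by simpa using hn)
  have hAl : ∀ n, level n A =
      ∑ k ∈ Finset.Icc 1 (n - -1), vecBracket (level k T) (level (n - k) X) - δ (level n T) := by
    intro n
    rw [← hd, ← level_loopBracket hT hXn, ← hA]
    rfl
  have hBl : ∀ n, level n (loopBracket T A) =
      ∑ k ∈ Finset.Icc 1 (n - 0), vecBracket (level k T) (level (n - k) A) :=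
    level_loopBracket hT hAn
  have hCl : ∀ n, level n (loopBracket T (loopBracket T A)) =
      ∑ k ∈ Finset.Icc 1 (n - 1), vecBracket (level k T) (level (n - k) (loopBracket T A)) :=
    level_loopBracket hT hBn
  have i1 : Finset.Icc (1 : ℤ) 1 = {1} := by decide
  have i2 : Finset.Icc (1 : ℤ) 2 = {1, 2} := by decide
  have i3 : Finset.Icc (1 : ℤ) 3 = {1, 2, 3} := by decide
  have i0 : Finset.Icc (1 : ℤ) 0 = ∅ := by decide
  have hA0 : level 0 A = vecBracket (level 1 T) v := by
    rw [hAl, show (0 : ℤ) - -1 = 1 by norm_num, i1, Finset.sum_singleton, hXl, hT 0 (by norm_num),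
      hδ]
    ext a
    norm_num
  have hA1 : level 1 A =
      vecBracket (level 1 T) u + vecBracket (level 2 T) v - δ (level 1 T) := by
    rw [hAl, show (1 : ℤ) - -1 = 2 by norm_num, i2, Finset.sum_pair (by norm_num), hXl, hXl]
    norm_num
  have hA2 : level 2 A =
      vecBracket (level 2 T) u + vecBracket (level 3 T) v - δ (level 2 T) := by
    rw [hAl, show (2 : ℤ) - -1 = 3 by norm_num, i3, Finset.sum_insert (by norm_num),
      Finset.sum_pair (by norm_num), hXl, hXl, hXl]
    norm_num [vecBracket_zero_right]
  have hB1 : level 1 (loopBracket T A) = vecBracket (level 1 T) (level 0 A) := by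
    rw [hBl, show (1 : ℤ) - 0 = 1 by norm_num, i1, Finset.sum_singleton, sub_self]
  have hB2 : level 2 (loopBracket T A) =
      vecBracket (level 1 T) (level 1 A) + vecBracket (level 2 T) (level 0 A) := by
    rw [hBl, show (2 : ℤ) - 0 = 2 by norm_num, i2, Finset.sum_pair (by norm_num)]
    norm_num
  have hC2 : level 2 (loopBracket T (loopBracket T A)) =
      vecBracket (level 1 T) (vecBracket (level 1 T) (level 0 A)) := by
    rw [hCl, show (2 : ℤ) - 1 = 1 by norm_num, i1, Finset.sum_singleton, ← hB1]
    norm_num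
  rw [← hA] at hAf
  have hY : ∀ (n : ℕ) (a : OspBasis), (Y a).coeff n = (expAdPartial d T X (n + 1) a).coeff n :=
    fun n a => h.coeff_eq hwt hTf hAf (by simp)
  refine ⟨?_, ?_, ?_⟩
  · rw [← hA0]
    ext a
    have := hY 0 a
    rw [coeff_expAdPartial, hA, zero_add, Finset.sum_range_one] at this
    rw [Pi.add_apply, show level 0 Y a = _ from this]
    have hx := congrFun (hXl 0) a
    rw [level] at hx
    simp [hx, level]
  · rw [← hA0, ← hA1, ← hB1]
    ext a
    have := hY 1 a
    rw [coeff_expAdPartial, hA, Finset.sum_range_succ, Finset.sum_range_one] at this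
    rw [Pi.add_apply, show level 1 Y a = _ from this]
    have hx := congrFun (hXl 1) a
    rw [level] at hx
    simp [hx, level]
  · rw [← hA0, ← hA1, ← hA2, ← hB2, ← hC2]
    ext a
    have := hY 2 a
    rw [coeff_expAdPartial, hA, Finset.sum_range_succ, Finset.sum_range_succ,
      Finset.sum_range_one] at this
    rw [Pi.add_apply, Pi.add_apply, show level 2 Y a = _ from this]
    have hx := congrFun (hXl 2) a
    rw [level] at hx
    simp [hx, level, Nat.factorial, add_assoc]

/-- The coefficient of `z⁰` in the Lax operator `ℒ^c - D`. -/
def lax₀ : FormalVec :=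
  formalVec [] (Formal.const 1) formalW₁ formalW₂ [] [] formalW₃ formalW₄

/-- The coefficient of `z` in the Lax operator `ℒ^c - D`. -/
def lax₁ : FormalVec := formalVec [] [] [] [] [] [] (Formal.const 1) []

/-- The coefficient of `z⁰` in `[ℒ^c, ℒ^c]/2 - D²`. -/
def square₀ : FormalVec :=
  formalVecAdd (formalVecD lax₀) (formalVecSmul (1 / 2) (formalBracket lax₀ lax₀))

/-- The coefficient of `z` in `[ℒ^c, ℒ^c]/2 - D²`. -/
def square₁ : FormalVec :=
  formalVec [] [] [] [] (Formal.const 1) [] (Formal.smul (-2) formalW₂) []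

theorem ev_const_one : ev (Formal.const 1) = 1 := by
  rw [ev, Formal.eval_const]
  simp

theorem lax_eq : canonicalQ (ev formalW₁) (ev formalW₂) (ev formalW₃) (ev formalW₄) + Lam =
    monoLoop 0 (vev lax₀) + monoLoop (-1) (vev lax₁) := by
  have h : tens e2 1 1 = monoLoop (-1) (vev lax₁) := by
    rw [tens_eq_monoLoop, lax₁, vev_formalVec, ev_const_one]
    congr 1
    ext a
    cases a <;> simp [vec, Formal.eval]
  rw [Lam, ← add_assoc, canonicalQ_add_f2, h, lax₀, vev_formalVec, ev_const_one]
  rfl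

theorem square_eq : loopD (canonicalQ (ev formalW₁) (ev formalW₂) (ev formalW₃) (ev formalW₄) + Lam)
    + (1 / 2 : ℂ) •
      loopBracket (canonicalQ (ev formalW₁) (ev formalW₂) (ev formalW₃) (ev formalW₄) + Lam)
        (canonicalQ (ev formalW₁) (ev formalW₂) (ev formalW₃) (ev formalW₄) + Lam) =
    monoLoop 0 (vev square₀) + monoLoop (-1) (vev square₁) := by
  have h2 : (1 / 2 : ℂ) = ((1 / 2 : ℚ) : ℂ) := by norm_num
  have e0 : vev square₀ = vecD (vev lax₀) + (1 / 2 : ℂ) • vecBracket (vev lax₀) (vev lax₀) := by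
    rw [vecD_vev, vecBracket_vev, h2, smul_vev, vev_add]
    rfl
  have e1 : vev square₁ = vecD (vev lax₁) + (1 / 2 : ℂ) •
      (vecBracket (vev lax₀) (vev lax₁) + vecBracket (vev lax₁) (vev lax₀)) := by
    rw [vecD_vev, vecBracket_vev, vecBracket_vev, vev_add, h2, smul_vev, vev_add]
    apply vev_congr
    decide +kernel
  have e2 : vecBracket (vev lax₁) (vev lax₁) = 0 := by
    rw [vecBracket_vev]
    exact vev_congr (y := fun _ => []) (by decide +kernel)
  rw [lax_eq, e0, e1]
  simp only [loopD_add, loopD_monoLoop, loopBracket_add_left, loopBracket_add_right,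
    loopBracket_monoLoop, e2, monoLoop_add, monoLoop_smul, zero_add, add_zero]
  have : monoLoop (-1 + -1) 0 = 0 := by
    ext a n
    simp [monoLoop]
  rw [this]
  ext a n
  simp only [Pi.add_apply, Pi.smul_apply, HahnSeries.coeff_add, HahnSeries.coeff_smul,
    Pi.zero_apply, HahnSeries.coeff_zero]
  module

/-- The solution `t` in the image of `ad h₂` of the equation `y + [t, h₂ - 2 w₂ e₂] = 0` modulo
the kernel of `ad h₂`. -/
def solve (y : FormalVec) : FormalVec :=
  formalVec (nf (Formal.smul (-1 / 2) (y f3))) []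
    (nf (Formal.smul (-1 / 2) (Formal.add (y f1) (Formal.smul 2 (Formal.mul
      (Formal.parityAut revParity (Formal.smul (-1 / 2) (y f3))) (Formal.smul (-2) formalW₂))))))
    [] [] (nf (Formal.smul (1 / 2) (y e1))) []
    (nf (Formal.smul (1 / 2) (Formal.add (y e3) (Formal.mul
      (Formal.parityAut revParity (Formal.smul (1 / 2) (y e1))) (Formal.smul (-2) formalW₂)))))

/-- The equation has at most one solution in the image of `ad h₂`: the components along `f₃` and
`e₁` are determined first, then those along `f₁` and `e₃`. -/
theorem eq_solve {t : OspBasis → PolyG} {y : FormalVec} (ht : ∀ a, eig a = 0 → t a = 0)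
    (h : ∀ a, eig a ≠ 0 → vev y a + vecBracket t (vev square₁) a = 0) : t = vev (solve y) := by
  have z1 := ht f2 rfl
  have z2 := ht h1 rfl
  have z3 := ht h2 rfl
  have z4 := ht e2 rfl
  have hf3 := h f3 (by decide)
  have hf1 := h f1 (by decide)
  have he1 := h e1 (by decide)
  have he3 := h e3 (by decide)
  rw [square₁, vev_formalVec] at hf3 hf1 he1 he3
  have hnil : Formal.eval revParity [] = 0 := rfl
  simp [vecBracket, sum_basis, basisList, structConst, bracketList, vec, parity,
    z1, z2, z3, z4, hnil, ev_const_one] at hf3 hf1 he1 he3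
  change ev (y f3) + _ = 0 at hf3
  change ev (y f1) + _ = 0 at hf1
  change ev (y e1) + _ = 0 at he1
  change ev (y e3) + _ = 0 at he3
  have k1 : t f3 = ev (Formal.smul (-1 / 2) (y f3)) := by
    rw [ev, Formal.eval_smul]
    push_cast
    linear_combination (norm := module) (1 / 2 : ℂ) • hf3
  have k2 : t e1 = ev (Formal.smul (1 / 2) (y e1)) := by
    rw [ev, Formal.eval_smul]
    push_cast
    linear_combination (norm := module) (-1 / 2 : ℂ) • he1
  rw [k1] at hf1
  rw [k2] at he3
  rw [solve, vev_formalVec]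
  ext a
  cases a
  case f3 => rw [k1, vec, ev_nf]
  case e1 => rw [k2, vec, ev_nf]
  case f1 =>
    rw [vec, ev_nf, ev, Formal.eval_smul, Formal.eval_add, Formal.eval_smul, Formal.eval_mul,
      Formal.eval_parityAut]
    push_cast
    linear_combination (norm := module) (1 / 2 : ℂ) • hf1
  case e3 =>
    rw [vec, ev_nf, ev, Formal.eval_smul, Formal.eval_add, Formal.eval_mul,
      Formal.eval_parityAut]
    push_cast
    linear_combination (norm := module) (-1 / 2 : ℂ) • he3
  case f2 => exact z1
  case h1 => exact z2
  case h2 => exact z3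
  case e2 => exact z4

/-- The coefficient of `z⁻¹` in the dressing transformation. -/
def formalT₁ : FormalVec := solve square₀

/-- The part of the coefficient of `z⁻¹` in `e^{ad T}[ℒ^c, ℒ^c]/2` that depends on the coefficient
of `z⁻¹` in `T` only. -/
def square₂ : FormalVec :=
  formalVecAdd (formalVecAdd (formalBracket formalT₁ square₀)
    (formalVecSmul (-1) (formalVecD (formalVecD formalT₁))))
    (formalVecSmul (1 / 2) (formalBracket formalT₁ (formalBracket formalT₁ square₁)))

/-- The coefficient of `z⁻²` in the dressing transformation. -/
def formalT₂ : FormalVec := solve square₂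

section

variable {T H K : LoopG}

theorem IsDressing.inFiltration {w₁ w₂ w₃ w₄ : PolyG} (h : IsDressing w₁ w₂ w₃ w₄ T H K) :
    InFiltration deg 2 1 T :=
  fun a n hn => h.pos a n (by omega)

theorem IsDressing.apply_eq_zero {w₁ w₂ w₃ w₄ : PolyG} (h : IsDressing w₁ w₂ w₃ w₄ T H K)
    {a : OspBasis} (ha : eig a = 0) : T a = 0 := by
  obtain ⟨Z, -, rfl⟩ := h.mem_im
  ext n
  rw [coeff_lamSq_bracket, ha]
  simp

theorem IsDressing.coeff_square {w₁ w₂ w₃ w₄ : PolyG} (h : IsDressing w₁ w₂ w₃ w₄ T H K)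
    {a : OspBasis} (ha : eig a ≠ 0) (n : ℤ) : ((H + LamSq) a).coeff n = 0 := by
  have h1 := congrArg (fun X : LoopG => (X a).coeff (n - 1)) h.mem_ker.2
  have ha' : (eig a : ℂ) ≠ 0 := by exact_mod_cast ha
  simp only [coeff_lamSq_bracket, sub_add_cancel] at h1
  rw [Pi.add_apply, HahnSeries.coeff_add, coeff_lamSq_of_eig_ne_zero ha, add_zero]
  exact (smul_eq_zero_iff_right ha').1 h1

theorem inFiltration_two_monoLoop (u v : OspBasis → PolyG) (hv : v e3 = 0 ∧ v e1 = 0 ∧ v f1 = 0 ∧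
    v f2 = 0 ∧ v f3 = 0 ∧ v h1 = 0) :
    InFiltration deg 2 (-2) (monoLoop 0 u + monoLoop (-1) v) := by
  refine (inFiltration_monoLoop fun a ha => ?_).add (inFiltration_monoLoop fun a ha => ?_)
  · have := deg_le a
    omega
  · cases a <;> simp_all [deg]

/-- There is no term `z⁰ ⊗ e₃` in the dressing transformation, so it starts with `z⁻¹`. -/
theorem IsDressing.level_eq_zero
    (h : IsDressing (ev formalW₁) (ev formalW₂) (ev formalW₃) (ev formalW₄) T H K)
    (n : ℤ) (hn : n < 1) : level n T = 0 := by
  have hneg : ∀ n < 0, level n T = 0 := by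
    intro n hn
    ext a
    have := deg_le a
    exact h.inFiltration a n (by omega)
  obtain hn | rfl : n < 0 ∨ n = 0 := by omega
  · exact hneg n hn
  have h0 : ∀ a, a ≠ e3 → level 0 T a = 0 := by
    intro a ha
    by_cases h' : eig a = 0
    · rw [level, h.apply_eq_zero h']
      rfl
    · refine h.inFiltration a 0 ?_
      cases a <;> simp_all [deg, eig]
  have hs := h.square
  rw [square_eq] at hs
  obtain ⟨X, hX⟩ : ∃ X, monoLoop 0 (vev square₀) + monoLoop (-1) (vev square₁) = X := ⟨_, rfl⟩
  have hXf : InFiltration deg 2 (-2) X := by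
    rw [← hX]
    apply inFiltration_two_monoLoop
    rw [square₁, vev_formalVec]
    exact ⟨rfl, rfl, rfl, rfl, rfl, rfl⟩
  rw [hX] at hs
  have hXl : ∀ n, level n X = (if n = 0 then vev square₀ else 0) +
      if n = -1 then vev square₁ else 0 := by
    intro n
    rw [← level_monoLoop, ← level_monoLoop, ← hX]
    rfl
  have hXn : ∀ n < -1, level n X = 0 := by
    intro n hn
    rw [hXl, if_neg (by omega), if_neg (by omega), add_zero]
  -- only the first order term contributes to the coefficient of `z ⊗ e₃`
  have e := hs.coeff_eq (a := e3) (n := -1) (M := 1) structConst_deg h.inFiltration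
    (inFiltration_first h.inFiltration (inFiltration_loopDD h.inFiltration) hXf) (by decide)
  have eX : (X e3).coeff (-1) = 0 := by
    have := congrFun (hXl (-1)) e3
    rw [level] at this
    rw [this]
    simp [square₁, vev, formalVec, Formal.eval]
  have eD : (loopDD T e3).coeff (-1) = 0 := by
    have : level (-1) (loopDD T) = 0 := by
      rw [loopDD, level_loopD, level_loopD, hneg _ (by norm_num)]
      ext a
      simp [vecD]
    exact congrFun this e3
  have eB : (loopBracket T X e3).coeff (-1) = vecBracket (level 0 T) (vev square₁) e3 := by
    have := congrFun (level_loopBracket hneg hXn (-1)) e3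
    rw [show Finset.Icc (0 : ℤ) (-1 - -1) = {0} by decide, Finset.sum_singleton, hXl] at this
    rw [level] at this
    rw [this]
    simp
  rw [h.coeff_square (by decide), coeff_expAdPartial, Finset.sum_range_one, eX,
    Function.iterate_zero, id_eq, Pi.sub_apply, HahnSeries.coeff_sub, eB] at e
  change 0 = 0 + (_ : ℂ) • (_ - (loopDD T e3).coeff (-1)) at e
  rw [eD, square₁, vev_formalVec] at e
  have hnil : Formal.eval revParity [] = 0 := rfl
  simp [vecBracket, sum_basis, basisList, structConst, bracketList, vec, parity, h0, hnil,
    ev_const_one] at e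
  ext a
  by_cases ha : a = e3
  · subst ha
    exact (smul_eq_zero_iff_right (by norm_num : (-2 : ℂ) ≠ 0)).1 e.symm
  · exact h0 a ha

theorem half_smul_vev (x : FormalVec) : (1 / 2 : ℂ) • vev x = vev (formalVecSmul (1 / 2) x) := by
  rw [← smul_vev]
  norm_num

/-- The first two terms of the dressing transformation. -/
theorem IsDressing.level_eq
    (h : IsDressing (ev formalW₁) (ev formalW₂) (ev formalW₃) (ev formalW₄) T H K) :
    level 1 T = vev formalT₁ ∧ level 2 T = vev formalT₂ := by
  have hs := h.square
  rw [square_eq] at hs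
  obtain ⟨k0, k1, -⟩ := level_expAd (δ := fun x => vecD (vecD x)) h.level_eq_zero
    (fun n => by rw [level_loopD, level_loopD]) (by ext a; simp [vecD]) hs
  have hz : ∀ n a, eig a = 0 → level n T a = 0 := by
    intro n a ha
    rw [level, h.apply_eq_zero ha]
    rfl
  have hT1 : level 1 T = vev formalT₁ := by
    refine eq_solve (hz 1) fun a ha => ?_
    rw [← h.coeff_square ha 0]
    exact (congrFun k0 a).symm
  refine ⟨hT1, eq_solve (hz 2) fun a ha => ?_⟩
  have e : vev square₂ = vecBracket (vev formalT₁) (vev square₀) - vecD (vecD (vev formalT₁)) +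
      (1 / 2 : ℂ) • vecBracket (vev formalT₁) (vecBracket (vev formalT₁) (vev square₁)) := by
    rw [vecBracket_vev, vecBracket_vev, vecBracket_vev, vecD_vev, vecD_vev, vev_sub, half_smul_vev,
      vev_add]
    rfl
  have k := congrFun k1 a
  rw [hT1] at k
  rw [← h.coeff_square ha 1, e]
  change _ = level 1 (H + LamSq) a
  rw [k]
  simp only [Pi.add_apply, Pi.sub_apply, Pi.smul_apply]
  module

/-- The pairing with `h₂ ⊗ zⁿ` reads off the coefficient of `h₁ ⊗ z⁻ⁿ`. -/
theorem density_eq (K : LoopG) (n : ℕ) : density K n = (-4 : ℂ) • (K h1).coeff n := by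
  have hf : ∀ a, form a h2 = if a = h1 then -4 else 0 := by decide
  have ht : ∀ b, b ≠ h2 → tens h2 n 1 b = 0 := by
    intro b hb
    simp [tens, hb]
  have hs : ∀ (c : ℤ) (x : HahnSeries ℤ PolyG), (c • x).coeff 0 = (c : ℂ) • x.coeff 0 :=
    fun c x => (Int.cast_smul_eq_zsmul ℂ c (x.coeff 0)).symm
  rw [density, loopForm, HahnSeries.coeff_sum, Finset.sum_eq_single h1]
  · rw [HahnSeries.coeff_sum, Finset.sum_eq_single h2]
    · rw [hs]
      simp [form, tens, parity, HahnSeries.coeff_mul_single]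
    · intro b _ hb
      rw [hs, ht b hb]
      simp
    · simp
  · intro a _ ha
    rw [HahnSeries.coeff_sum]
    refine Finset.sum_eq_zero fun b _ => ?_
    rw [hs]
    by_cases hb : b = h2
    · subst hb
      simp [hf, ha]
    · rw [ht b hb]
      simp
  · simp

open Formal in
/-- Symbolic form of the density `ρ₂`. -/
def formalRho₂ : FormalG :=
  let D := Formal.D revParity
  add (smul (-4) (mul (mul formalW₁ formalW₃) formalW₄))
    (add (mul (D (D formalW₁)) formalW₄)
      (add (smul (-1) (mul formalW₁ (D (D formalW₄))))
        (add (smul (-2) (mul (mul (D formalW₁) formalW₂) formalW₄))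
          (add (smul (-2) (mul (mul formalW₁ (D formalW₂)) formalW₄))
            (smul (-2) (mul (mul formalW₁ formalW₂) (D formalW₄)))))))

/-- The coefficient of `z⁻³` in `T` enters that of `z⁻²` in `K` through a bracket with `e₂` only,
which has no component along `h₁`. -/
theorem vecBracket_lax₁_h1 (t : OspBasis → PolyG) : vecBracket t (vev lax₁) h1 = 0 := by
  have hs : ∀ a, structConst a e2 h1 = 0 := by decide
  refine Finset.sum_eq_zero fun a _ => Finset.sum_eq_zero fun b _ => ?_
  by_cases hb : b = e2
  · rw [hb, hs, Int.cast_zero, zero_smul]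
  · have : vev lax₁ b = 0 := by cases b <;> first | rfl | exact absurd rfl hb
    rw [this, mul_zero, smul_zero]

/-- The first three densities. -/
theorem IsDressing.density_eq
    (h : IsDressing (ev formalW₁) (ev formalW₂) (ev formalW₃) (ev formalW₄) T H K) :
    density K 0 = ev formalRho₀ ∧ density K 1 = ev formalRho₁ ∧ density K 2 = ev formalRho₂ := by
  have hs := h.lax
  rw [lax_eq] at hs
  obtain ⟨k0, k1, k2⟩ := level_expAd (δ := vecD) h.level_eq_zero
    (fun n => level_loopD n T) (by ext a; simp [vecD]) hs
  have hL : ∀ n, level n (K + Lam) h1 = (K h1).coeff n := by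
    intro n
    simp [level, Lam, tens]
  have g0 := congrFun k0 h1
  have g1 := congrFun k1 h1
  have g2 := congrFun k2 h1
  have h6 : (1 / 6 : ℂ) = ((1 / 6 : ℚ) : ℂ) := by norm_num
  have hT3 : vecBracket (vev formalT₂) (vev lax₀) + vecBracket (level 3 T) (vev lax₁) -
      vecD (vev formalT₂) = vecBracket (vev formalT₂) (vev lax₀) - vecD (vev formalT₂) +
        vecBracket (level 3 T) (vev lax₁) := by abel
  rw [h.level_eq.1, h.level_eq.2, hL] at g2
  rw [h.level_eq.1, h.level_eq.2, hL] at g1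
  rw [h.level_eq.1, hL, Pi.add_apply, vecBracket_lax₁_h1, add_zero] at g0
  rw [hT3, Pi.add_apply, Pi.add_apply, Pi.add_apply, vecBracket_lax₁_h1, add_zero, ← Pi.add_apply,
    ← Pi.add_apply] at g2
  simp only [vecBracket_vev, vecD_vev, vev_add, vev_sub, half_smul_vev, h6, smul_vev] at g1 g2
  have hm : (-4 : ℂ) = ((-4 : ℚ) : ℂ) := by norm_num
  refine ⟨?_, ?_, ?_⟩
  · rw [Osp.density_eq, Nat.cast_zero, g0, hm]
    exact (Formal.eval_smul _ _).symm
  · rw [Osp.density_eq, Nat.cast_one, g1, hm]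
    refine (Formal.eval_smul _ _).symm.trans (Formal.eval_congr code ?_)
    decide +kernel
  · rw [Osp.density_eq, Nat.cast_ofNat, g2, hm]
    refine (Formal.eval_smul _ _).symm.trans (Formal.eval_congr code ?_)
    decide +kernel

end

/-! ### The hierarchy -/

/-- Symbolic form of an element whose derivative is the difference of two representatives of
`∫ρ₂`. -/
def formalPotential : FormalG :=
  let D := Formal.D revParity
  Formal.add (Formal.smul (-1) (Formal.add (Formal.mul formalW₁ (D formalW₄))
    (Formal.mul (D formalW₁) formalW₄)))
    (Formal.smul 2 (Formal.mul (Formal.mul formalW₁ formalW₂) formalW₄))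

theorem ev_formalPotential_mem : ev formalPotential ∈ wAlgebra := by
  have h1 := ev_formalW₁_mem
  have h2 := ev_formalW₂_mem
  have h4 := ev_formalW₄_mem
  simp only [ev, formalPotential, Formal.eval_add, Formal.eval_smul, Formal.eval_mul, Formal.eval_D]
  exact wSubalgebra.add_mem (wSubalgebra.smul_mem (wSubalgebra.add_mem
    (wSubalgebra.mul_mem h1 (D_mem_wAlgebra h4)) (wSubalgebra.mul_mem (D_mem_wAlgebra h1) h4)) _)
    (wSubalgebra.smul_mem (wSubalgebra.mul_mem (wSubalgebra.mul_mem h1 h2) h4) _)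

/-- Symbolic form of the density to which `∫ρ₂` is equal. -/
def formalIntegral₂ : FormalG :=
  let D := Formal.D revParity
  Formal.add (Formal.add (Formal.smul 2 (Formal.mul (D (D formalW₁)) formalW₄))
    (Formal.smul (-4) (Formal.mul (D (Formal.mul formalW₁ formalW₂)) formalW₄)))
    (Formal.smul (-4) (Formal.mul (Formal.mul formalW₁ formalW₃) formalW₄))

theorem ev_formalRho₂ :
    ev formalRho₂ = ev formalIntegral₂ + SuperPoly.D (ev formalPotential) := by
  have h : ev formalRho₂ =
      ev (Formal.add formalIntegral₂ (Formal.D revParity formalPotential)) :=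
    Formal.eval_congr code (by decide +kernel)
  rw [h, ev, Formal.eval_add, Formal.eval_D]

theorem eqFunctional_of_eq {a b : PolyG} (h : a = b) : EqFunctional a b :=
  ⟨0, wSubalgebra.zero_mem, by rw [h, sub_self, map_zero]⟩

theorem ratCast_smul_eq (c : ℤ) (x : PolyG) : (((c : ℚ) : ℂ)) • x = (c : PolyG) * x := by
  rw [Algebra.smul_def, Rat.cast_intCast, map_intCast]

theorem ratCast_neg_smul_eq (c : ℕ) (x : PolyG) :
    (((-(c : ℚ) : ℚ) : ℂ)) • x = -((c : PolyG) * x) := by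
  have h := ratCast_smul_eq c x
  push_cast at h ⊢
  rw [← h]
  module

/-- A form of `neg_mul` that can be used for rewriting in `PolyG`: the instances in the general lemma
agree with those of `RingQuot` only after unfolding. -/
theorem polyG_neg_mul (a b : PolyG) : -a * b = -(a * b) := neg_mul a b

end Osp

end

theorem mainTheorem9 :
    (∃ (N₂ N₃ w₁ w₂ w₃ w₄ : Osp.PolyG) (T H K : Osp.LoopG),
      Osp.IsCanonicalForm N₂ N₃ w₁ w₂ w₃ w₄ ∧ Osp.IsDressing w₁ w₂ w₃ w₄ T H K) ∧
    ∀ (N₂ N₃ w₁ w₂ w₃ w₄ : Osp.PolyG) (T H K : Osp.LoopG),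
      Osp.IsCanonicalForm N₂ N₃ w₁ w₂ w₃ w₄ → Osp.IsDressing w₁ w₂ w₃ w₄ T H K →
      (w₁ ∈ Osp.wAlgebra ∧ w₂ ∈ Osp.wAlgebra ∧ w₃ ∈ Osp.wAlgebra ∧ w₄ ∈ Osp.wAlgebra) ∧
      (Osp.flow (Osp.density K 0) w₁ = 2 * w₁ ∧
        Osp.flow (Osp.density K 0) w₂ = 0 ∧
        Osp.flow (Osp.density K 0) w₃ = 0 ∧
        Osp.flow (Osp.density K 0) w₄ = -2 * w₄) ∧
      (Osp.flow (Osp.density K 1) w₁ = SuperPoly.D (SuperPoly.D w₁) - 2 * SuperPoly.D (w₁ * w₂) - 2 * (w₁ * w₃) ∧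
        Osp.flow (Osp.density K 1) w₂ = 0 ∧
        Osp.flow (Osp.density K 1) w₃ = -8 * (w₁ * w₂ * w₄) ∧
        Osp.flow (Osp.density K 1) w₄ = SuperPoly.D (SuperPoly.D w₄) + 2 * (w₂ * SuperPoly.D w₄) + 2 * (w₃ * w₄)) ∧
      Osp.EqFunctional (Osp.density K 0) (-4 * w₂) ∧
      Osp.EqFunctional (Osp.density K 1) (4 * (w₁ * w₄)) ∧
      Osp.EqFunctional (Osp.density K 2)
        (2 * (SuperPoly.D (SuperPoly.D w₁) * w₄) - 4 * (SuperPoly.D (w₁ * w₂) * w₄) - 4 * (w₁ * w₃ * w₄)) := by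
  open Osp in
  refine ⟨?_, ?_⟩
  · obtain ⟨T, H, K, h⟩ := exists_isDressing
      (ev_mem_goodCoeff (k := 1) (a := .f1) ev_formalW₁_mem (by decide +kernel))
      (ev_mem_goodCoeff (k := 1) (a := .h1) ev_formalW₂_mem (by decide +kernel))
      (ev_mem_goodCoeff (k := 1) (a := .e2) ev_formalW₃_mem (by decide +kernel))
      (ev_mem_goodCoeff (k := 1) (a := .e3) ev_formalW₄_mem (by decide +kernel))
    exact ⟨_, _, _, _, _, _, T, H, K, isCanonicalForm_formal, h⟩
  · intro N₂ N₃ w₁ w₂ w₃ w₄ T H K hc hd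
    obtain ⟨rfl, rfl, rfl, rfl⟩ := hc.eq_formal
    obtain ⟨r0, r1, r2⟩ := hd.density_eq
    rw [r0, r1, r2]
    obtain ⟨a1, a2, a3, a4⟩ := flow_formalRho₀
    obtain ⟨b1, b2, b3, b4⟩ := flow_formalRho₁
    have s2 (x : PolyG) : ((2 : ℚ) : ℂ) • x = 2 * x := by simpa using ratCast_smul_eq 2 x
    have s4 (x : PolyG) : ((4 : ℚ) : ℂ) • x = 4 * x := by simpa using ratCast_smul_eq 4 x
    have m2 (x : PolyG) : ((-2 : ℚ) : ℂ) • x = -(2 * x) := by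
      simpa using ratCast_neg_smul_eq 2 x
    have m4 (x : PolyG) : ((-4 : ℚ) : ℂ) • x = -(4 * x) := by
      simpa using ratCast_neg_smul_eq 4 x
    have m8 (x : PolyG) : ((-8 : ℚ) : ℂ) • x = -(8 * x) := by
      simpa using ratCast_neg_smul_eq 8 x
    refine ⟨⟨ev_formalW₁_mem, ev_formalW₂_mem, ev_formalW₃_mem, ev_formalW₄_mem⟩,
      ⟨?_, a2, a3, ?_⟩, ⟨?_, b2, ?_, ?_⟩, ?_, ?_, ?_⟩
    · rw [a1, ev, SuperPoly.Formal.eval_smul, s2]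
    · rw [a4, ev, SuperPoly.Formal.eval_smul, m2, polyG_neg_mul]
    · rw [b1]
      simp only [ev, SuperPoly.Formal.eval_smul, SuperPoly.Formal.eval_add,
        SuperPoly.Formal.eval_mul, SuperPoly.Formal.eval_D, m2, sub_eq_add_neg, add_assoc]
    · rw [b3]
      simp only [ev, SuperPoly.Formal.eval_smul, SuperPoly.Formal.eval_mul, m8, polyG_neg_mul]
    · rw [b4]
      simp only [ev, SuperPoly.Formal.eval_smul, SuperPoly.Formal.eval_add,
        SuperPoly.Formal.eval_mul, SuperPoly.Formal.eval_D, s2]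
      noncomm_ring
    · apply eqFunctional_of_eq
      rw [formalRho₀, ev, SuperPoly.Formal.eval_smul, m4, polyG_neg_mul]
    · apply eqFunctional_of_eq
      rw [formalRho₁, ev_nf, ev, SuperPoly.Formal.eval_smul, SuperPoly.Formal.eval_mul, s4]
    · refine ⟨ev formalPotential, ev_formalPotential_mem, ?_⟩
      rw [ev_formalRho₂]
      simp only [ev, formalIntegral₂, SuperPoly.Formal.eval_smul, SuperPoly.Formal.eval_add,
        SuperPoly.Formal.eval_mul, SuperPoly.Formal.eval_D, s2, m4, ← sub_eq_add_neg]
      exact add_sub_cancel_left _ _
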